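/- Let $L,B,K_d,\rho_o,V_{eff},S_{eff},\zeta>0$ be constants, and set $$F_d(l,N)=\frac{K_d\,\rho_o V_{eff}N\,(L-l)}{B\rho_o+K_d(L-l)},\qquad F(l,N,f)=\frac{F_d(l,N)-\rho_oV_{eff}N f}{\rho_oS_{eff}(1-f)},\qquad \alpha_p(x,N,l,f)=\frac{1}{l}\bigl(\zeta N-xF(l,N,f)\bigr).$$ Let $T>0$, $Q=(0,T)\times(0,1)$, and let $(l_e,N_e,f_{pe})$ be a constant equilibrium: $F(l_e,N_e,f_{pe})=0$, with $0<l_e<L$, $N_e>0$ and $0<f_{pe}<1$. For data $l^0\in(0,L)$, $f_p^0$, and $F_{in},N\in W^{1,\infty}(0,T)$, write $h=\frac{F_{in}}{\rho_oV_{eff}N}$ and consider the Cauchy problem for $(l,f_p)$ $$\begin{cases}\dot l(t)=F(l(t),N(t),f_p(t,1)),\quad t\in(0,T),\\ l(0)=l^0,\\ \partial_tf_p+\alpha_p(x,N(t),l(t),f_p(t,1))\,\partial_xf_p=0\ \text{ in }Q,\\ f_p(0,x)=f_p^0(x),\ x\in(0,1),\qquad f_p(t,0)=h(t),\ t\in(0,T).\end{cases}\tag{1}$$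 The differential equations hold almost everywhere, for weak derivatives. Continuous representatives are used throughout. Theorem. There exist $\varepsilon_0>0$ and $C>0$, depending only on the above constants, on $T$ and on the equilibrium, such that the following holds for every $\varepsilon\in(0,\varepsilon_0]$. Suppose that $f_p^0\in H^2(0,1)$ and $h\in H^2(0,T)$, that the compatibility conditions $$h(0)=f_p^0(0),\qquad (f_p^0)_x(0)+\frac{l^0}{\zeta N(0)}\,h'(0)=0$$ hold, and that $$\|f_p^0-f_{pe}\|_{H^2(0,1)}+\|h-f_{pe}\|_{H^2(0,T)}+\|N-N_e\|_{W^{1,\infty}(0,T)}+|l^0-l_e|\le\varepsilon .$$ Then (1) has a solution $(l,f_p)$ with $l\in W^{1,\infty}(0,T)$ and $f_p\in W^{1,\infty}(Q)\cap C^0([0,T];H^2(0,1))$. It satisfies $0<l(t)<L$ on $[0,T]$ and $0<f_p<1$ on $[0,T]\times[0,1]$, as well as $$\|f_p-f_{pe}\|_{C^0([0,T];H^2(0,1))}\le C\varepsilon,\qquad \|f_p-f_{pe}\|_{W^{1,\infty}(Q)}\le C\varepsilon,\qquad \|l-l_e\|_{W^{1,\infty}(0,T)}\le C\varepsilon .$$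 This solution is unique in $W^{1,\infty}(0,T)\times C^0([0,T];H^2(0,1))$, and also in $W^{1,\infty}(0,T)\times W^{1,\infty}(Q)$. -/

import Mathlib

open MeasureTheory Set Filter Topology
open scoped ENNReal ContDiff

/-! ### Weak derivatives and Sobolev spaces

Elements of `W^{1,∞}(a,b)`, `H²(a,b)` and of the spaces of functions on the rectangle below are
identified with their continuous representative on the closed interval (rectangle), so that the
traces occurring in initial, boundary and compatibility conditions are plain values. -/

/-- `v` is the weak derivative of `u` on the open set `Ω` in the direction `e`:
`∫_Ω u ∂_e φ = - ∫_Ω v φ` for all `φ ∈ C_c^∞(Ω)`, with `u, v ∈ L¹_loc(Ω)`. -/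
def HasWeakDeriv {E : Type*} [NormedAddCommGroup E] [NormedSpace ℝ E] [MeasureSpace E]
    (Ω : Set E) (e : E) (u v : E → ℝ) : Prop :=
  LocallyIntegrableOn u Ω volume ∧ LocallyIntegrableOn v Ω volume ∧
    ∀ φ : E → ℝ, ContDiff ℝ ∞ φ → HasCompactSupport φ → tsupport φ ⊆ Ω →
      ∫ x in Ω, u x * fderiv ℝ φ x e = - ∫ x in Ω, v x * φ x

/-- The `L^p` (extended) norm on a set, with respect to Lebesgue measure. -/
noncomputable def normLp {E : Type*} [MeasureSpace E] (Ω : Set E) (p : ℝ≥0∞) (u : E → ℝ) : ℝ≥0∞ :=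
  eLpNorm u p (volume.restrict Ω)

/-- The norm of `W^{1,∞}(a,b)`, namely `‖u‖_∞ + ‖u'‖_∞`; the weak derivative is unique almost
everywhere, and the value is `⊤` when there is none. -/
noncomputable def w1infNorm (a b : ℝ) (u : ℝ → ℝ) : ℝ≥0∞ :=
  ⨅ (v : ℝ → ℝ) (_ : HasWeakDeriv (Ioo a b) 1 u v), normLp (Ioo a b) ⊤ u + normLp (Ioo a b) ⊤ v

/-- `u ∈ W^{1,∞}(a,b)`, `u` being the continuous representative. -/
def MemW1inf (a b : ℝ) (u : ℝ → ℝ) : Prop :=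
  ContinuousOn u (Icc a b) ∧ w1infNorm a b u < ⊤

/-- The norm of `H²(a,b)`, namely `(‖u‖² + ‖u'‖² + ‖u''‖²)^{1/2}` with `L²(a,b)` norms; the value is
`⊤` when `u ∉ H²(a,b)`. -/
noncomputable def h2Norm (a b : ℝ) (u : ℝ → ℝ) : ℝ≥0∞ :=
  ⨅ (v : ℝ → ℝ) (w : ℝ → ℝ) (_ : HasWeakDeriv (Ioo a b) 1 u v)
    (_ : HasWeakDeriv (Ioo a b) 1 v w),
    (normLp (Ioo a b) 2 u ^ 2 + normLp (Ioo a b) 2 v ^ 2 + normLp (Ioo a b) 2 w ^ 2) ^ (1 / 2 : ℝ)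

/-- `u ∈ H²(a,b)`, `u` being the continuous representative (which is then `C¹` on `[a,b]`). -/
def MemH2 (a b : ℝ) (u : ℝ → ℝ) : Prop :=
  ContinuousOn u (Icc a b) ∧ h2Norm a b u < ⊤

/-- The open rectangle `Q = (0,T) × (0,1)`, with points `(t,x)`. -/
def rectQ (T : ℝ) : Set (ℝ × ℝ) := Ioo 0 T ×ˢ Ioo 0 1

/-- The norm of `W^{1,∞}(Q)`, namely `‖f‖_∞ + ‖∂_t f‖_∞ + ‖∂_x f‖_∞`. -/
noncomputable def w1infNormQ (T : ℝ) (f : ℝ → ℝ → ℝ) : ℝ≥0∞ :=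
  ⨅ (ft : ℝ × ℝ → ℝ) (fx : ℝ × ℝ → ℝ)
    (_ : HasWeakDeriv (rectQ T) (1, 0) (fun p => f p.1 p.2) ft)
    (_ : HasWeakDeriv (rectQ T) (0, 1) (fun p => f p.1 p.2) fx),
    normLp (rectQ T) ⊤ (fun p => f p.1 p.2) + normLp (rectQ T) ⊤ ft + normLp (rectQ T) ⊤ fx

/-- `f ∈ W^{1,∞}(Q)`, `f` being the continuous representative on `[0,T] × [0,1]`. -/
def MemW1infQ (T : ℝ) (f : ℝ → ℝ → ℝ) : Prop :=
  ContinuousOn (fun p : ℝ × ℝ => f p.1 p.2) (Icc 0 T ×ˢ Icc 0 1) ∧ w1infNormQ T f < ⊤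

/-- `f ∈ C⁰([0,T]; H²(0,1))`. -/
def MemC0H2 (T : ℝ) (f : ℝ → ℝ → ℝ) : Prop :=
  (∀ t ∈ Icc 0 T, MemH2 0 1 (f t)) ∧
    ∀ t ∈ Icc 0 T,
      Tendsto (fun s => h2Norm 0 1 (fun x => f s x - f t x)) (𝓝[Icc 0 T] t) (𝓝 0)

/-! ### The extruder model -/

/-- The physical constants of the extruder. -/
structure Extruder where
  /-- extruder length -/
  L : ℝ
  /-- geometric parameter (pressure flow coefficient) -/
  B : ℝ
  /-- geometric parameter of the die -/
  Kd : ℝ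
  /-- melt density -/
  rho : ℝ
  /-- effective volume -/
  Veff : ℝ
  /-- effective area -/
  Seff : ℝ
  /-- screw pitch -/
  zeta : ℝ
  L_pos : 0 < L
  B_pos : 0 < B
  Kd_pos : 0 < Kd
  rho_pos : 0 < rho
  Veff_pos : 0 < Veff
  Seff_pos : 0 < Seff
  zeta_pos : 0 < zeta

namespace Extruder

/-- Net forward mass flow rate `F_d` at the die, for interface position `l` and screw speed `N`. -/
noncomputable def Fd (P : Extruder) (l N : ℝ) : ℝ :=
  P.Kd * P.rho * P.Veff * N * (P.L - l) / (P.B * P.rho + P.Kd * (P.L - l))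

/-- The interface velocity `F(l, N, f)`. -/
noncomputable def F (P : Extruder) (l N f : ℝ) : ℝ :=
  (P.Fd l N - P.rho * P.Veff * N * f) / (P.rho * P.Seff * (1 - f))

/-- The normalized transport velocity `α_p(x, N, l, f)`. -/
noncomputable def alpha (P : Extruder) (x N l f : ℝ) : ℝ :=
  (1 / l) * (P.zeta * N - x * P.F l N f)

/-- The boundary value `F_in(t) / (ρ V_eff N(t))` of the filling ratio. -/
noncomputable def inflow (P : Extruder) (Fi N : ℝ → ℝ) (t : ℝ) : ℝ :=
  Fi t / (P.rho * P.Veff * N t)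

/-- `(l, f)` solves on `[0,T]` the Cauchy problem
`l' = F(l, N, f(·,1))`, `l(0) = l0`,
`∂_t f + α_p(x, N, l, f(·,1)) ∂_x f = 0` in `Q`, `f(0,·) = f0`, `f(·,0) = F_in / (ρ V_eff N)`,
with `l ∈ W^{1,∞}(0,T)` and `f` continuous on `[0,T] × [0,1]`. The differential equations hold almost
everywhere for the weak derivatives. -/
structure IsSolution (P : Extruder) (T l0 : ℝ) (f0 Fi N : ℝ → ℝ) (l : ℝ → ℝ) (f : ℝ → ℝ → ℝ) :
    Prop where
  l_mem : MemW1inf 0 T l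
  f_cont : ContinuousOn (fun p : ℝ × ℝ => f p.1 p.2) (Icc 0 T ×ˢ Icc 0 1)
  ode : HasWeakDeriv (Ioo 0 T) 1 l (fun t => P.F (l t) (N t) (f t 1))
  l_init : l 0 = l0
  pde : ∃ ft fx : ℝ × ℝ → ℝ,
    HasWeakDeriv (rectQ T) (1, 0) (fun p => f p.1 p.2) ft ∧
    HasWeakDeriv (rectQ T) (0, 1) (fun p => f p.1 p.2) fx ∧
    ∀ᵐ p ∂(volume.restrict (rectQ T)),
      ft p + P.alpha p.2 (N p.1) (l p.1) (f p.1 1) * fx p = 0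
  f_init : ∀ x ∈ Icc (0 : ℝ) 1, f 0 x = f0 x
  f_bdry : ∀ t ∈ Icc 0 T, f t 0 = P.inflow Fi N t

end Extruder

/-! ### Test functions with a continuous derivative in one direction only -/

section WeakDerivGeneral

open Convolution ContinuousLinearMap

variable {E : Type*} [NormedAddCommGroup E] [NormedSpace ℝ E] [MeasureSpace E] [BorelSpace E]
  [FiniteDimensional ℝ E] [(volume : Measure E).IsAddHaarMeasure]

/-! If `x' = α` and `l' = F`, then `(l x)' = ζ N`, so `z = l x - ζ ∫₀ᵗ N` is conserved along every
characteristic. A solution therefore has the form `f(t, x) = G(l(t) x - ζ ∫₀ᵗ N)` with a profile `G`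
of one variable. This profile does not involve the unknown `l`: on `[0, l⁰]` it is the rescaled
initial datum, and for negative `z` it is the inflow read in the variable `-ζ ∫₀ᵗ N`. The two
compatibility conditions match `G` and `G'` at `z = 0`, so `G''` is square integrable, and both `G'`
and `G''` are of size `ε` (`exists_profile`).

The coupled problem thus reduces to the scalar equation `l' = F(l, N, G(l - ζ ∫₀ᵗ N))`. Near the
equilibrium `F` is Lipschitz, proportional to `N`, and zero at the equilibrium itself. After
truncation to a box the equation is globally solvable. Gronwall's inequality keeps its solution
within `O(ε)` of `l_e`, so for small `ε` the truncation is never active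
(`Extruder.exists_interface`). Each time slice of `f` is an affine substitution into `G`; this gives
the `H²` bounds, and continuity of dilations and translations in `L²` gives continuity in time
(`memC0H2_slice`).

For uniqueness, let a competing weak solution stay in the box up to time `τ`. Its interface is then
`C¹`, and the velocity is nonnegative at `x = 1` because `|F(·, 1, ·)| ≤ ζ` in the box, so
information enters only through the data. Testing the weak equation with functions of `z` shows that
a continuous weak solution is constant along characteristics
(`TransportCoeff.eq_along_characteristic`), hence equal to the same profile `G` along its own
interface. Both interfaces solve one Lipschitz equation and coincide. The constructed solution lies
strictly inside the box, so a first exit time of the competitor is impossible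
(`Extruder.IsProfileSolution.eq_of_isSolution`).

The coefficients `N` and `l'` are only continuous in time as far as the transport argument is
concerned. This is why the weak formulation is first extended to test functions differentiable in a
single direction. -/

lemma abs_normed_convolution_le (B : ContDiffBump (0 : E)) {φ : E → ℝ} {C : ℝ}
    (hC : ∀ x, |φ x| ≤ C) (x : E) :
    |(B.normed volume ⋆[lsmul ℝ ℝ, volume] φ) x| ≤ C := by
  have hi : Integrable (fun y => B.normed volume y) (volume : Measure E) := B.integrable_normed
  calc |(B.normed volume ⋆[lsmul ℝ ℝ, volume] φ) x|
      = ‖∫ y, B.normed volume y * φ (x - y)‖ := by simp [convolution]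
    _ ≤ ∫ y, B.normed volume y * C := by
        refine norm_integral_le_of_norm_le (hi.mul_const C) (Eventually.of_forall fun y => ?_)
        rw [norm_mul, Real.norm_of_nonneg (B.nonneg_normed y)]
        exact mul_le_mul_of_nonneg_left (hC _) (B.nonneg_normed y)
    _ = C := by rw [integral_mul_const, B.integral_normed, one_mul]

/-- Mollification commutes with a directional derivative even if `φ` is differentiable in that
direction only: differentiate under the integral with the derivative falling on `φ`. -/
lemma fderiv_normed_convolution (B : ContDiffBump (0 : E)) {φ ψ : E → ℝ} {e : E}
    (hφ : Continuous φ) (hψ : Continuous ψ) {C D : ℝ} (hC : ∀ x, |φ x| ≤ C) (hD : ∀ x, |ψ x| ≤ D)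
    (hd : ∀ x, HasLineDerivAt ℝ φ (ψ x) x e) (x : E) :
    fderiv ℝ (B.normed volume ⋆[lsmul ℝ ℝ, volume] φ) x e
      = (B.normed volume ⋆[lsmul ℝ ℝ, volume] ψ) x := by
  have hi : Integrable (fun y => B.normed volume y) (volume : Measure E) := B.integrable_normed
  have hsm : ContDiff ℝ ∞ (B.normed volume ⋆[lsmul ℝ ℝ, volume] φ) :=
    B.hasCompactSupport_normed.contDiff_convolution_left (lsmul ℝ ℝ) B.contDiff_normed
      hφ.locallyIntegrable
  have h1 : HasLineDerivAt ℝ (B.normed volume ⋆[lsmul ℝ ℝ, volume] φ)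
      (fderiv ℝ (B.normed volume ⋆[lsmul ℝ ℝ, volume] φ) x e) x e :=
    ((hsm.differentiable (by simp)) x).hasFDerivAt.hasLineDerivAt e
  have hmeas : ∀ (χ : E → ℝ) (z : E), Continuous χ →
      AEStronglyMeasurable (fun y => B.normed volume y * χ (z - y)) volume := fun χ z h =>
    (B.continuous_normed.mul (h.comp (continuous_const.sub continuous_id))).aestronglyMeasurable
  have h2 : HasLineDerivAt ℝ (B.normed volume ⋆[lsmul ℝ ℝ, volume] φ)
      ((B.normed volume ⋆[lsmul ℝ ℝ, volume] ψ) x) x e := by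
    have key := hasDerivAt_integral_of_dominated_loc_of_deriv_le (μ := (volume : Measure E))
      (F := fun (s : ℝ) y => B.normed volume y * φ (x + s • e - y))
      (F' := fun (s : ℝ) y => B.normed volume y * ψ (x + s • e - y)) (x₀ := 0)
      (bound := fun y => B.normed volume y * D) (s := univ) univ_mem
      (Eventually.of_forall fun s => hmeas φ _ hφ)
      ((hi.mul_const C).mono' (hmeas φ _ hφ) (Eventually.of_forall fun y => by
        rw [norm_mul, Real.norm_of_nonneg (B.nonneg_normed y)]
        exact mul_le_mul_of_nonneg_left (hC _) (B.nonneg_normed y)))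
      (hmeas ψ _ hψ)
      (Eventually.of_forall fun y s _ => by
        rw [norm_mul, Real.norm_of_nonneg (B.nonneg_normed y)]
        exact mul_le_mul_of_nonneg_left (hD _) (B.nonneg_normed y))
      (hi.mul_const D)
      (Eventually.of_forall fun y s _ => by
        have h := hd (x + s • e - y)
        unfold HasLineDerivAt at h
        have h' : HasDerivAt (fun t : ℝ => φ (x + s • e - y + (t - s) • e))
            (ψ (x + s • e - y)) s := by
          have := HasDerivAt.comp_sub_const (f := fun t : ℝ => φ (x + s • e - y + t • e)) s s
            (by simpa using h)
          exact this
        have h'' : (fun t : ℝ => φ (x + s • e - y + (t - s) • e))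
            = fun t : ℝ => φ (x + t • e - y) := by
          funext t; congr 1; rw [sub_smul]; abel
        rw [h''] at h'
        exact h'.const_mul _)
    have := key.2
    simp only [zero_smul, add_zero] at this
    exact this
  exact h1.unique h2

lemma MeasureTheory.LocallyIntegrableOn.integrableOn_mul_of_hasCompactSupport {E : Type*}
    [NormedAddCommGroup E] [NormedSpace ℝ E] [MeasureSpace E] [BorelSpace E]
    [FiniteDimensional ℝ E] {Ω : Set E} {w χ : E → ℝ} (hw : LocallyIntegrableOn w Ω volume)
    (hχ : Continuous χ) (hc : HasCompactSupport χ) (hs : tsupport χ ⊆ Ω) :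
    IntegrableOn (fun x => w x * χ x) Ω volume := by
  have : ProperSpace E := FiniteDimensional.proper ℝ E
  have h1 : IntegrableOn w (tsupport χ) volume := hw.integrableOn_compact_subset hs hc
  have h2 := h1.mul_continuousOn hχ.continuousOn hc
  have h3 : Integrable (fun x => w x * χ x) volume := by
    rw [← integrableOn_iff_integrable_of_support_subset (s := tsupport χ)]
    · exact h2
    · intro x hx
      refine subset_closure fun h0 => ?_
      simp only [Function.mem_support] at hx
      exact hx (by simp [h0])
  exact h3.integrableOn

/-- Mollify `φ` and pass to the limit on both sides. The gain is that `φ` may be nonsmooth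
transversally to `e`, as happens with test functions built from `N` and `l'`. -/
theorem HasWeakDeriv.integral_mul_of_hasLineDerivAt {Ω : Set E} {e : E} {u v φ ψ : E → ℝ}
    (h : HasWeakDeriv Ω e u v) (hΩ : IsOpen Ω) (hφ : Continuous φ) (hψ : Continuous ψ)
    (hc : HasCompactSupport φ) (hs : tsupport φ ⊆ Ω)
    (hd : ∀ x, HasLineDerivAt ℝ φ (ψ x) x e) :
    ∫ x in Ω, u x * ψ x = - ∫ x in Ω, v x * φ x := by
  have : ProperSpace E := FiniteDimensional.proper ℝ E
  obtain ⟨δ, hδ, hK⟩ := hc.isCompact.exists_cthickening_subset_open hΩ hs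
  set K := Metric.cthickening δ (tsupport φ) with hKdef
  have hKc : IsCompact K := hc.isCompact.cthickening
  have hψ0 : ∀ x, x ∉ tsupport φ → ψ x = 0 := fun x hx => by
    have h0 : φ =ᶠ[𝓝 x] fun _ => 0 := notMem_tsupport_iff_eventuallyEq.mp hx
    have h1 : HasLineDerivAt ℝ φ 0 x e :=
      ((hasFDerivAt_const (0 : ℝ) x).congr_of_eventuallyEq h0).hasLineDerivAt e
    exact (hd x).unique h1
  have hψs : Function.support ψ ⊆ tsupport φ := fun x hx => by
    by_contra h'; exact hx (hψ0 x h')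
  have hψc : HasCompactSupport ψ := HasCompactSupport.of_support_subset_isCompact hc hψs
  obtain ⟨C, hC⟩ := hφ.bounded_above_of_compact_support hc
  obtain ⟨D, hD⟩ := hψ.bounded_above_of_compact_support hψc
  -- Radii at most `δ` keep every mollified function supported in the compact thickening `K ⊆ Ω`.
  let B : ℕ → ContDiffBump (0 : E) := fun n =>
    ⟨δ / (n + 2) / 2, δ / (n + 2), by positivity, by
      have : 0 < δ / (n + 2) := by positivity
      linarith⟩
  have hBδ : ∀ n, (B n).rOut ≤ δ := fun n => by
    change δ / (n + 2) ≤ δ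
    apply div_le_self hδ.le
    have : (0 : ℝ) ≤ n := Nat.cast_nonneg n
    linarith
  have hB0 : Tendsto (fun n => (B n).rOut) atTop (𝓝 0) := by
    change Tendsto (fun n : ℕ => δ / (n + 2)) atTop (𝓝 0)
    exact tendsto_const_nhds.div_atTop
      (tendsto_atTop_add_const_right _ _ tendsto_natCast_atTop_atTop)
  have hsupp : ∀ (χ : E → ℝ), Function.support χ ⊆ tsupport φ → ∀ n x, x ∉ K →
      ((B n).normed volume ⋆[lsmul ℝ ℝ, volume] χ) x = 0 := by
    intro χ hχ n x hx
    by_contra h0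
    have := support_convolution_subset (lsmul ℝ ℝ) (μ := (volume : Measure E))
      (f := (B n).normed volume) (g := χ) h0
    obtain ⟨y, hy, z, hz, rfl⟩ := Set.mem_add.mp this
    apply hx
    rw [(B n).support_normed_eq] at hy
    refine Metric.mem_cthickening_of_dist_le _ z _ _ (hχ hz) ?_
    simp only [dist_eq_norm, add_sub_cancel_right]
    have : ‖y‖ < (B n).rOut := by simpa using hy
    exact this.le.trans (hBδ n)
  -- Dominated convergence: the mollified functions are bounded by `M` and vanish off `K`, where `w`
  -- is integrable.
  have hlim : ∀ (w χ : E → ℝ) (M : ℝ), LocallyIntegrableOn w Ω volume → Continuous χ →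
      (∀ x, |χ x| ≤ M) → Function.support χ ⊆ tsupport φ →
      Tendsto (fun n => ∫ x in Ω, w x * ((B n).normed volume ⋆[lsmul ℝ ℝ, volume] χ) x) atTop
        (𝓝 (∫ x in Ω, w x * χ x)) := by
    intro w χ M hw hχ hM hsχ
    have hcont : ∀ n, Continuous ((B n).normed volume ⋆[lsmul ℝ ℝ, volume] χ) := fun n =>
      ((B n).hasCompactSupport_normed.contDiff_convolution_left (n := 0) (lsmul ℝ ℝ)
        (B n).contDiff_normed hχ.locallyIntegrable).continuous
    have hwK : IntegrableOn w K volume := hw.integrableOn_compact_subset hK hKc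
    have hwm : AEStronglyMeasurable w (volume.restrict Ω) :=
      hw.aestronglyMeasurable
    refine tendsto_integral_of_dominated_convergence
      (bound := K.indicator (fun x => |w x| * M)) (fun n => hwm.mul (hcont n).aestronglyMeasurable)
      ?_ ?_ ?_
    · refine Integrable.mono_measure ?_ Measure.restrict_le_self
      rw [integrable_indicator_iff hKc.measurableSet]
      exact (hwK.abs).mul_const M
    · intro n
      refine Eventually.of_forall fun x => ?_
      by_cases hx : x ∈ K
      · rw [indicator_of_mem hx, norm_mul]
        exact mul_le_mul_of_nonneg_left (abs_normed_convolution_le _ hM x) (abs_nonneg _)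
      · rw [hsupp χ hsχ n x hx, indicator_of_notMem hx]; simp
    · refine Eventually.of_forall fun x => ?_
      exact (ContDiffBump.convolution_tendsto_right_of_continuous hB0 hχ x).const_mul _
  have heq : ∀ n, ∫ x in Ω, u x * ((B n).normed volume ⋆[lsmul ℝ ℝ, volume] ψ) x
      = - ∫ x in Ω, v x * ((B n).normed volume ⋆[lsmul ℝ ℝ, volume] φ) x := by
    intro n
    have hts : tsupport ((B n).normed volume ⋆[lsmul ℝ ℝ, volume] φ) ⊆ K := by
      refine closure_minimal (fun x hx => ?_) hKc.isClosed
      by_contra h'; exact hx (hsupp φ subset_closure n x h')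
    have := h.2.2 ((B n).normed volume ⋆[lsmul ℝ ℝ, volume] φ)
      ((B n).hasCompactSupport_normed.contDiff_convolution_left (lsmul ℝ ℝ)
        (B n).contDiff_normed hφ.locallyIntegrable)
      (HasCompactSupport.of_support_subset_isCompact hKc (subset_closure.trans hts))
      (hts.trans hK)
    simpa only [fderiv_normed_convolution (B n) hφ hψ hC hD hd] using this
  have l1 := hlim u ψ D h.1 hψ hD hψs
  have l2 := hlim v φ C h.2.1 hφ hC subset_closure
  simp only [heq] at l1
  exact tendsto_nhds_unique l1 l2.neg

theorem HasWeakDeriv.of_hasLineDerivAt {Ω : Set E} {e : E} {u v : E → ℝ}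
    (hu : Continuous u) (hv : Continuous v) (hd : ∀ x, HasLineDerivAt ℝ u (v x) x e) :
    HasWeakDeriv Ω e u v := by
  refine ⟨hu.locallyIntegrable.locallyIntegrableOn _, hv.locallyIntegrable.locallyIntegrableOn _,
    fun φ hφ hc hs => ?_⟩
  have hφ' : Continuous fun x => fderiv ℝ φ x e :=
    (hφ.continuous_fderiv (by simp)).clm_apply continuous_const
  have hc' : HasCompactSupport fun x => fderiv ℝ φ x e := hc.fderiv_apply (𝕜 := ℝ) e
  have h0 : ∀ x, x ∉ Ω → φ x = 0 := fun x hx => image_eq_zero_of_notMem_tsupport fun h => hx (hs h)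
  have h0' : ∀ x, x ∉ Ω → fderiv ℝ φ x e = 0 := fun x hx => by
    have : x ∉ tsupport (fderiv ℝ φ) := fun h => hx (hs (tsupport_fderiv_subset ℝ h))
    rw [image_eq_zero_of_notMem_tsupport this]; rfl
  rw [setIntegral_eq_integral_of_forall_compl_eq_zero (fun x hx => by rw [h0' x hx, mul_zero]),
    setIntegral_eq_integral_of_forall_compl_eq_zero (fun x hx => by rw [h0 x hx, mul_zero])]
  refine integral_bilinear_hasLineDerivAt_right_eq_neg_left_of_integrable
    (B := ContinuousLinearMap.mul ℝ ℝ) (f := u) (f' := v) (g := φ)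
    (g' := fun x => fderiv ℝ φ x e) (v := e) ?_ ?_ ?_ (fun x _ => hd x)
    (fun x _ => ((hφ.differentiable (by simp)) x).hasFDerivAt.hasLineDerivAt e)
  · exact (hv.mul hφ.continuous).integrable_of_hasCompactSupport hc.mul_left
  · exact (hu.mul hφ').integrable_of_hasCompactSupport hc'.mul_left
  · exact (hu.mul hφ.continuous).integrable_of_hasCompactSupport hc.mul_left

end WeakDerivGeneral

/-! ### Weak derivatives on an interval and primitives -/

section OneDim

lemma continuous_deriv_smoothTransition : Continuous (deriv Real.smoothTransition) :=
  (Real.smoothTransition.contDiff (n := 1)).continuous_deriv le_rfl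

lemma deriv_smoothTransition_eq_zero {x : ℝ} (hx : x ∉ Icc (0 : ℝ) 1) :
    deriv Real.smoothTransition x = 0 := by
  rcases lt_or_ge x 0 with h | h
  · have : Real.smoothTransition =ᶠ[𝓝 x] fun _ => 0 := by
      filter_upwards [Iio_mem_nhds h] with y hy
      exact Real.smoothTransition.zero_of_nonpos (le_of_lt hy)
    rw [this.deriv_eq]; simp
  · have h1 : 1 < x := by
      by_contra h'; exact hx ⟨h, not_lt.mp h'⟩
    have : Real.smoothTransition =ᶠ[𝓝 x] fun _ => 1 := by
      filter_upwards [Ioi_mem_nhds h1] with y hy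
      exact Real.smoothTransition.one_of_one_le (le_of_lt hy)
    rw [this.deriv_eq]; simp

lemma hasCompactSupport_deriv_smoothTransition :
    HasCompactSupport (deriv Real.smoothTransition) :=
  HasCompactSupport.of_support_subset_isCompact isCompact_Icc fun x hx => by
    by_contra h; exact hx (deriv_smoothTransition_eq_zero h)

lemma integral_deriv_smoothTransition : ∫ x, deriv Real.smoothTransition x = 1 := by
  have h : ∫ x in (-1 : ℝ)..1, deriv Real.smoothTransition x = 1 := by
    rw [intervalIntegral.integral_deriv_eq_sub
      (fun x _ => (Real.smoothTransition.contDiff (n := 1)).differentiable (by simp) x)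
      (continuous_deriv_smoothTransition.intervalIntegrable _ _)]
    rw [Real.smoothTransition.one, Real.smoothTransition.zero_of_nonpos (by norm_num)]; simp
  rw [← h]
  symm
  refine intervalIntegral.integral_eq_integral_of_support_subset fun x hx => ?_
  have : x ∈ Icc (0 : ℝ) 1 := by
    by_contra h'; exact hx (deriv_smoothTransition_eq_zero h')
  exact ⟨by linarith [this.1], this.2⟩

/-- The rescaled derivative of the smooth step has mass one and lives on `[s, s + δ n]`, so it is a
one-sided approximate identity at `s`. -/
lemma tendsto_integral_mul_deriv_smoothTransition {u : ℝ → ℝ} (hu : Continuous u) {C : ℝ}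
    (hC : ∀ x, |u x| ≤ C) (s : ℝ) {δ : ℕ → ℝ} (hδ : ∀ n, 0 < δ n)
    (hδ0 : Tendsto δ atTop (𝓝 0)) :
    Tendsto (fun n => ∫ x, u x * (deriv Real.smoothTransition ((x - s) / δ n) / δ n)) atTop
      (𝓝 (u s)) := by
  have h1 : ∀ n, ∫ x, u x * (deriv Real.smoothTransition ((x - s) / δ n) / δ n)
      = ∫ y, u (s + δ n * y) * deriv Real.smoothTransition y := by
    intro n
    have hn := (hδ n).ne'
    have e1 : ∀ x, u x * (deriv Real.smoothTransition ((x - s) / δ n) / δ n)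
        = (fun z => (fun y => u (s + δ n * y) * deriv Real.smoothTransition y) (z / δ n) * (δ n)⁻¹)
          (x - s) := by
      intro x
      have : s + δ n * ((x - s) / δ n) = x := by field_simp; ring
      simp only [this]; ring
    simp_rw [e1]
    rw [integral_sub_right_eq_self
      (fun z => (fun y => u (s + δ n * y) * deriv Real.smoothTransition y) (z / δ n) * (δ n)⁻¹) s,
      integral_mul_const, Measure.integral_comp_div
        (fun y => u (s + δ n * y) * deriv Real.smoothTransition y) (δ n), abs_of_pos (hδ n), smul_eq_mul]
    field_simp
  simp_rw [h1]
  have h2 : u s = ∫ y, u s * deriv Real.smoothTransition y := by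
    rw [integral_const_mul, integral_deriv_smoothTransition, mul_one]
  rw [h2]
  refine tendsto_integral_of_dominated_convergence
    (bound := fun y => C * |deriv Real.smoothTransition y|) (fun n => ?_) ?_ (fun n => ?_) ?_
  · exact ((hu.comp (by fun_prop)).mul continuous_deriv_smoothTransition).aestronglyMeasurable
  · exact ((continuous_deriv_smoothTransition.integrable_of_hasCompactSupport
      hasCompactSupport_deriv_smoothTransition).abs).const_mul C
  · refine Eventually.of_forall fun y => ?_
    rw [norm_mul]
    exact mul_le_mul_of_nonneg_right (hC _) (abs_nonneg _)
  · refine Eventually.of_forall fun y => Tendsto.mul_const _ ?_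
    have : Tendsto (fun n => s + δ n * y) atTop (𝓝 (s + 0 * y)) := (hδ0.mul_const y).const_add s
    rw [zero_mul, add_zero] at this
    exact (hu.tendsto s).comp this

lemma tendsto_smoothTransition_div (x s : ℝ) {δ : ℕ → ℝ} (hδ : ∀ n, 0 < δ n)
    (hδ0 : Tendsto δ atTop (𝓝 0)) :
    Tendsto (fun n => Real.smoothTransition ((x - s) / δ n)) atTop
      (𝓝 ((Ioi s).indicator (fun _ => 1) x)) := by
  by_cases hx : s < x
  · rw [indicator_of_mem (show x ∈ Ioi s from hx)]
    have : ∀ᶠ n in atTop, δ n < x - s := hδ0.eventually (gt_mem_nhds (sub_pos.mpr hx))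
    refine tendsto_const_nhds.congr' ?_
    filter_upwards [this] with n hn
    rw [Real.smoothTransition.one_of_one_le]
    rw [le_div_iff₀ (hδ n)]; linarith
  · rw [indicator_of_notMem (show x ∉ Ioi s from hx)]
    refine tendsto_const_nhds.congr fun n => ?_
    rw [Real.smoothTransition.zero_of_nonpos]
    exact div_nonpos_of_nonpos_of_nonneg (by linarith [not_lt.mp hx]) (hδ n).le

/-- A continuous function with a weak derivative is its primitive. -/
theorem HasWeakDeriv.sub_eq_integral {a b : ℝ} {u v : ℝ → ℝ}
    (h : HasWeakDeriv (Ioo a b) 1 u v) (hu : ContinuousOn u (Ioo a b)) {s t : ℝ}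
    (hs : s ∈ Ioo a b) (ht : t ∈ Ioo a b) : u t - u s = ∫ x in s..t, v x := by
  wlog hst : s ≤ t generalizing s t
  · have := this ht hs (le_of_not_ge hst)
    rw [intervalIntegral.integral_symm, ← this]; ring
  obtain ⟨b', hb', hb'b⟩ := exists_between ht.2
  set δ : ℕ → ℝ := fun n => (b' - t) / (n + 1) with hδdef
  have hd : 0 < b' - t := by linarith
  have hδ : ∀ n, 0 < δ n := fun n => by positivity
  have hδ1 : ∀ n, δ n ≤ b' - t := fun n => by
    apply div_le_self hd.le
    have : (0 : ℝ) ≤ n := Nat.cast_nonneg n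
    linarith
  have hδ0 : Tendsto δ atTop (𝓝 0) := tendsto_const_nhds.div_atTop
    (tendsto_atTop_add_const_right _ _ tendsto_natCast_atTop_atTop)
  have hsb : s ≤ b' := by linarith
  have hsub : Icc s b' ⊆ Ioo a b := fun x hx => ⟨by linarith [hs.1, hx.1], by linarith [hx.2]⟩
  -- A bounded continuous function on the whole line, equal to `u` wherever the test functions live.
  set U : ℝ → ℝ := IccExtend hsb ((Icc s b').domRestrict u) with hU
  have hUc : Continuous U := (continuousOn_iff_continuous_domRestrict.mp (hu.mono hsub)).Icc_extend'
  have hUe : ∀ x ∈ Icc s b', U x = u x := fun x hx => by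
    rw [hU, IccExtend_of_mem _ _ hx]; rfl
  obtain ⟨C, hC⟩ : ∃ C, ∀ x, |U x| ≤ C := by
    obtain ⟨C, hC⟩ := isCompact_Icc.exists_bound_of_continuousOn (hu.mono hsub)
    exact ⟨C, fun x => hC _ (projIcc s b' hsb x).2⟩
  -- Smooth approximations of the indicator of `(s, t]`. Their derivatives are approximate
  -- identities at `s` and, with a minus sign, at `t`; the choice of `δ` leaves room up to `b'`.
  set φ : ℕ → ℝ → ℝ := fun n x =>
    Real.smoothTransition ((x - s) / δ n) - Real.smoothTransition ((x - t) / δ n) with hφ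
  have hφd : ∀ n x, HasDerivAt (φ n) (deriv Real.smoothTransition ((x - s) / δ n) / δ n
      - deriv Real.smoothTransition ((x - t) / δ n) / δ n) x := by
    intro n x
    have key : ∀ c : ℝ, HasDerivAt (fun x => Real.smoothTransition ((x - c) / δ n))
        (deriv Real.smoothTransition ((x - c) / δ n) / δ n) x := by
      intro c
      have h1 : HasDerivAt (fun x : ℝ => (x - c) / δ n) (1 / δ n) x :=
        ((hasDerivAt_id x).sub_const c).div_const _
      have h2 := ((Real.smoothTransition.contDiff (n := 1)).differentiable (by simp)
        ((x - c) / δ n)).hasDerivAt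
      have h3 := h2.comp x h1
      rw [mul_one_div] at h3
      exact h3
    exact (key s).sub (key t)
  have hφ0 : ∀ n x, x ∉ Icc s b' → φ n x = 0 := by
    intro n x hx
    simp only [hφ]
    rcases lt_or_ge x s with h1 | h1
    · rw [Real.smoothTransition.zero_of_nonpos, Real.smoothTransition.zero_of_nonpos, sub_zero]
      · exact div_nonpos_of_nonpos_of_nonneg (by linarith) (hδ n).le
      · exact div_nonpos_of_nonpos_of_nonneg (by linarith) (hδ n).le
    · have h2 : b' < x := by by_contra h'; exact hx ⟨h1, not_lt.mp h'⟩
      have := hδ1 n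
      rw [Real.smoothTransition.one_of_one_le, Real.smoothTransition.one_of_one_le, sub_self]
      · rw [le_div_iff₀ (hδ n)]; linarith
      · rw [le_div_iff₀ (hδ n)]; linarith
  have hφsm : ∀ n, ContDiff ℝ ∞ (φ n) := fun n =>
    (Real.smoothTransition.contDiff.comp (by fun_prop)).sub
      (Real.smoothTransition.contDiff.comp (by fun_prop))
  have hφts : ∀ n, tsupport (φ n) ⊆ Icc s b' := fun n =>
    closure_minimal (fun x hx => by by_contra h'; exact hx (hφ0 n x h')) isClosed_Icc
  have hw := fun n => h.2.2 (φ n) (hφsm n)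
    (HasCompactSupport.of_support_subset_isCompact isCompact_Icc (subset_closure.trans (hφts n)))
    ((hφts n).trans hsub)
  have hd0 : ∀ n x, x ∉ Icc s b' → fderiv ℝ (φ n) x 1 = 0 := by
    intro n x hx
    have : x ∉ tsupport (fderiv ℝ (φ n)) := fun h' =>
      hx (hφts n (tsupport_fderiv_subset ℝ h'))
    rw [image_eq_zero_of_notMem_tsupport this]; rfl
  have lhs : ∀ n, ∫ x in Ioo a b, u x * fderiv ℝ (φ n) x 1
      = (∫ x, U x * (deriv Real.smoothTransition ((x - s) / δ n) / δ n))
        - ∫ x, U x * (deriv Real.smoothTransition ((x - t) / δ n) / δ n) := by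
    intro n
    have hint : ∀ c : ℝ, Integrable fun x =>
        U x * (deriv Real.smoothTransition ((x - c) / δ n) / δ n) := by
      intro c
      refine Continuous.integrable_of_hasCompactSupport
        (hUc.mul ((continuous_deriv_smoothTransition.comp (by fun_prop)).div_const _)) ?_
      refine HasCompactSupport.of_support_subset_isCompact
        (isCompact_Icc (a := c) (b := c + δ n)) fun x hx => ?_
      by_contra h'
      apply hx
      have : (x - c) / δ n ∉ Icc (0 : ℝ) 1 := by
        rintro ⟨h1, h2⟩
        rw [div_le_one (hδ n)] at h2
        have h3 : 0 ≤ x - c := by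
          by_contra h4
          exact absurd h1 (not_le.mpr (div_neg_of_neg_of_pos (not_le.mp h4) (hδ n)))
        exact h' ⟨by linarith, by linarith⟩
      simp [deriv_smoothTransition_eq_zero this]
    rw [setIntegral_eq_integral_of_forall_compl_eq_zero
      (fun x hx => by rw [hd0 n x (fun h' => hx (hsub h')), mul_zero]),
      ← integral_sub (hint s) (hint t)]
    refine integral_congr_ae (Eventually.of_forall fun x => ?_)
    by_cases hx : x ∈ Icc s b'
    · simp only [hUe x hx]
      rw [fderiv_apply_one_eq_deriv, (hφd n x).deriv]; ring
    · have h1 := hd0 n x hx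
      rw [fderiv_apply_one_eq_deriv, (hφd n x).deriv] at h1
      simp only [hd0 n x hx]
      rw [← mul_sub, h1]; ring
  have l1 : Tendsto (fun n => ∫ x in Ioo a b, u x * fderiv ℝ (φ n) x 1) atTop
      (𝓝 (u s - u t)) := by
    simp_rw [lhs]
    have := (tendsto_integral_mul_deriv_smoothTransition hUc hC s hδ hδ0).sub
      (tendsto_integral_mul_deriv_smoothTransition hUc hC t hδ hδ0)
    rwa [hUe s ⟨le_rfl, hsb⟩, hUe t ⟨hst, hb'.le⟩] at this
  have l2 : Tendsto (fun n => ∫ x in Ioo a b, v x * φ n x) atTop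
      (𝓝 (∫ x in Ioo a b, v x * (Ioc s t).indicator (fun _ => 1) x)) := by
    have hvK : IntegrableOn v (Icc s b') volume :=
      h.2.1.integrableOn_compact_subset hsub isCompact_Icc
    refine tendsto_integral_of_dominated_convergence
      (bound := (Icc s b').indicator fun x => |v x|) (fun n => ?_) ?_ (fun n => ?_) ?_
    · exact h.2.1.aestronglyMeasurable.mul (hφsm n).continuous.aestronglyMeasurable
    · refine Integrable.mono_measure ?_ Measure.restrict_le_self
      rw [integrable_indicator_iff measurableSet_Icc]
      exact hvK.abs
    · refine Eventually.of_forall fun x => ?_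
      by_cases hx : x ∈ Icc s b'
      · rw [indicator_of_mem hx, norm_mul]
        refine mul_le_of_le_one_right (abs_nonneg _) ?_
        rw [Real.norm_eq_abs, abs_le]
        have a1 := Real.smoothTransition.nonneg ((x - s) / δ n)
        have a2 := Real.smoothTransition.nonneg ((x - t) / δ n)
        have a3 := Real.smoothTransition.le_one ((x - s) / δ n)
        have a4 := Real.smoothTransition.le_one ((x - t) / δ n)
        constructor <;> simp only [hφ] <;> linarith
      · rw [hφ0 n x hx, indicator_of_notMem hx]; simp
    · refine Eventually.of_forall fun x => Tendsto.const_mul _ ?_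
      have e : (Ioc s t).indicator (fun _ => (1 : ℝ)) x
          = (Ioi s).indicator (fun _ => 1) x - (Ioi t).indicator (fun _ => 1) x := by
        by_cases h1 : s < x <;> by_cases h2 : t < x
        · simp [indicator, h1, h2]
        · simp [indicator, h1, h2, not_lt.mp h2]
        · exact absurd (lt_of_le_of_lt hst h2) h1
        · simp [indicator, h1, h2]
      rw [e]
      exact (tendsto_smoothTransition_div x s hδ hδ0).sub
        (tendsto_smoothTransition_div x t hδ hδ0)
  simp_rw [hw] at l1
  have l3 := tendsto_nhds_unique l1 l2.neg
  have e4 : ∫ x in Ioo a b, v x * (Ioc s t).indicator (fun _ => 1) x = ∫ x in s..t, v x := by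
    rw [intervalIntegral.integral_of_le hst]
    have : ∀ x, v x * (Ioc s t).indicator (fun _ => (1 : ℝ)) x = (Ioc s t).indicator v x := by
      intro x; by_cases hx : x ∈ Ioc s t <;> simp [hx]
    simp_rw [this]
    rw [setIntegral_indicator measurableSet_Ioc, inter_eq_right.mpr]
    exact fun x hx => hsub ⟨hx.1.le, hx.2.trans hb'.le⟩
  rw [e4] at l3
  linarith

/-- A primitive is absolutely continuous, so it integrates by parts against `φ`; the boundary terms
vanish because `φ` is zero at both ends. -/
theorem HasWeakDeriv.of_integral {a b c : ℝ} {u w : ℝ → ℝ} (hab : a ≤ b)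
    (hw : IntervalIntegrable w volume a b)
    (hu : ∀ x ∈ Icc a b, u x = c + ∫ y in a..x, w y) : HasWeakDeriv (Ioo a b) 1 u w := by
  have hAC : AbsolutelyContinuousOnInterval (fun x => c + ∫ y in a..x, w y) a b := by
    refine AbsolutelyContinuousOnInterval.add ?_
      (hw.absolutelyContinuousOnInterval_intervalIntegral (c := a) (by simp))
    exact (LipschitzWith.const c).lipschitzOnWith.absolutelyContinuousOnInterval
  have hcont : ContinuousOn u (Icc a b) := by
    have := hAC.continuousOn
    rw [uIcc_of_le hab] at this
    exact this.congr hu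
  have hwI : IntegrableOn w (Ioo a b) volume :=
    ((intervalIntegrable_iff_integrableOn_Ioc_of_le hab).mp hw).mono_set Ioo_subset_Ioc_self
  refine ⟨(hcont.mono Ioo_subset_Icc_self).locallyIntegrableOn measurableSet_Ioo,
    hwI.locallyIntegrableOn, fun φ hφ hc hs => ?_⟩
  have hφ1 : ContDiff ℝ 1 φ := hφ.of_le (by exact_mod_cast le_top)
  have hφAC : AbsolutelyContinuousOnInterval φ a b := hφ1.contDiffOn.absolutelyContinuousOnInterval
  have key := hAC.integral_mul_deriv_eq_deriv_mul hφAC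
  have ha : φ a = 0 := image_eq_zero_of_notMem_tsupport fun h => lt_irrefl _ (hs h).1
  have hb : φ b = 0 := image_eq_zero_of_notMem_tsupport fun h => lt_irrefl _ (hs h).2
  rw [ha, hb, mul_zero, mul_zero, sub_zero, zero_sub, intervalIntegral.integral_of_le hab,
    intervalIntegral.integral_of_le hab] at key
  rw [← integral_Ioc_eq_integral_Ioo, ← integral_Ioc_eq_integral_Ioo]
  have e1 : ∫ x in Ioc a b, u x * fderiv ℝ φ x 1
      = ∫ x in Ioc a b, (c + ∫ y in a..x, w y) * deriv φ x := by
    refine setIntegral_congr_fun measurableSet_Ioc fun x hx => ?_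
    simp only [fderiv_apply_one_eq_deriv]
    rw [hu x (Ioc_subset_Icc_self hx)]
  rw [e1, key]
  congr 1
  refine setIntegral_congr_ae measurableSet_Ioc ?_
  filter_upwards [hw.ae_hasDerivAt_integral] with x hx hxI
  have hx' : x ∈ uIcc a b := by rw [uIcc_of_le hab]; exact Ioc_subset_Icc_self hxI
  rw [((hx hx' a (by simp)).const_add c).deriv]

end OneDim

/-! ### Representatives, embeddings and norm bounds in `H²` and `W^{1,∞}` -/

section Sobolev

lemma IsCompact.exists_Icc_subset_Ioo {a b : ℝ} (hab : a < b) {K : Set ℝ} (hK : IsCompact K)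
    (hs : K ⊆ Ioo a b) : ∃ c d, a < c ∧ c ≤ d ∧ d < b ∧ K ⊆ Icc c d := by
  rcases K.eq_empty_or_nonempty with rfl | hne
  · exact ⟨(a + b) / 2, (a + b) / 2, by linarith, le_rfl, by linarith, empty_subset _⟩
  · obtain ⟨c, hc⟩ := hK.exists_isLeast hne
    obtain ⟨d, hd⟩ := hK.exists_isGreatest hne
    exact ⟨c, d, (hs hc.1).1, hc.2 hd.1, (hs hd.1).2, fun x hx => ⟨hc.2 hx, hd.2 hx⟩⟩

/-- A test function of mean zero has a compactly supported primitive, which can itself be used as a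
test function. -/
lemma HasWeakDeriv.integral_mul_eq_of_integral_eq_zero {a b : ℝ} {v w g : ℝ → ℝ}
    (h : HasWeakDeriv (Ioo a b) 1 v w) (hw : ∀ x, w x = 0) (hab : a < b) (hg : Continuous g)
    (hc : HasCompactSupport g) (hs : tsupport g ⊆ Ioo a b) (h0 : ∫ x, g x = 0) :
    ∫ x in Ioo a b, v x * g x = 0 := by
  obtain ⟨c, d, hac, hcd, hdb, hK⟩ := hc.isCompact.exists_Icc_subset_Ioo hab hs
  have hg0 : ∀ x, x ∉ Icc c d → g x = 0 := fun x hx =>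
    image_eq_zero_of_notMem_tsupport fun h' => hx (hK h')
  set θ : ℝ → ℝ := fun x => ∫ y in a..x, g y with hθ
  have hθd : ∀ x, HasDerivAt θ (g x) x := fun x =>
    intervalIntegral.integral_hasDerivAt_right (hg.intervalIntegrable _ _)
      hg.stronglyMeasurable.stronglyMeasurableAtFilter hg.continuousAt
  have hθ0 : ∀ x, x ∉ Icc c d → θ x = 0 := by
    intro x hx
    rcases lt_or_ge x c with h1 | h1
    · simp only [hθ]
      refine intervalIntegral.integral_zero_ae (Eventually.of_forall fun y hy => hg0 y ?_)
      rintro ⟨h2, -⟩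
      rcases le_total a x with h3 | h3
      · rw [uIoc_of_le h3] at hy; linarith [hy.2]
      · rw [uIoc_of_ge h3] at hy; linarith [hy.2]
    · have h2 : d < x := by by_contra h'; exact hx ⟨h1, not_lt.mp h'⟩
      simp only [hθ]
      rw [← h0]
      refine intervalIntegral.integral_eq_integral_of_support_subset fun y hy => ?_
      have : y ∈ Icc c d := by by_contra h'; exact hy (hg0 y h')
      exact ⟨by linarith [this.1], by linarith [this.2]⟩
  have hts : tsupport θ ⊆ Icc c d :=
    closure_minimal (fun x hx => by by_contra h'; exact hx (hθ0 x h')) isClosed_Icc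
  have := h.integral_mul_of_hasLineDerivAt isOpen_Ioo
    (continuous_iff_continuousAt.mpr fun x => (hθd x).continuousAt) hg
    (HasCompactSupport.of_support_subset_isCompact isCompact_Icc (subset_closure.trans hts))
    (hts.trans fun x hx => ⟨by linarith [hx.1], by linarith [hx.2]⟩)
    (fun x => by simpa using (hθd x).hasFDerivAt.hasLineDerivAt 1)
  simpa [hw] using this

/-- Du Bois-Reymond: subtracting `(∫ g) ρ`, with `ρ` a fixed bump of mass one, gives any test
function mean zero. The constant is then `∫ v ρ`. -/
lemma HasWeakDeriv.ae_eq_const {a b : ℝ} {v w : ℝ → ℝ} (h : HasWeakDeriv (Ioo a b) 1 v w)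
    (hw : ∀ x, w x = 0) (hab : a < b) : ∃ c : ℝ, ∀ᵐ x, x ∈ Ioo a b → v x = c := by
  let B : ContDiffBump ((a + b) / 2) := ⟨(b - a) / 8, (b - a) / 4, by linarith, by linarith⟩
  set ρ := B.normed (volume : Measure ℝ) with hρ
  have hρs : tsupport ρ ⊆ Ioo a b := by
    rw [hρ, B.tsupport_normed_eq]
    intro x hx
    rw [Metric.mem_closedBall, Real.dist_eq, abs_le] at hx
    change -((b - a) / 4) ≤ _ ∧ _ ≤ (b - a) / 4 at hx
    exact ⟨by linarith [hx.1], by linarith [hx.2]⟩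
  have hρc : HasCompactSupport ρ := B.hasCompactSupport_normed
  have hρi : ∫ x, ρ x = 1 := B.integral_normed
  have hρ0 : Continuous ρ := B.continuous_normed
  have hint : ∀ g : ℝ → ℝ, Continuous g → HasCompactSupport g → tsupport g ⊆ Ioo a b →
      IntegrableOn (fun x => v x * g x) (Ioo a b) volume := fun g hg hgc hgs =>
    h.1.integrableOn_mul_of_hasCompactSupport hg hgc hgs
  refine ⟨∫ x in Ioo a b, v x * ρ x, ?_⟩
  have := isOpen_Ioo.ae_eq_zero_of_integral_contDiff_smul_eq_zero (μ := (volume : Measure ℝ))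
    (U := Ioo a b) (f := fun x => v x - ∫ x in Ioo a b, v x * ρ x)
    (h.1.sub (continuous_const.locallyIntegrable.locallyIntegrableOn _)) ?_
  · filter_upwards [this] with x hx hxI
    exact sub_eq_zero.mp (hx hxI)
  intro g hg hgc hgs
  set I := ∫ x, g x with hI
  have hg0 := hg.continuous
  have key := h.integral_mul_eq_of_integral_eq_zero hw hab (g := fun x => g x - I * ρ x)
    (hg0.sub (continuous_const.mul hρ0)) (hgc.sub hρc.mul_left)
    ((tsupport_sub _ _).trans (union_subset hgs ((tsupport_mul_subset_right).trans hρs))) (by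
      rw [integral_sub (hg0.integrable_of_hasCompactSupport hgc)
        ((hρ0.integrable_of_hasCompactSupport hρc).const_mul I), integral_const_mul, hρi, mul_one,
        sub_self])
  have e1 : ∫ x in Ioo a b, v x * (g x - I * ρ x)
      = (∫ x in Ioo a b, v x * g x) - I * ∫ x in Ioo a b, v x * ρ x := by
    rw [← integral_const_mul, ← integral_sub (hint g hg0 hgc hgs)
      ((hint ρ hρ0 hρc hρs).const_mul I)]
    congr 1; funext x; ring
  have e2 : ∫ x in Ioo a b, v x * g x = ∫ x, v x * g x :=
    setIntegral_eq_integral_of_forall_compl_eq_zero fun x hx => by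
      rw [image_eq_zero_of_notMem_tsupport fun h' => hx (hgs h'), mul_zero]
  have hvg : Integrable fun x => v x * g x := by
    rw [← integrableOn_iff_integrable_of_support_subset (s := Ioo a b)]
    · exact hint g hg0 hgc hgs
    · intro x hx
      by_contra h'
      exact hx (by simp [image_eq_zero_of_notMem_tsupport fun h'' => h' (hgs h'')])
  rw [e1, e2] at key
  set c := ∫ x in Ioo a b, v x * ρ x
  have e3 : ∀ x, g x • (v x - c) = v x * g x - c * g x := fun x => by
    rw [smul_eq_mul]; ring
  simp_rw [e3]
  rw [integral_sub hvg ((hg0.integrable_of_hasCompactSupport hgc).const_mul c),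
    integral_const_mul]
  linarith

/-- A function with an integrable weak derivative agrees a.e. with a primitive of it. -/
theorem HasWeakDeriv.ae_eq_integral {a b : ℝ} {v w : ℝ → ℝ} (h : HasWeakDeriv (Ioo a b) 1 v w)
    (hab : a < b) (hw : IntervalIntegrable w volume a b) :
    ∃ c : ℝ, ∀ᵐ x, x ∈ Ioo a b → v x = c + ∫ y in a..x, w y := by
  have hV : HasWeakDeriv (Ioo a b) 1 (fun x => ∫ y in a..x, w y) w :=
    .of_integral (c := 0) hab.le hw fun x _ => by rw [zero_add]
  have hdiff : HasWeakDeriv (Ioo a b) 1 (fun x => v x - ∫ y in a..x, w y) fun _ => 0 := by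
    refine ⟨h.1.sub hV.1, continuous_const.locallyIntegrable.locallyIntegrableOn _,
      fun φ hφ hc hs => ?_⟩
    have hφ' : Continuous fun x => fderiv ℝ φ x 1 :=
      (hφ.continuous_fderiv (by simp)).clm_apply continuous_const
    have hc' : HasCompactSupport fun x => fderiv ℝ φ x 1 := hc.fderiv_apply (𝕜 := ℝ) 1
    have hs' : tsupport (fun x => fderiv ℝ φ x 1) ⊆ Ioo a b :=
      (tsupport_fderiv_apply_subset ℝ 1).trans hs
    have hi : ∀ z : ℝ → ℝ, LocallyIntegrableOn z (Ioo a b) volume →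
        IntegrableOn (fun x => z x * fderiv ℝ φ x 1) (Ioo a b) volume := fun z hz =>
      hz.integrableOn_mul_of_hasCompactSupport hφ' hc' hs'
    simp only [sub_mul]
    rw [integral_sub (hi v h.1) (hi _ hV.1), h.2.2 φ hφ hc hs, hV.2.2 φ hφ hc hs]
    simp
  obtain ⟨c, hc⟩ := hdiff.ae_eq_const (fun _ => rfl) hab
  refine ⟨c, ?_⟩
  filter_upwards [hc] with x hx hxI
  linarith [hx hxI]

/-- Up to the end points, a continuous function is the primitive of its weak derivative. -/
theorem HasWeakDeriv.eq_add_integral {a b : ℝ} {u v : ℝ → ℝ} (h : HasWeakDeriv (Ioo a b) 1 u v)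
    (hab : a < b) (hu : ContinuousOn u (Icc a b)) (hv : IntervalIntegrable v volume a b) :
    ∀ x ∈ Icc a b, u x = u a + ∫ y in a..x, v y := by
  have hvI : IntegrableOn v (uIcc a b) volume := by
    rw [uIcc_of_le hab.le, integrableOn_Icc_iff_integrableOn_Ioc]
    exact (intervalIntegrable_iff_integrableOn_Ioc_of_le hab.le).mp hv
  have hprim : ContinuousOn (fun x => ∫ y in a..x, v y) (Icc a b) := by
    have := intervalIntegral.continuousOn_primitive_interval hvI
    rwa [uIcc_of_le hab.le] at this
  set m := (a + b) / 2
  have hm : m ∈ Ioo a b := ⟨by simp only [m]; linarith, by simp only [m]; linarith⟩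
  have hint : ∀ x ∈ Icc a b, IntervalIntegrable v volume a x := fun x hx =>
    hv.mono_set (by rw [uIcc_of_le hab.le, uIcc_of_le hx.1]; exact Icc_subset_Icc_right hx.2)
  have hE : EqOn (fun x => u x - ∫ y in a..x, v y) (fun _ => u m - ∫ y in a..m, v y) (Icc a b) := by
    refine EqOn.of_subset_closure (s := Ioo a b) (fun x hx => ?_) (hu.sub hprim) continuousOn_const
      Ioo_subset_Icc_self (by rw [closure_Ioo hab.ne])
    have e1 := h.sub_eq_integral (hu.mono Ioo_subset_Icc_self) hm hx
    have e2 := intervalIntegral.integral_interval_sub_left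
      (hint x (Ioo_subset_Icc_self hx)) (hint m (Ioo_subset_Icc_self hm))
    linarith
  intro x hx
  have h1 := hE hx
  have h2 := hE (left_mem_Icc.mpr hab.le)
  simp only [intervalIntegral.integral_same] at h1 h2
  linarith

/-- Written as `max |u| δ = δ`, the bound is an equality of continuous functions, which passes from
almost everywhere to the closed interval. -/
lemma forall_Icc_abs_le_of_ae {a b δ : ℝ} (hab : a < b) {u : ℝ → ℝ}
    (hu : ContinuousOn u (Icc a b)) (h : ∀ᵐ x, x ∈ Ioo a b → |u x| ≤ δ) :
    ∀ x ∈ Icc a b, |u x| ≤ δ := by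
  have hE : EqOn (fun x => max |u x| δ) (fun _ => δ) (Icc a b) := by
    refine Measure.eqOn_Icc_of_ae_eq volume hab.ne ?_ (hu.abs.sup continuousOn_const)
      continuousOn_const
    rw [Filter.EventuallyEq, ← restrict_Ioo_eq_restrict_Icc, ae_restrict_iff' measurableSet_Ioo]
    filter_upwards [h] with x hx hxI
    exact max_eq_right (hx hxI)
  intro x hx
  exact max_eq_right_iff.mp (hE hx)

/-- `u` has the derivatives `v` and `w` on `[a,b]`, in the integrated sense, with `w ∈ L²`. -/
structure IsH2Rep (a b : ℝ) (u v w : ℝ → ℝ) : Prop where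
  memLp : MemLp w 2 (volume.restrict (Ioo a b))
  fst : ∀ x ∈ Icc a b, u x = u a + ∫ y in a..x, v y
  snd : ∀ x ∈ Icc a b, v x = v a + ∫ y in a..x, w y

lemma MeasureTheory.MemLp.intervalIntegrable_of_two {a b : ℝ} (hab : a ≤ b) {w : ℝ → ℝ}
    (hw : MemLp w 2 (volume.restrict (Ioo a b))) : IntervalIntegrable w volume a b := by
  rw [intervalIntegrable_iff_integrableOn_Ioo_of_le hab]
  exact hw.integrable one_le_two

lemma continuousOn_of_eq_add_integral {a b c : ℝ} (hab : a ≤ b) {u w : ℝ → ℝ}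
    (hw : IntervalIntegrable w volume a b)
    (h : ∀ x ∈ Icc a b, u x = c + ∫ y in a..x, w y) : ContinuousOn u (Icc a b) := by
  have hvI : IntegrableOn w (uIcc a b) volume := by
    rw [uIcc_of_le hab, integrableOn_Icc_iff_integrableOn_Ioc]
    exact (intervalIntegrable_iff_integrableOn_Ioc_of_le hab).mp hw
  have := intervalIntegral.continuousOn_primitive_interval hvI
  rw [uIcc_of_le hab] at this
  exact (continuousOn_const.add this).congr h

lemma IsH2Rep.continuousOn_snd {a b : ℝ} (hab : a ≤ b) {u v w : ℝ → ℝ} (h : IsH2Rep a b u v w) :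
    ContinuousOn v (Icc a b) :=
  continuousOn_of_eq_add_integral hab (h.memLp.intervalIntegrable_of_two hab) h.snd

lemma IsH2Rep.intervalIntegrable_snd {a b : ℝ} (hab : a ≤ b) {u v w : ℝ → ℝ}
    (h : IsH2Rep a b u v w) : IntervalIntegrable v volume a b :=
  (by simpa [uIcc_of_le hab] using h.continuousOn_snd hab :
    ContinuousOn v (uIcc a b)).intervalIntegrable

lemma IsH2Rep.continuousOn {a b : ℝ} (hab : a ≤ b) {u v w : ℝ → ℝ} (h : IsH2Rep a b u v w) :
    ContinuousOn u (Icc a b) :=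
  continuousOn_of_eq_add_integral hab (h.intervalIntegrable_snd hab) h.fst

lemma hasDerivWithinAt_of_eq_add_integral {a b : ℝ} {u v : ℝ → ℝ} (hv : ContinuousOn v (Icc a b))
    (h : ∀ x ∈ Icc a b, u x = u a + ∫ y in a..x, v y) {x : ℝ} (hx : x ∈ Icc a b) :
    HasDerivWithinAt u (v x) (Icc a b) x := by
  have hab : a ≤ b := hx.1.trans hx.2
  have hv' : IntervalIntegrable v volume a x := by
    refine (hv.mono ?_).intervalIntegrable
    rw [uIcc_of_le hx.1]; exact Icc_subset_Icc_right hx.2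
  have : Fact (x ∈ Icc a b) := ⟨hx⟩
  have key : HasDerivWithinAt (fun z => ∫ y in a..z, v y) (v x) (Icc a b) x :=
    intervalIntegral.integral_hasDerivWithinAt_right hv'
      (hv.stronglyMeasurableAtFilter_nhdsWithin measurableSet_Icc x) (hv x hx)
  exact (key.const_add (u a)).congr h (h x hx)

lemma IsH2Rep.derivWithin_eq {a b : ℝ} (hab : a < b) {u v w : ℝ → ℝ} (h : IsH2Rep a b u v w)
    {x : ℝ} (hx : x ∈ Icc a b) : derivWithin u (Icc a b) x = v x :=
  (hasDerivWithinAt_of_eq_add_integral (h.continuousOn_snd hab.le) h.fst hx).derivWithin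
    (uniqueDiffOn_Icc hab x hx)

/-- The strict inequality makes the infimum defining the norm produce actual weak derivatives. The
first derivative is then replaced by its continuous version, a primitive of the second. -/
theorem exists_isH2Rep_of_h2Norm_lt {a b δ : ℝ} (hab : a < b) {u : ℝ → ℝ}
    (hu : ContinuousOn u (Icc a b)) (h : h2Norm a b u < ENNReal.ofReal δ) :
    ∃ v w, IsH2Rep a b u v w ∧ normLp (Ioo a b) 2 u ≤ ENNReal.ofReal δ ∧
      normLp (Ioo a b) 2 v ≤ ENNReal.ofReal δ ∧ normLp (Ioo a b) 2 w ≤ ENNReal.ofReal δ := by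
  simp only [h2Norm, iInf_lt_iff] at h
  obtain ⟨v, w, huv, hvw, hlt⟩ := h
  have hle : ∀ X : ℝ≥0∞, X ^ 2 ≤ normLp (Ioo a b) 2 u ^ 2 + normLp (Ioo a b) 2 v ^ 2
      + normLp (Ioo a b) 2 w ^ 2 → X ≤ ENNReal.ofReal δ := by
    intro X hX
    have h1 : X = (X ^ 2) ^ (1 / 2 : ℝ) := by
      rw [← ENNReal.rpow_natCast, ← ENNReal.rpow_mul]; norm_num
    rw [h1]
    exact (ENNReal.rpow_le_rpow hX (by norm_num)).trans hlt.le
  have hU := hle (normLp (Ioo a b) 2 u) (by rw [add_assoc]; exact le_self_add)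
  have hV := hle (normLp (Ioo a b) 2 v) (by
    rw [add_right_comm]; exact le_add_self)
  have hW := hle (normLp (Ioo a b) 2 w) le_add_self
  have hwm : MemLp w 2 (volume.restrict (Ioo a b)) :=
    ⟨hvw.2.1.aestronglyMeasurable, hW.trans_lt ENNReal.ofReal_lt_top⟩
  have hwi := hwm.intervalIntegrable_of_two hab.le
  obtain ⟨c, hc⟩ := hvw.ae_eq_integral hab hwi
  set V : ℝ → ℝ := fun x => c + ∫ y in a..x, w y with hVdef
  have hVv : v =ᵐ[volume.restrict (Ioo a b)] V := by
    rw [Filter.EventuallyEq, ae_restrict_iff' measurableSet_Ioo]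
    exact hc
  have hvi : IntervalIntegrable v volume a b := by
    rw [intervalIntegrable_iff_integrableOn_Ioo_of_le hab.le]
    refine (MemLp.integrable (q := 2) one_le_two ⟨huv.2.1.aestronglyMeasurable,
      hV.trans_lt ENNReal.ofReal_lt_top⟩)
  refine ⟨V, w, ⟨hwm, fun x hx => ?_, fun x _ => by simp [hVdef]⟩, hU, ?_, hW⟩
  · rw [huv.eq_add_integral hab hu hvi x hx]
    congr 1
    rw [intervalIntegral.integral_of_le hx.1, intervalIntegral.integral_of_le hx.1,
      integral_Ioc_eq_integral_Ioo, integral_Ioc_eq_integral_Ioo]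
    exact integral_congr_ae (ae_mono (Measure.restrict_mono (Ioo_subset_Ioo_right hx.2) le_rfl) hVv)
  · have : normLp (Ioo a b) 2 V = normLp (Ioo a b) 2 v := (eLpNorm_congr_ae hVv).symm
    rw [this]; exact hV

/-- Cauchy–Schwarz against the constant function one. -/
lemma integral_abs_le_of_normLp_two_le {a b δ : ℝ} (hab : a < b) (hδ : 0 ≤ δ) {v : ℝ → ℝ}
    (hv : MemLp v 2 (volume.restrict (Ioo a b))) (h : normLp (Ioo a b) 2 v ≤ ENNReal.ofReal δ) :
    ∫ x in a..b, |v x| ≤ Real.sqrt (b - a) * δ := by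
  have hvi : Integrable v (volume.restrict (Ioo a b)) := hv.integrable one_le_two
  rw [intervalIntegral.integral_of_le hab.le, integral_Ioc_eq_integral_Ioo]
  have h1 := eLpNorm_le_eLpNorm_mul_rpow_measure_univ (p := 1) (q := 2) one_le_two
    hv.aestronglyMeasurable
  rw [eLpNorm_one_eq_lintegral_enorm, ← ofReal_integral_norm_eq_lintegral_enorm hvi] at h1
  have h2 : (volume.restrict (Ioo a b)) univ = ENNReal.ofReal (b - a) := by simp
  rw [h2, ENNReal.ofReal_rpow_of_pos (by linarith)] at h1
  have h3 := h1.trans (mul_le_mul_left h _)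
  rw [← ENNReal.ofReal_mul hδ, ENNReal.ofReal_le_ofReal_iff (by positivity)] at h3
  rw [Real.sqrt_eq_rpow, mul_comm]
  have e : (1 : ℝ) / ENNReal.toReal 1 - 1 / ENNReal.toReal 2 = 1 / 2 := by norm_num
  rw [e] at h3
  exact h3

/-- One-dimensional Sobolev embedding: average `|u x| ≤ |u y| + ∫ |v|` over `y` and apply
Cauchy–Schwarz to both terms. -/
lemma abs_le_of_normLp_two_le {a b δ : ℝ} (hab : a < b) (hδ : 0 ≤ δ) {u v : ℝ → ℝ}
    (hu : ContinuousOn u (Icc a b)) (hv : MemLp v 2 (volume.restrict (Ioo a b)))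
    (huv : ∀ x ∈ Icc a b, u x = u a + ∫ y in a..x, v y)
    (hu2 : normLp (Ioo a b) 2 u ≤ ENNReal.ofReal δ) (hv2 : normLp (Ioo a b) 2 v ≤ ENNReal.ofReal δ) :
    ∀ x ∈ Icc a b, |u x| ≤ Real.sqrt (b - a) * ((b - a)⁻¹ + 1) * δ := by
  intro x hx
  have hum : MemLp u 2 (volume.restrict (Ioo a b)) :=
    ⟨(hu.mono Ioo_subset_Icc_self).aestronglyMeasurable measurableSet_Ioo,
      hu2.trans_lt ENNReal.ofReal_lt_top⟩
  have i1 := integral_abs_le_of_normLp_two_le hab hδ hum hu2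
  have i2 := integral_abs_le_of_normLp_two_le hab hδ hv hv2
  have hvi := hv.intervalIntegrable_of_two hab.le
  have hui := hum.intervalIntegrable_of_two hab.le
  have hsub : ∀ y ∈ Icc a b, IntervalIntegrable v volume a y := fun y hy =>
    hvi.mono_set (by rw [uIcc_of_le hab.le, uIcc_of_le hy.1]; exact Icc_subset_Icc_right hy.2)
  have key : ∀ y ∈ Icc a b, |u x| - ∫ z in a..b, |v z| ≤ |u y| := by
    intro y hy
    have e : u x - u y = ∫ z in y..x, v z := by
      rw [huv x hx, huv y hy, ← intervalIntegral.integral_interval_sub_left (hsub x hx) (hsub y hy)]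
      ring
    have h1 : |∫ z in y..x, v z| ≤ ∫ z in a..b, |v z| := by
      have h2 := intervalIntegral.norm_integral_le_integral_norm_uIoc (f := v) (a := y) (b := x)
        (μ := volume)
      rw [Real.norm_eq_abs] at h2
      refine h2.trans ?_
      rw [intervalIntegral.integral_of_le hab.le]
      refine setIntegral_mono_set ?_ (Eventually.of_forall fun z => abs_nonneg _)
        (LE.le.eventuallyLE ?_)
      · exact ((intervalIntegrable_iff_integrableOn_Ioc_of_le hab.le).mp hvi).abs
      · exact fun z hz => ⟨lt_of_le_of_lt (le_min hy.1 hx.1) hz.1, hz.2.trans (max_le hy.2 hx.2)⟩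
    have h3 := abs_sub_abs_le_abs_sub (u x) (u y)
    rw [e] at h3
    linarith
  have hI := intervalIntegral.integral_mono_on hab.le (by simp) hui.abs key
  rw [intervalIntegral.integral_const, smul_eq_mul] at hI
  have hba : 0 < b - a := by linarith
  have h4 : (b - a) * |u x| ≤ Real.sqrt (b - a) * δ + (b - a) * (Real.sqrt (b - a) * δ) := by
    nlinarith
  have h5 : |u x| = (b - a)⁻¹ * ((b - a) * |u x|) := by field_simp
  rw [h5]
  refine (mul_le_mul_of_nonneg_left h4 (by positivity)).trans (le_of_eq ?_)
  field_simp

theorem exists_of_w1infNorm_lt {a b δ : ℝ} (hab : a < b) {u : ℝ → ℝ}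
    (hu : ContinuousOn u (Icc a b)) (h : w1infNorm a b u < ENNReal.ofReal δ) :
    ∃ v, IntervalIntegrable v volume a b ∧ (∀ x ∈ Icc a b, u x = u a + ∫ y in a..x, v y) ∧
      (∀ x ∈ Icc a b, |u x| ≤ δ) ∧ ∀ᵐ x, x ∈ Ioo a b → |v x| ≤ δ := by
  have hδ : 0 < δ := by
    by_contra h'
    rw [ENNReal.ofReal_of_nonpos (not_lt.mp h')] at h
    exact not_lt_bot h
  simp only [w1infNorm, iInf_lt_iff] at h
  obtain ⟨v, huv, hlt⟩ := h
  have hb : ∀ f : ℝ → ℝ, normLp (Ioo a b) ⊤ f ≤ ENNReal.ofReal δ →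
      ∀ᵐ x, x ∈ Ioo a b → |f x| ≤ δ := by
    intro f hf
    rw [← ae_restrict_iff' measurableSet_Ioo]
    rw [normLp, eLpNorm_exponent_top] at hf
    filter_upwards [ae_le_eLpNormEssSup (f := f) (μ := volume.restrict (Ioo a b))] with x hx
    have := hx.trans hf
    rw [← ofReal_norm, ENNReal.ofReal_le_ofReal_iff hδ.le] at this
    exact this
  have hbu := hb u (le_self_add.trans hlt.le)
  have hbv := hb v (le_add_self.trans hlt.le)
  have hvi : IntervalIntegrable v volume a b := by
    rw [intervalIntegrable_iff_integrableOn_Ioo_of_le hab.le]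
    exact Integrable.of_bound huv.2.1.aestronglyMeasurable δ
      ((ae_restrict_iff' measurableSet_Ioo).mpr hbv)
  exact ⟨v, hvi, huv.eq_add_integral hab hu hvi, forall_Icc_abs_le_of_ae hab hu hbu, hbv⟩

/-- The factor `2` replaces `√3`, coming from three terms of size `m²`. -/
theorem h2Norm_le {a b m : ℝ} (hab : a ≤ b) {u v w : ℝ → ℝ} (h : IsH2Rep a b u v w)
    (hu : normLp (Ioo a b) 2 u ≤ ENNReal.ofReal m) (hv : normLp (Ioo a b) 2 v ≤ ENNReal.ofReal m)
    (hw : normLp (Ioo a b) 2 w ≤ ENNReal.ofReal m) : h2Norm a b u ≤ ENNReal.ofReal (2 * m) := by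
  have h1 : HasWeakDeriv (Ioo a b) 1 u v := .of_integral hab (h.intervalIntegrable_snd hab) h.fst
  have h2 : HasWeakDeriv (Ioo a b) 1 v w :=
    .of_integral hab (h.memLp.intervalIntegrable_of_two hab) h.snd
  have h0 : h2Norm a b u ≤ (normLp (Ioo a b) 2 u ^ 2 + normLp (Ioo a b) 2 v ^ 2
      + normLp (Ioo a b) 2 w ^ 2) ^ (1 / 2 : ℝ) :=
    iInf₂_le_of_le v w (iInf₂_le_of_le h1 h2 le_rfl)
  refine h0.trans ?_
  have h3 : normLp (Ioo a b) 2 u ^ 2 + normLp (Ioo a b) 2 v ^ 2 + normLp (Ioo a b) 2 w ^ 2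
      ≤ ENNReal.ofReal (2 * m) ^ 2 := by
    calc _ ≤ ENNReal.ofReal m ^ 2 + ENNReal.ofReal m ^ 2 + ENNReal.ofReal m ^ 2 := by gcongr
      _ ≤ 4 * ENNReal.ofReal m ^ 2 := by
        rw [show (4 : ℝ≥0∞) = 1 + 1 + 1 + 1 by norm_num, add_mul, add_mul, add_mul, one_mul]
        exact le_self_add
      _ = ENNReal.ofReal (2 * m) ^ 2 := by
        rw [ENNReal.ofReal_mul (by norm_num), mul_pow, ENNReal.ofReal_ofNat]; norm_num
  refine (ENNReal.rpow_le_rpow h3 (by norm_num)).trans (le_of_eq ?_)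
  rw [← ENNReal.rpow_natCast, ← ENNReal.rpow_mul]; norm_num

lemma normLp_le_of_bound {E : Type*} [MeasureSpace E] {Ω : Set E} (hΩ : MeasurableSet Ω)
    {p : ℝ≥0∞} {u : E → ℝ} {m : ℝ} (h1 : volume Ω ≤ 1) (h : ∀ x ∈ Ω, |u x| ≤ m) :
    normLp Ω p u ≤ ENNReal.ofReal m := by
  have h2 : ∀ᵐ x ∂(volume.restrict Ω), ‖u x‖ ≤ m :=
    (ae_restrict_iff' hΩ).mpr (Eventually.of_forall h)
  refine (eLpNorm_le_of_ae_bound h2).trans ?_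
  refine mul_le_of_le_one_left' (ENNReal.rpow_le_one ?_ (by positivity))
  simpa using h1

lemma normLp_top_le_of_bound {E : Type*} [MeasureSpace E] {Ω : Set E} (hΩ : MeasurableSet Ω)
    {u : E → ℝ} {m : ℝ} (h : ∀ x ∈ Ω, |u x| ≤ m) : normLp Ω ⊤ u ≤ ENNReal.ofReal m := by
  rw [normLp, eLpNorm_exponent_top]
  exact eLpNormEssSup_le_of_ae_bound ((ae_restrict_iff' hΩ).mpr (Eventually.of_forall h))

end Sobolev

/-! ### Changes of variables in `L²` -/

section ChangeOfVariables

lemma eLpNorm_two_sq {E : Type*} [MeasurableSpace E] (μ : Measure E) (f : E → ℝ) :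
    eLpNorm f 2 μ ^ 2 = ∫⁻ x, ‖f x‖ₑ ^ 2 ∂μ := by
  have := eLpNorm_nnreal_pow_eq_lintegral (μ := μ) (f := f) (p := 2) (by norm_num)
  simpa using this

/-- Integrability, and with it measurability, transfers through the change of variables formula.
This serves functions defined through a chosen inverse of `Φ`, whose measurability is not otherwise
at hand. -/
lemma aestronglyMeasurable_of_comp {s : Set ℝ} (hs : MeasurableSet s) {Φ Φ' g : ℝ → ℝ}
    (hΦ : ∀ x ∈ s, HasDerivWithinAt Φ (Φ' x) s x) (hinj : InjOn Φ s) {D : ℝ}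
    (hΦ'm : ContinuousOn Φ' s) (hD : ∀ x ∈ s, |Φ' x| ≤ D)
    (hg : IntegrableOn (fun x => g (Φ x)) s volume) :
    AEStronglyMeasurable g (volume.restrict (Φ '' s)) := by
  have : IntegrableOn g (Φ '' s) volume := by
    rw [integrableOn_image_iff_integrableOn_abs_deriv_smul hs hΦ hinj]
    exact Integrable.bdd_mul hg (hΦ'm.abs.aestronglyMeasurable hs) (c := D)
      ((ae_restrict_iff' hs).mpr (Eventually.of_forall fun x hx => by simpa using hD x hx))
  exact this.aestronglyMeasurable

/-- The squared norm picks up the Jacobian, at most `D`. The formula for lower integrals needs no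
measurability of `g`. -/
lemma eLpNorm_two_image_le {s : Set ℝ} (hs : MeasurableSet s) {Φ Φ' g : ℝ → ℝ}
    (hΦ : ∀ x ∈ s, HasDerivWithinAt Φ (Φ' x) s x) (hinj : InjOn Φ s) {D : ℝ} (hD0 : 0 ≤ D)
    (hD : ∀ x ∈ s, |Φ' x| ≤ D) :
    eLpNorm g 2 (volume.restrict (Φ '' s))
      ≤ ENNReal.ofReal (Real.sqrt D) * eLpNorm (fun x => g (Φ x)) 2 (volume.restrict s) := by
  have h : eLpNorm g 2 (volume.restrict (Φ '' s)) ^ 2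
      ≤ (ENNReal.ofReal (Real.sqrt D) * eLpNorm (fun x => g (Φ x)) 2 (volume.restrict s)) ^ 2 := by
    rw [mul_pow, eLpNorm_two_sq, eLpNorm_two_sq,
      lintegral_image_eq_lintegral_abs_deriv_mul hs hΦ hinj, ← ENNReal.ofReal_pow (by positivity),
      Real.sq_sqrt hD0, ← lintegral_const_mul' _ _ ENNReal.ofReal_ne_top]
    refine setLIntegral_mono' hs fun x hx => ?_
    gcongr
    exact hD x hx
  exact (pow_le_pow_left_iff_of_nonneg' h)
where
  pow_le_pow_left_iff_of_nonneg' {X Y : ℝ≥0∞} (h : X ^ 2 ≤ Y ^ 2) : X ≤ Y := by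
    by_contra h'
    exact absurd h (not_le.mpr (ENNReal.pow_right_strictMono two_ne_zero (not_le.mp h')))

end ChangeOfVariables

/-- The primitive of `g` with value `c` at `0`. -/
noncomputable def prim (c : ℝ) (g : ℝ → ℝ) (z : ℝ) : ℝ := c + ∫ y in (0 : ℝ)..z, g y

/-! ### Elementary properties of primitives -/

section Prim

lemma prim_zero (c : ℝ) (g : ℝ → ℝ) : prim c g 0 = c := by simp [prim]

lemma prim_sub_prim {c : ℝ} {g : ℝ → ℝ} (hg : ∀ a b, IntervalIntegrable g volume a b) (x y : ℝ) :
    prim c g y - prim c g x = ∫ z in x..y, g z := by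
  simp only [prim]
  rw [← intervalIntegral.integral_interval_sub_left (hg 0 y) (hg 0 x)]; ring

lemma continuous_prim {c : ℝ} {g : ℝ → ℝ} (hg : ∀ a b, IntervalIntegrable g volume a b) :
    Continuous (prim c g) :=
  continuous_const.add (intervalIntegral.continuous_primitive hg 0)

lemma hasDerivAt_prim {c : ℝ} {g : ℝ → ℝ} (hg : Continuous g) (z : ℝ) :
    HasDerivAt (prim c g) (g z) z :=
  (intervalIntegral.integral_hasDerivAt_right (hg.intervalIntegrable _ _)
    hg.stronglyMeasurable.stronglyMeasurableAtFilter hg.continuousAt).const_add c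

lemma MeasureTheory.MemLp.intervalIntegrable {g : ℝ → ℝ} (hg : MemLp g 2 volume) (a b : ℝ) :
    IntervalIntegrable g volume a b := by
  rw [intervalIntegrable_iff]
  unfold uIoc
  exact (hg.restrict _).integrable one_le_two

end Prim

/-! ### The transported profile built from initial and boundary data -/

section Profile

/-- The transported profile: gluing the initial datum (rescaled to `[0, l0]`) and the boundary datum
(in the variable `-ζ ∫₀ᵗ N`) gives a function with square integrable second derivative. -/
theorem exists_profile {T ζ la lb n0 n1 : ℝ} (hT : 0 < T) (hζ : 0 < ζ) (hla : 0 < la) (hlb : 0 < lb)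
    (hn0 : 0 < n0) (hn1 : 0 < n1) :
    ∃ C > 0, ∀ (κ l0 : ℝ) (N f0 v0 w0 h vh wh : ℝ → ℝ), 0 ≤ κ → la ≤ l0 → l0 ≤ lb →
      Continuous N → (∀ t, n0 ≤ N t) → (∀ t, N t ≤ n1) → LipschitzOnWith 1 N (Icc 0 T) →
      IsH2Rep 0 1 f0 v0 w0 → IsH2Rep 0 T h vh wh → h 0 = f0 0 →
      v0 0 + l0 / (ζ * N 0) * vh 0 = 0 → |v0 0| ≤ κ →
      normLp (Ioo 0 1) 2 w0 ≤ ENNReal.ofReal κ → normLp (Ioo 0 T) 2 vh ≤ ENNReal.ofReal κ →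
      normLp (Ioo 0 T) 2 wh ≤ ENNReal.ofReal κ →
      ∃ (c1 : ℝ) (g2 : ℝ → ℝ), MemLp g2 2 volume ∧ eLpNorm g2 2 volume ≤ ENNReal.ofReal (C * κ) ∧
        (∀ z, |prim c1 g2 z| ≤ C * κ) ∧
        (∀ z ∈ Icc 0 l0, prim (f0 0) (prim c1 g2) z = f0 (z / l0)) ∧
        ∀ t ∈ Icc 0 T, prim (f0 0) (prim c1 g2) (-(ζ * prim 0 N t)) = h t := by
  -- Bound for the `L²` norm of the second derivative. Each side contributes the square root of its
  -- Jacobian times the bound for its integrand.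
  set C2 : ℝ := Real.sqrt lb * (1 / la ^ 2)
    + Real.sqrt (ζ * n1) * (1 / (ζ ^ 2 * n0 ^ 2) + 1 / (ζ ^ 2 * n0 ^ 3)) with hC2
  have hC2p : 0 < C2 := by positivity
  -- The three terms bound `‖g2‖₂`, the slope `c1` at the origin, and `∫ |g2|` over an interval of
  -- the displayed length that contains the support of `g2`.
  refine ⟨C2 + 1 / la + Real.sqrt ((lb + 1) - (-(ζ * n1 * T + 1))) * C2, by positivity, ?_⟩
  intro κ l0 N f0 v0 w0 h vh wh hκ hl0a hl0b hN hNn0 hNn1 hNL hf0 hh hcomp0 hcomp1 hv0 hw0 hvh hwh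
  have hl0 : 0 < l0 := hla.trans_le hl0a
  have hNp : ∀ t, 0 < N t := fun t => hn0.trans_le (hNn0 t)
  -- The characteristic coordinate of what enters at `x = 0` at time `s`.
  set Φ : ℝ → ℝ := fun s => -(ζ * prim 0 N s) with hΦ
  have hΦd : ∀ s, HasDerivAt Φ (-(ζ * N s)) s := fun s => ((hasDerivAt_prim hN s).const_mul ζ).neg
  have hΦanti : StrictAnti Φ := strictAnti_of_deriv_neg fun s => by
    rw [(hΦd s).deriv]; exact neg_neg_of_pos (mul_pos hζ (hNp s))
  have hΦ0 : Φ 0 = 0 := by simp [hΦ, prim_zero]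
  -- Differentiating `G (Φ s) = h s` gives `G' (Φ s) = -p s / ζ` with `p = h' / N`. Since `N` is
  -- Lipschitz and bounded below, `p` is absolutely continuous.
  set p : ℝ → ℝ := fun s => (vh 0 + ∫ y in (0 : ℝ)..s, wh y) * (N s)⁻¹ with hp
  have hwhi := hh.memLp.intervalIntegrable_of_two hT.le
  have hA1 : AbsolutelyContinuousOnInterval (fun s => vh 0 + ∫ y in (0 : ℝ)..s, wh y) 0 T := by
    refine AbsolutelyContinuousOnInterval.add ?_
      (hwhi.absolutelyContinuousOnInterval_intervalIntegral (c := 0) (by simp))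
    exact (LipschitzWith.const (vh 0)).lipschitzOnWith.absolutelyContinuousOnInterval
  have hNinv : LipschitzOnWith (Real.toNNReal (1 / n0 ^ 2)) (fun s => (N s)⁻¹) (Icc 0 T) := by
    refine LipschitzOnWith.of_dist_le_mul fun s hs t ht => ?_
    have h1 := hNL.dist_le_mul s hs t ht
    rw [Real.coe_toNNReal _ (by positivity), Real.dist_eq, Real.dist_eq] at *
    simp only [NNReal.coe_one, one_mul] at h1
    have e : (N s)⁻¹ - (N t)⁻¹ = (N t - N s) / (N s * N t) := by
      have := (hNp s).ne'; have := (hNp t).ne'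
      field_simp
    rw [e, abs_div, abs_of_pos (mul_pos (hNp s) (hNp t)), abs_sub_comm, one_div_mul_eq_div]
    have h2 : n0 ^ 2 ≤ N s * N t := by nlinarith [hNn0 s, hNn0 t]
    exact div_le_div₀ (abs_nonneg _) h1 (by positivity) h2
  have hpAC : AbsolutelyContinuousOnInterval p 0 T :=
    hA1.mul (by
      apply LipschitzOnWith.absolutelyContinuousOnInterval
      rwa [uIcc_of_le hT.le])
  have hpval : ∀ s ∈ Icc 0 T, p s = vh s / N s := fun s hs => by
    simp only [hp]; rw [hh.snd s hs, div_eq_mul_inv]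
  -- A second differentiation yields `G'' (Φ s) = q s`.
  set q : ℝ → ℝ := fun s => deriv p s / (ζ ^ 2 * N s) with hq
  have hqm : AEStronglyMeasurable q (volume.restrict (Ioo 0 T)) :=
    ((measurable_deriv p).div (measurable_const.mul hN.measurable)).aestronglyMeasurable
  have hqb : ∀ᵐ s ∂(volume.restrict (Ioo 0 T)),
      ‖q s‖ ≤ 1 / (ζ ^ 2 * n0 ^ 2) * |wh s| + 1 / (ζ ^ 2 * n0 ^ 3) * |vh s| := by
    rw [ae_restrict_iff' measurableSet_Ioo]
    have hNinvAC : AbsolutelyContinuousOnInterval (fun s => (N s)⁻¹) 0 T := by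
      apply LipschitzOnWith.absolutelyContinuousOnInterval
      rwa [uIcc_of_le hT.le]
    filter_upwards [hwhi.ae_hasDerivAt_integral, hNinvAC.ae_differentiableAt] with s h1 h2 hs
    have hs' : s ∈ uIcc 0 T := by rw [uIcc_of_le hT.le]; exact Ioo_subset_Icc_self hs
    have d1 := (h1 hs' 0 (by simp)).const_add (vh 0)
    have d2 := (h2 hs').hasDerivAt
    have d3 : deriv p s = wh s * (N s)⁻¹
        + (vh 0 + ∫ y in (0 : ℝ)..s, wh y) * deriv (fun s => (N s)⁻¹) s := (d1.mul d2).deriv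
    have d4 : |deriv (fun s => (N s)⁻¹) s| ≤ 1 / n0 ^ 2 := by
      have := norm_deriv_le_of_lipschitzOn (Icc_mem_nhds hs.1 hs.2) hNinv
      rwa [Real.coe_toNNReal _ (by positivity)] at this
    rw [← hh.snd s (Ioo_subset_Icc_self hs)] at d3
    have hNs := hNp s
    have d5 : |deriv p s| ≤ |wh s| * (1 / n0) + |vh s| * (1 / n0 ^ 2) := by
      rw [d3]
      refine (abs_add_le _ _).trans ?_
      rw [abs_mul, abs_mul, abs_of_pos (inv_pos.mpr hNs), ← one_div]
      gcongr
      exact hNn0 s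
    simp only [hq]
    rw [Real.norm_eq_abs, abs_div, abs_of_pos (show 0 < ζ ^ 2 * N s by positivity)]
    calc |deriv p s| / (ζ ^ 2 * N s)
        ≤ (|wh s| * (1 / n0) + |vh s| * (1 / n0 ^ 2)) / (ζ ^ 2 * n0) := by
          gcongr; exact hNn0 s
      _ = _ := by field_simp
  have hvhm : AEStronglyMeasurable vh (volume.restrict (Ioo 0 T)) :=
    ((hh.continuousOn_snd hT.le).mono Ioo_subset_Icc_self).aestronglyMeasurable measurableSet_Ioo
  have hqn : eLpNorm q 2 (volume.restrict (Ioo 0 T))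
      ≤ ENNReal.ofReal ((1 / (ζ ^ 2 * n0 ^ 2) + 1 / (ζ ^ 2 * n0 ^ 3)) * κ) := by
    refine (eLpNorm_mono_ae_real hqb).trans ?_
    refine (eLpNorm_add_le (hh.memLp.aestronglyMeasurable.norm.const_mul _)
      (hvhm.norm.const_mul _) one_le_two).trans ?_
    rw [add_mul, ENNReal.ofReal_add (by positivity) (by positivity)]
    have key : ∀ (c : ℝ) (f : ℝ → ℝ), 0 ≤ c → normLp (Ioo 0 T) 2 f ≤ ENNReal.ofReal κ →
        eLpNorm (fun s => c * |f s|) 2 (volume.restrict (Ioo 0 T)) ≤ ENNReal.ofReal (c * κ) := by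
      intro c f hc hf
      have e := eLpNorm_const_smul (c := c) (f := fun s => |f s|) (p := 2)
        (μ := volume.restrict (Ioo 0 T))
      have e' : (c • fun s => |f s|) = fun s => c * |f s| := rfl
      rw [e'] at e
      rw [e, ENNReal.ofReal_mul hc, Real.enorm_of_nonneg hc]
      gcongr
      exact (eLpNorm_norm f).le.trans hf
    exact add_le_add (key _ _ (by positivity) hwh) (key _ _ (by positivity) hvh)
  have hqM : MemLp q 2 (volume.restrict (Ioo 0 T)) := ⟨hqm, hqn.trans_lt ENNReal.ofReal_lt_top⟩
  -- the two pieces of the second derivative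
  set k : ℝ → ℝ := Function.invFunOn Φ (Ioo 0 T) with hk
  have hkΦ : ∀ s ∈ Ioo 0 T, k (Φ s) = s := fun s hs =>
    (hΦanti.injective.injOn).leftInvOn_invFunOn hs
  set gp : ℝ → ℝ := fun z => w0 (z / l0) / l0 ^ 2 with hgp
  set gn : ℝ → ℝ := fun z => q (k z) with hgn
  have hΦim : Φ '' Ioo 0 T ⊆ Ioo (Φ T) 0 := by
    rintro _ ⟨s, hs, rfl⟩
    exact ⟨hΦanti hs.2, by rw [← hΦ0]; exact hΦanti hs.1⟩
  have hΦc : Continuous Φ := continuous_iff_continuousAt.mpr fun s => (hΦd s).continuousAt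
  have hΦim' : Φ '' Ioo 0 T = Ioo (Φ T) 0 := by
    refine hΦim.antisymm ?_
    have := intermediate_value_Ioo' hT.le hΦc.continuousOn
    rwa [hΦ0] at this
  have hscale : (fun x => l0 * x) '' Ioo 0 1 = Ioo 0 l0 := by
    rw [image_mul_left_Ioo hl0]; simp
  have hpn : eLpNorm gp 2 (volume.restrict (Ioo 0 l0))
      ≤ ENNReal.ofReal (Real.sqrt lb * (1 / la ^ 2) * κ) := by
    rw [← hscale]
    refine (eLpNorm_two_image_le measurableSet_Ioo (Φ' := fun _ => l0)
      (fun x _ => by simpa using ((hasDerivAt_id x).const_mul l0).hasDerivWithinAt)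
      (fun x _ y _ hxy => mul_left_cancel₀ hl0.ne' hxy) hlb.le
      (fun x _ => by rw [abs_of_pos hl0]; exact hl0b)).trans ?_
    rw [mul_assoc, ENNReal.ofReal_mul (Real.sqrt_nonneg _)]
    gcongr
    have e1 : (fun x => gp (l0 * x)) = (1 / l0 ^ 2) • w0 := by
      funext x; simp only [hgp, Pi.smul_apply, smul_eq_mul]
      rw [mul_div_cancel_left₀ _ hl0.ne']; ring
    rw [e1, eLpNorm_const_smul, ENNReal.ofReal_mul (by positivity),
      Real.enorm_of_nonneg (by positivity)]
    gcongr
    exact hw0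
  have hpm : AEStronglyMeasurable gp (volume.restrict (Ioo 0 l0)) := by
    rw [← hscale]
    refine aestronglyMeasurable_of_comp measurableSet_Ioo (Φ' := fun _ => l0) (D := l0)
      (fun x _ => by simpa using ((hasDerivAt_id x).const_mul l0).hasDerivWithinAt)
      (fun x _ y _ hxy => mul_left_cancel₀ hl0.ne' hxy) continuousOn_const
      (fun x _ => by rw [abs_of_pos hl0]) ?_
    have e1 : (fun x => gp (l0 * x)) = fun x => w0 x / l0 ^ 2 := by
      funext x; simp only [hgp]
      rw [mul_div_cancel_left₀ _ hl0.ne']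
    rw [e1]
    exact (hf0.memLp.integrable one_le_two).div_const _
  have hΦ'b : ∀ x ∈ Ioo 0 T, |-(ζ * N x)| ≤ ζ * n1 := fun x _ => by
    rw [abs_neg, abs_of_pos (mul_pos hζ (hNp x))]
    exact mul_le_mul_of_nonneg_left (hNn1 x) hζ.le
  have hgnq : ∀ᵐ s ∂(volume.restrict (Ioo 0 T)), gn (Φ s) = q s :=
    (ae_restrict_iff' measurableSet_Ioo).mpr (Eventually.of_forall fun s hs => by
      simp only [hgn]; rw [hkΦ s hs])
  have hnn : eLpNorm gn 2 (volume.restrict (Ioo (Φ T) 0)) ≤ ENNReal.ofReal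
      (Real.sqrt (ζ * n1) * (1 / (ζ ^ 2 * n0 ^ 2) + 1 / (ζ ^ 2 * n0 ^ 3)) * κ) := by
    rw [← hΦim']
    refine (eLpNorm_two_image_le measurableSet_Ioo (fun x _ => (hΦd x).hasDerivWithinAt)
      hΦanti.injective.injOn (by positivity) hΦ'b).trans ?_
    rw [mul_assoc, ENNReal.ofReal_mul (Real.sqrt_nonneg _)]
    gcongr
    rw [eLpNorm_congr_ae hgnq]
    exact hqn
  have hnm : AEStronglyMeasurable gn (volume.restrict (Ioo (Φ T) 0)) := by
    rw [← hΦim']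
    refine aestronglyMeasurable_of_comp measurableSet_Ioo (fun x _ => (hΦd x).hasDerivWithinAt)
      hΦanti.injective.injOn (by fun_prop) hΦ'b ?_
    exact (integrable_congr hgnq).mpr (hqM.integrable one_le_two)
  -- The two pieces live on disjoint intervals abutting at `0`, and the profile is continued beyond
  -- them with zero second derivative.
  set g2 : ℝ → ℝ := (Ioo 0 l0).indicator gp + (Ioo (Φ T) 0).indicator gn with hg2
  have hpm' := (aestronglyMeasurable_indicator_iff (μ := volume) measurableSet_Ioo).mpr hpm
  have hnm' := (aestronglyMeasurable_indicator_iff (μ := volume) measurableSet_Ioo).mpr hnm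
  have hg2n : eLpNorm g2 2 volume ≤ ENNReal.ofReal (C2 * κ) := by
    refine (eLpNorm_add_le hpm' hnm' one_le_two).trans ?_
    rw [hC2, add_mul, ENNReal.ofReal_add (by positivity) (by positivity),
      eLpNorm_indicator_eq_eLpNorm_restrict measurableSet_Ioo,
      eLpNorm_indicator_eq_eLpNorm_restrict measurableSet_Ioo]
    exact add_le_add hpn hnn
  have hg2M : MemLp g2 2 volume := ⟨hpm'.add hnm', hg2n.trans_lt ENNReal.ofReal_lt_top⟩
  have hg2i := hg2M.intervalIntegrable
  -- The slope at the origin seen from the initial datum; the first order compatibility condition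
  -- identifies it with the slope seen from the inflow.
  set c1 : ℝ := v0 0 / l0 with hc1
  have hg1c : Continuous (prim c1 g2) := continuous_prim hg2i
  -- values on the two sides
  have hpos : ∀ z ∈ Icc 0 l0, prim c1 g2 z = v0 (z / l0) / l0 := by
    intro z hz
    have hz' : z / l0 ∈ Icc (0 : ℝ) 1 := ⟨div_nonneg hz.1 hl0.le, (div_le_one hl0).mpr hz.2⟩
    have e1 : ∫ y in (0 : ℝ)..z, g2 y = ∫ y in (0 : ℝ)..z, w0 (y / l0) / l0 ^ 2 := by
      rw [intervalIntegral.integral_of_le hz.1, intervalIntegral.integral_of_le hz.1,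
        integral_Ioc_eq_integral_Ioo, integral_Ioc_eq_integral_Ioo]
      refine setIntegral_congr_fun measurableSet_Ioo fun y hy => ?_
      have h1 : y ∈ Ioo 0 l0 := ⟨hy.1, hy.2.trans_le hz.2⟩
      have h2 : y ∉ Ioo (Φ T) 0 := fun h' => lt_asymm hy.1 h'.2
      simp only [hg2, Pi.add_apply, indicator_of_mem h1, indicator_of_notMem h2, add_zero, hgp]
    simp only [prim]
    rw [e1, intervalIntegral.integral_div, intervalIntegral.integral_comp_div w0 hl0.ne',
      hf0.snd _ hz', zero_div, hc1, smul_eq_mul]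
    field_simp
  have hneg : ∀ t ∈ Icc 0 T, prim c1 g2 (Φ t) = -(p t) / ζ := by
    intro t ht
    have hΦt : Φ t ≤ 0 := by rw [← hΦ0]; exact hΦanti.antitone ht.1
    have cov := integral_Icc_deriv_smul_of_deriv_nonpos (g := g2) (a := 0) (b := t)
      hΦc.continuousOn (fun x _ => hΦd x)
      (fun x _ => (neg_neg_of_pos (mul_pos hζ (hNp x))).le) ht.1
    rw [hΦ0] at cov
    have e1 : ∫ y in (0 : ℝ)..Φ t, g2 y = -∫ y in Icc (Φ t) 0, g2 y := by
      rw [intervalIntegral.integral_symm, intervalIntegral.integral_of_le hΦt,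
        integral_Icc_eq_integral_Ioc]
    have e2 : ∫ x in Icc 0 t, -(ζ * N x) • g2 (Φ x) = ∫ x in (0 : ℝ)..t, -(1 / ζ) * deriv p x := by
      rw [intervalIntegral.integral_of_le ht.1, integral_Icc_eq_integral_Ioo,
        integral_Ioc_eq_integral_Ioo]
      refine setIntegral_congr_fun measurableSet_Ioo fun x hx => ?_
      have hxT : x ∈ Ioo 0 T := ⟨hx.1, hx.2.trans_le ht.2⟩
      have h1 : Φ x ∈ Ioo (Φ T) 0 := hΦim ⟨x, hxT, rfl⟩
      have h2 : Φ x ∉ Ioo 0 l0 := fun h' => lt_asymm h1.2 h'.1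
      simp only [hg2, Pi.add_apply, indicator_of_mem h1, indicator_of_notMem h2, zero_add, hgn]
      rw [hkΦ x hxT]
      simp only [hq, smul_eq_mul]
      have := (hNp x).ne'
      field_simp
    have e3 : ∫ x in (0 : ℝ)..t, deriv p x = p t - p 0 :=
      (hpAC.mono (by rw [uIcc_of_le ht.1, uIcc_of_le hT.le]
                     exact Icc_subset_Icc_right ht.2)).integral_deriv_eq_sub
    simp only [prim]
    rw [e1, ← cov, e2, intervalIntegral.integral_const_mul, e3]
    have hp0 : p 0 = vh 0 / N 0 := hpval 0 ⟨le_rfl, hT.le⟩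
    -- No jump of `G'` at the corner: this is where the first order compatibility condition enters.
    have h0 : c1 = -(p 0) / ζ := by
      rw [hc1, hp0]
      have := (hNp 0).ne'
      have e4 : v0 0 = -(l0 / (ζ * N 0) * vh 0) := by linarith
      rw [e4]; field_simp
    rw [h0]; field_simp; ring
  refine ⟨c1, g2, hg2M, hg2n.trans (ENNReal.ofReal_le_ofReal ?_), fun z => ?_, fun z hz => ?_,
    fun t ht => ?_⟩
  · refine mul_le_mul_of_nonneg_right ?_ hκ
    have : 0 ≤ 1 / la + Real.sqrt ((lb + 1) - (-(ζ * n1 * T + 1))) * C2 := by positivity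
    linarith
  · -- sup bound
    have hMT : prim 0 N T ≤ n1 * T := by
      simp only [prim, zero_add]
      have := intervalIntegral.integral_mono_on hT.le (hN.intervalIntegrable 0 T)
        (intervalIntegrable_const (μ := volume) (c := n1)) (fun x _ => hNn1 x)
      rw [intervalIntegral.integral_const, smul_eq_mul] at this
      linarith
    have hΦT : -(ζ * n1 * T) ≤ Φ T := by
      simp only [hΦ]
      have := mul_le_mul_of_nonneg_left hMT hζ.le
      linarith
    set A := -(ζ * n1 * T + 1) with hA
    set B := lb + 1 with hB
    have hAB : A < B := by
      have : 0 < ζ * n1 * T := by positivity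
      simp only [hA, hB]; linarith
    have hsupp : ∀ y, y ∉ Ioc A B → g2 y = 0 := by
      intro y hy
      have h1 : y ∉ Ioo 0 l0 := fun h' => hy ⟨by
        have : 0 < ζ * n1 * T := by positivity
        simp only [hA]; linarith [h'.1], by simp only [hB]; linarith [h'.2]⟩
      have h2 : y ∉ Ioo (Φ T) 0 := fun h' => hy ⟨by
        simp only [hA]; linarith [h'.1], by simp only [hB]; linarith [h'.2]⟩
      simp only [hg2, Pi.add_apply, indicator_of_notMem h1, indicator_of_notMem h2, add_zero]
    have i1 := integral_abs_le_of_normLp_two_le hAB (δ := C2 * κ) (by positivity)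
      (hg2M.restrict (Ioo A B)) ((eLpNorm_restrict_le _ _ _ _).trans hg2n)
    have e2 : ∫ y in A..B, |g2 y| = ∫ y, |g2 y| :=
      intervalIntegral.integral_eq_integral_of_support_subset fun y hy => by
        by_contra h'; exact hy (by simp [hsupp y h'])
    have hg2L1 : Integrable (fun y => |g2 y|) := by
      have := (hg2i A B).abs
      rw [intervalIntegrable_iff_integrableOn_Ioc_of_le hAB.le] at this
      rw [← integrableOn_iff_integrable_of_support_subset (s := Ioc A B)]
      · exact this
      · intro y hy
        by_contra h'; exact hy (by simp [hsupp y h'])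
    have i3 : |∫ y in (0 : ℝ)..z, g2 y| ≤ ∫ y, |g2 y| := by
      have h2 := intervalIntegral.norm_integral_le_integral_norm_uIoc (f := g2) (a := 0) (b := z)
        (μ := volume)
      rw [Real.norm_eq_abs] at h2
      exact h2.trans (setIntegral_le_integral hg2L1 (Eventually.of_forall fun y => abs_nonneg _))
    have i4 : |c1| ≤ 1 / la * κ := by
      rw [hc1, abs_div, abs_of_pos hl0, one_div_mul_eq_div]
      exact div_le_div₀ hκ hv0 hla hl0a
    have i5 : |prim c1 g2 z| ≤ |c1| + |∫ y in (0 : ℝ)..z, g2 y| := abs_add_le _ _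
    rw [e2] at i1
    have : 0 ≤ C2 * κ := by positivity
    linarith
  · -- initial datum
    have e1 : ∫ y in (0 : ℝ)..z, prim c1 g2 y = ∫ y in (0 : ℝ)..z, v0 (y / l0) / l0 := by
      refine intervalIntegral.integral_congr fun y hy => ?_
      rw [uIcc_of_le hz.1] at hy
      exact hpos y ⟨hy.1, hy.2.trans hz.2⟩
    have hz' : z / l0 ∈ Icc (0 : ℝ) 1 := ⟨div_nonneg hz.1 hl0.le, (div_le_one hl0).mpr hz.2⟩
    rw [prim, e1, intervalIntegral.integral_div, intervalIntegral.integral_comp_div v0 hl0.ne',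
      hf0.fst _ hz', zero_div, smul_eq_mul]
    field_simp
  · -- boundary datum
    have d1 : ∀ s ∈ uIcc 0 t, HasDerivAt (fun s => prim (f0 0) (prim c1 g2) (Φ s))
        (prim c1 g2 (Φ s) * (-(ζ * N s))) s := fun s _ =>
      (hasDerivAt_prim hg1c (Φ s)).comp s (hΦd s)
    have e1 := intervalIntegral.integral_eq_sub_of_hasDerivAt d1
      (Continuous.intervalIntegrable ((hg1c.comp hΦc).mul (hN.const_mul ζ).neg) _ _)
    have e2 : ∫ s in (0 : ℝ)..t, prim c1 g2 (Φ s) * (-(ζ * N s)) = ∫ s in (0 : ℝ)..t, vh s := by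
      refine intervalIntegral.integral_congr fun s hs => ?_
      rw [uIcc_of_le ht.1] at hs
      have hsT : s ∈ Icc 0 T := ⟨hs.1, hs.2.trans ht.2⟩
      rw [hneg s hsT, hpval s hsT]
      have := (hNp s).ne'
      field_simp
    rw [e2, hΦ0, prim_zero] at e1
    rw [hh.fst t ht, hcomp0, e1]
    change prim (f0 0) (prim c1 g2) (Φ t) = _
    ring

end Profile

/-! ### Time slices of a travelling profile and continuity in `H²` -/

section Slices

lemma ENNReal.tendsto_zero_of_forall_ofReal {ι : Type*} {F : Filter ι} {φ : ι → ℝ≥0∞}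
    (h : ∀ r : ℝ, 0 < r → ∀ᶠ s in F, φ s ≤ ENNReal.ofReal r) : Tendsto φ F (𝓝 0) := by
  rw [ENNReal.tendsto_nhds_zero]
  intro ε hε
  obtain ⟨r, -, hr0, hr⟩ := ENNReal.lt_iff_exists_real_btwn.mp hε
  have hr' : 0 < r := by simpa using hr0
  filter_upwards [h r hr'] with s hs using hs.trans hr.le

/-- The inverse substitution has Jacobian `1 / l`; restricting to `(0, 1)` only decreases the norm.
-/
lemma eLpNorm_two_affine_le {g : ℝ → ℝ} {l : ℝ} (hl : 0 < l) (m : ℝ) :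
    eLpNorm (fun x => l ^ 2 * g (l * x - m)) 2 (volume.restrict (Ioo 0 1))
      ≤ ENNReal.ofReal (l ^ 2 * Real.sqrt (1 / l)) * eLpNorm g 2 volume := by
  have e : (fun x => l ^ 2 * g (l * x - m)) = (l ^ 2) • fun x => g (l * x - m) := rfl
  rw [e, eLpNorm_const_smul, Real.enorm_of_nonneg (by positivity),
    ENNReal.ofReal_mul (by positivity), mul_assoc]
  gcongr
  refine (eLpNorm_restrict_le _ _ _ _).trans ?_
  have him : (fun y => (y + m) / l) '' univ = univ := by
    rw [image_univ, range_eq_univ]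
    exact fun x => ⟨l * x - m, by field_simp; ring⟩
  have key := eLpNorm_two_image_le (g := fun x => g (l * x - m)) MeasurableSet.univ
    (Φ := fun y => (y + m) / l) (Φ' := fun _ => 1 / l)
    (fun y _ => (((hasDerivAt_id y).add_const m).div_const l).hasDerivWithinAt)
    (fun x _ y _ hxy => by
      have := (div_left_inj' hl.ne').mp hxy
      linarith) (D := 1 / l) (by positivity) (fun x _ => by rw [abs_of_pos (by positivity)])
  rw [him, Measure.restrict_univ] at key
  refine key.trans (le_of_eq ?_)
  congr 2
  funext y
  congr 1
  field_simp; ring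

lemma aestronglyMeasurable_affine {g : ℝ → ℝ} (hg : MemLp g 2 volume) {l : ℝ} (hl : 0 < l)
    (m : ℝ) : AEStronglyMeasurable (fun x => g (l * x - m)) (volume.restrict (Ioo 0 1)) := by
  have key := aestronglyMeasurable_of_comp (g := fun x => g (l * x - m))
    (measurableSet_Ioo (a := -m) (b := l - m))
    (Φ := fun y => (y + m) / l) (Φ' := fun _ => 1 / l)
    (fun y _ => (((hasDerivAt_id y).add_const m).div_const l).hasDerivWithinAt)
    (fun x _ y _ hxy => by
      have := (div_left_inj' hl.ne').mp hxy
      linarith) (D := 1 / l) continuousOn_const (fun x _ => by rw [abs_of_pos (by positivity)])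
    (by
      have e : (fun y => g (l * ((y + m) / l) - m)) = g := by
        funext y; congr 1; field_simp; ring
      rw [e]
      exact (hg.restrict (Ioo (-m) (l - m))).integrable one_le_two)
  refine key.mono_measure (Measure.restrict_mono ?_ le_rfl)
  intro x hx
  exact ⟨l * x - m, ⟨by nlinarith [hx.1], by nlinarith [hx.2]⟩, by field_simp; ring⟩

lemma isH2Rep_slice {c0 c1 : ℝ} {g : ℝ → ℝ} (hg : MemLp g 2 volume) {l : ℝ} (hl : 0 < l) (m : ℝ) :
    IsH2Rep 0 1 (fun x => prim c0 (prim c1 g) (l * x - m)) (fun x => l * prim c1 g (l * x - m))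
      (fun x => l ^ 2 * g (l * x - m)) := by
  have hgi := hg.intervalIntegrable
  have hg1 : Continuous (prim c1 g) := continuous_prim hgi
  refine ⟨⟨(aestronglyMeasurable_affine hg hl m).const_mul _,
    (eLpNorm_two_affine_le hl m).trans_lt (ENNReal.mul_lt_top ENNReal.ofReal_lt_top hg.2)⟩,
    fun x _ => ?_, fun x _ => ?_⟩
  · rw [intervalIntegral.integral_const_mul, intervalIntegral.integral_comp_mul_sub _ hl.ne',
      ← prim_sub_prim (c := c0) (fun a b => hg1.intervalIntegrable a b), smul_eq_mul]
    field_simp; ring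
  · rw [intervalIntegral.integral_const_mul, intervalIntegral.integral_comp_mul_sub _ hl.ne',
      ← prim_sub_prim (c := c1) hgi, smul_eq_mul]
    field_simp; ring

lemma IsH2Rep.sub_const {a b : ℝ} {u v w : ℝ → ℝ} (h : IsH2Rep a b u v w) (c : ℝ) :
    IsH2Rep a b (fun x => u x - c) v w :=
  ⟨h.memLp, fun x hx => by rw [h.fst x hx]; ring, h.snd⟩

lemma IsH2Rep.sub {a b : ℝ} {u v w u' v' w' : ℝ → ℝ} (h : IsH2Rep a b u v w)
    (h' : IsH2Rep a b u' v' w') :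
    IsH2Rep a b (fun x => u x - u' x) (fun x => v x - v' x) (fun x => w x - w' x) := by
  have hsub : ∀ {f : ℝ → ℝ} {x : ℝ}, x ∈ Icc a b → IntervalIntegrable f volume a b →
      IntervalIntegrable f volume a x := fun hx hf => hf.mono_set (by
    rw [uIcc_of_le hx.1, uIcc_of_le (hx.1.trans hx.2)]; exact Icc_subset_Icc_right hx.2)
  refine ⟨h.memLp.sub h'.memLp, fun x hx => ?_, fun x hx => ?_⟩
  · have hab := hx.1.trans hx.2
    rw [intervalIntegral.integral_sub (hsub hx (h.intervalIntegrable_snd hab))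
      (hsub hx (h'.intervalIntegrable_snd hab)), h.fst x hx, h'.fst x hx]; ring
  · have hab := hx.1.trans hx.2
    rw [intervalIntegral.integral_sub (hsub hx (h.memLp.intervalIntegrable_of_two hab))
      (hsub hx (h'.memLp.intervalIntegrable_of_two hab)), h.snd x hx, h'.snd x hx]; ring

lemma h2Norm_slice_le {c0 c1 fpe K D δ : ℝ} {g : ℝ → ℝ} (hg : MemLp g 2 volume) {l : ℝ}
    (hl : 0 < l) (m : ℝ) (h0 : ∀ x ∈ Ioo (0 : ℝ) 1, |prim c0 (prim c1 g) (l * x - m) - fpe| ≤ K)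
    (h1 : ∀ z, |prim c1 g z| ≤ D) (hlD : l * D ≤ K) (h2 : eLpNorm g 2 volume ≤ ENNReal.ofReal δ)
    (h2K : l ^ 2 * Real.sqrt (1 / l) * δ ≤ K) :
    h2Norm 0 1 (fun x => prim c0 (prim c1 g) (l * x - m) - fpe) ≤ ENNReal.ofReal (2 * K) := by
  refine h2Norm_le zero_le_one ((isH2Rep_slice hg hl m).sub_const fpe)
    (normLp_le_of_bound measurableSet_Ioo (by simp) h0)
    (normLp_le_of_bound measurableSet_Ioo (by simp) fun x _ => ?_) ?_
  · rw [abs_mul, abs_of_pos hl]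
    exact (mul_le_mul_of_nonneg_left (h1 _) hl.le).trans hlD
  · refine (eLpNorm_two_affine_le hl m).trans ?_
    refine (mul_le_mul_right h2 _).trans ?_
    rw [← ENNReal.ofReal_mul (by positivity)]
    exact ENNReal.ofReal_le_ofReal h2K

lemma IsH2Rep.h2Norm_lt_top {a b : ℝ} (hab : a ≤ b) {u v w : ℝ → ℝ} (h : IsH2Rep a b u v w) :
    h2Norm a b u < ⊤ := by
  have hc : ∀ f : ℝ → ℝ, ContinuousOn f (Icc a b) → normLp (Ioo a b) 2 f < ⊤ := by
    intro f hf
    obtain ⟨C, hC⟩ := isCompact_Icc.exists_bound_of_continuousOn hf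
    refine (eLpNorm_le_of_ae_bound (C := C) ((ae_restrict_iff' measurableSet_Ioo).mpr
      (Eventually.of_forall fun x hx => hC x (Ioo_subset_Icc_self hx)))).trans_lt ?_
    refine ENNReal.mul_lt_top (ENNReal.rpow_lt_top_of_nonneg (by positivity) (by simp))
      ENNReal.ofReal_lt_top
  have hu := hc u (h.continuousOn hab)
  have hv := hc v (h.continuousOn_snd hab)
  have hw : normLp (Ioo a b) 2 w < ⊤ := h.memLp.2
  set X := normLp (Ioo a b) 2 u + normLp (Ioo a b) 2 v + normLp (Ioo a b) 2 w with hX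
  have hXt : X ≠ ⊤ := by simp [hX, hu.ne, hv.ne, hw.ne]
  refine (h2Norm_le hab h (m := X.toReal) ?_ ?_ ?_).trans_lt ENNReal.ofReal_lt_top
  · rw [ENNReal.ofReal_toReal hXt, hX, add_assoc]; exact le_self_add
  · rw [ENNReal.ofReal_toReal hXt, hX, add_right_comm]; exact le_add_self
  · rw [ENNReal.ofReal_toReal hXt, hX]; exact le_add_self

/-- Compactness of `[0, 1]` turns joint continuity into convergence uniform in `x`. -/
lemma eventually_forall_Icc_abs_sub_lt {ι : Type*} {F : Filter ι} {H : ℝ × ℝ → ℝ → ℝ}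
    (hH : Continuous fun q : (ℝ × ℝ) × ℝ => H q.1 q.2) {p : ι → ℝ × ℝ} {p0 : ℝ × ℝ}
    (hp : Tendsto p F (𝓝 p0)) {r : ℝ} (hr : 0 < r) :
    ∀ᶠ s in F, ∀ x ∈ Icc (0 : ℝ) 1, |H (p s) x - H p0 x| < r := by
  refine hp.eventually (p := fun q => ∀ x ∈ Icc (0 : ℝ) 1, |H q x - H p0 x| < r) ?_
  refine isCompact_Icc.eventually_forall_of_forall_eventually fun x _ => ?_
  have hc : Continuous fun q : (ℝ × ℝ) × ℝ => |H q.1 q.2 - H p0 q.2| :=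
    (hH.sub (hH.comp (continuous_const.prodMk continuous_snd))).abs
  have := hc.tendsto (p0, x)
  simp only [sub_self, abs_zero] at this
  exact this.eventually (gt_mem_nhds hr)

/-- Continuity of dilations and translations in `L²`: clear by uniform convergence for continuous
compactly supported functions, and carried over by density because the substitutions are uniformly
bounded for dilation factors near `l0`. -/
lemma tendsto_normLp_two_affine {g : ℝ → ℝ} (hg : MemLp g 2 volume) {ι : Type*} {F : Filter ι}
    {l m : ι → ℝ} {l0 m0 : ℝ} (hl0 : 0 < l0) (hl : Tendsto l F (𝓝 l0)) (hm : Tendsto m F (𝓝 m0)) :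
    Tendsto (fun s => normLp (Ioo 0 1) 2
      (fun x => l s ^ 2 * g (l s * x - m s) - l0 ^ 2 * g (l0 * x - m0))) F (𝓝 0) := by
  refine ENNReal.tendsto_zero_of_forall_ofReal fun r hr => ?_
  -- Bounds `a² √(1/a)`, the norm of the substitution, for all `a` in `[l0 / 2, 2 l0]`.
  set K : ℝ := (2 * l0) ^ 2 * Real.sqrt (1 / (l0 / 2)) with hK
  have hKp : 0 < K := by positivity
  obtain ⟨g', hg'c, hg'n, hg'cont, hg'M⟩ := hg.exists_hasCompactSupport_eLpNorm_sub_le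
    (by simp) (ε := ENNReal.ofReal (r / 3 / K)) (by
      simp only [ne_eq, ENNReal.ofReal_eq_zero, not_le]; positivity)
  have hdM : MemLp (g - g') 2 volume := hg.sub hg'M
  have hsmall : ∀ a b : ℝ, l0 / 2 ≤ a → a ≤ 2 * l0 →
      eLpNorm (fun x => a ^ 2 * (g - g') (a * x - b)) 2 (volume.restrict (Ioo 0 1))
        ≤ ENNReal.ofReal (r / 3) := by
    intro a b h1 h2
    have ha : 0 < a := by linarith
    refine (eLpNorm_two_affine_le ha b).trans
      ((mul_le_mul' (b := ENNReal.ofReal K) ?_ hg'n).trans ?_)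
    · refine ENNReal.ofReal_le_ofReal ?_
      rw [hK]
      gcongr
    · rw [← ENNReal.ofReal_mul hKp.le]
      refine ENNReal.ofReal_le_ofReal (le_of_eq ?_)
      field_simp
  have hmeas : ∀ a b : ℝ, l0 / 2 ≤ a → AEStronglyMeasurable
      (fun x => a ^ 2 * (g - g') (a * x - b)) (volume.restrict (Ioo 0 1)) := fun a b h1 =>
    (aestronglyMeasurable_affine hdM (by linarith) b).const_mul _
  have hH : Continuous fun q : (ℝ × ℝ) × ℝ => q.1.1 ^ 2 * g' (q.1.1 * q.2 - q.1.2) := by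
    exact (by fun_prop : Continuous fun q : (ℝ × ℝ) × ℝ => q.1.1 ^ 2).mul
      (hg'cont.comp (by fun_prop))
  filter_upwards [eventually_forall_Icc_abs_sub_lt (H := fun p x => p.1 ^ 2 * g' (p.1 * x - p.2))
    hH (hl.prodMk_nhds hm) (show 0 < r / 3 by positivity),
    hl.eventually (Icc_mem_nhds (show l0 / 2 < l0 by linarith) (show l0 < 2 * l0 by linarith))]
    with s h1 h2
  have e : (fun x => l s ^ 2 * g (l s * x - m s) - l0 ^ 2 * g (l0 * x - m0))
      = ((fun x => l s ^ 2 * (g - g') (l s * x - m s)) - fun x => l0 ^ 2 * (g - g') (l0 * x - m0))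
        + fun x => l s ^ 2 * g' (l s * x - m s) - l0 ^ 2 * g' (l0 * x - m0) := by
    funext x; simp only [Pi.add_apply, Pi.sub_apply]; ring
  have hm1 := hmeas (l s) (m s) h2.1
  have hm2 := hmeas l0 m0 (by linarith)
  have hm3 : AEStronglyMeasurable (fun x => l s ^ 2 * g' (l s * x - m s)
      - l0 ^ 2 * g' (l0 * x - m0)) (volume.restrict (Ioo 0 1)) :=
    Continuous.aestronglyMeasurable (((hg'cont.comp (by fun_prop)).const_mul _).sub
      ((hg'cont.comp (by fun_prop)).const_mul _))
  have hm4 : normLp (Ioo 0 1) 2 (fun x => l s ^ 2 * g' (l s * x - m s)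
      - l0 ^ 2 * g' (l0 * x - m0)) ≤ ENNReal.ofReal (r / 3) :=
    normLp_le_of_bound measurableSet_Ioo (by simp) fun x hx => (h1 x (Ioo_subset_Icc_self hx)).le
  calc normLp (Ioo 0 1) 2 (fun x => l s ^ 2 * g (l s * x - m s) - l0 ^ 2 * g (l0 * x - m0))
      ≤ ENNReal.ofReal (r / 3) + ENNReal.ofReal (r / 3) + ENNReal.ofReal (r / 3) := by
        rw [e]
        refine (eLpNorm_add_le (hm1.sub hm2) hm3 one_le_two).trans (add_le_add ?_ hm4)
        exact (eLpNorm_sub_le hm1 hm2 one_le_two).trans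
          (add_le_add (hsmall _ _ h2.1 h2.2) (hsmall _ _ (by linarith) (by linarith)))
    _ = ENNReal.ofReal r := by
        rw [← ENNReal.ofReal_add (by positivity) (by positivity),
          ← ENNReal.ofReal_add (by positivity) (by positivity)]
        congr 1; ring

/-- A travelling profile with square integrable second derivative is continuous in time with values
in `H²`. -/
theorem memC0H2_slice {T c0 c1 : ℝ} {g : ℝ → ℝ} (hg : MemLp g 2 volume) {l m : ℝ → ℝ}
    (hl : ContinuousOn l (Icc 0 T)) (hm : ContinuousOn m (Icc 0 T))
    (hlp : ∀ t ∈ Icc 0 T, 0 < l t) :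
    MemC0H2 T (fun t x => prim c0 (prim c1 g) (l t * x - m t)) := by
  have hg1 : Continuous (prim c1 g) := continuous_prim hg.intervalIntegrable
  have hg0 : Continuous (prim c0 (prim c1 g)) := continuous_prim fun a b =>
    hg1.intervalIntegrable a b
  refine ⟨fun t ht => ⟨(hg0.comp (by fun_prop)).continuousOn,
    (isH2Rep_slice hg (hlp t ht) (m t)).h2Norm_lt_top zero_le_one⟩, fun t ht => ?_⟩
  refine ENNReal.tendsto_zero_of_forall_ofReal fun r hr => ?_
  have hp : Tendsto (fun s => (l s, m s)) (𝓝[Icc 0 T] t) (𝓝 (l t, m t)) :=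
    (hl t ht).tendsto.prodMk_nhds (hm t ht).tendsto
  have hr2 : 0 < r / 2 := by positivity
  filter_upwards [self_mem_nhdsWithin,
    eventually_forall_Icc_abs_sub_lt (H := fun p x => prim c0 (prim c1 g) (p.1 * x - p.2))
      (hg0.comp (by fun_prop)) hp hr2,
    eventually_forall_Icc_abs_sub_lt (H := fun p x => p.1 * prim c1 g (p.1 * x - p.2))
      ((by fun_prop : Continuous fun q : (ℝ × ℝ) × ℝ => q.1.1).mul (hg1.comp (by fun_prop))) hp hr2,
    (ENNReal.tendsto_nhds_zero.mp (tendsto_normLp_two_affine hg (hlp t ht) (hl t ht).tendsto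
      (hm t ht).tendsto)) (ENNReal.ofReal (r / 2)) (by simpa using hr2)] with s hs h1 h2 h3
  have key := h2Norm_le zero_le_one
    ((isH2Rep_slice (c0 := c0) (c1 := c1) hg (hlp s hs) (m s)).sub
      (isH2Rep_slice (c0 := c0) (c1 := c1) hg (hlp t ht) (m t)))
    (normLp_le_of_bound measurableSet_Ioo (by simp) fun x hx => (h1 x (Ioo_subset_Icc_self hx)).le)
    (normLp_le_of_bound measurableSet_Ioo (by simp) fun x hx => (h2 x (Ioo_subset_Icc_self hx)).le)
    h3
  rwa [mul_div_cancel₀ _ two_ne_zero] at key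

end Slices

open scoped NNReal

/-! ### The interface equation near the equilibrium -/

section Interface

/-- Proportionality to the screw speed makes the equilibrium condition, the Lipschitz bound and the
comparison with `ζ N` independent of `N`. -/
lemma Extruder.F_eq_mul (P : Extruder) (l N f : ℝ) : P.F l N f = N * P.F l 1 f := by
  simp only [Extruder.F, Extruder.Fd]; ring

/-- `[le - r, le + r] × [fpe - r, fpe + r]` is a neighbourhood of the equilibrium inside the
physical domain, on which `F(·, 1, ·)` is Lipschitz and bounded by the screw pitch. -/
structure Extruder.IsBox (P : Extruder) (le fpe r Λ : ℝ) : Prop where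
  r_pos : 0 < r
  one_le : 1 ≤ Λ
  l_pos : 0 < le - r
  l_lt : le + r < P.L
  f_pos : 0 < fpe - r
  f_lt : fpe + r < 1
  eq_zero : P.F le 1 fpe = 0
  lip : ∀ l ∈ Icc (le - r) (le + r), ∀ l' ∈ Icc (le - r) (le + r),
    ∀ f ∈ Icc (fpe - r) (fpe + r), ∀ f' ∈ Icc (fpe - r) (fpe + r),
      |P.F l 1 f - P.F l' 1 f'| ≤ Λ * (|l - l'| + |f - f'|)
  le_zeta : ∀ l ∈ Icc (le - r) (le + r), ∀ f ∈ Icc (fpe - r) (fpe + r), |P.F l 1 f| ≤ P.zeta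

/-- `F(·, 1, ·)` is `C¹` near the equilibrium, hence Lipschitz there. Since it vanishes at the
equilibrium, shrinking the box makes it smaller than `ζ`. -/
theorem Extruder.exists_isBox (P : Extruder) {le Ne fpe : ℝ} (hle : le ∈ Ioo 0 P.L) (hNe : 0 < Ne)
    (hfpe : fpe ∈ Ioo (0 : ℝ) 1) (heq : P.F le Ne fpe = 0) : ∃ r Λ, P.IsBox le fpe r Λ := by
  have h0 : P.F le 1 fpe = 0 := by
    rw [P.F_eq_mul] at heq
    exact (mul_eq_zero.mp heq).resolve_left hNe.ne'
  have hsm : ContDiffAt ℝ 1 (fun p : ℝ × ℝ => P.F p.1 1 p.2) (le, fpe) := by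
    have h1 : P.B * P.rho + P.Kd * (P.L - le) ≠ 0 := by
      have := mul_pos P.B_pos P.rho_pos
      have := mul_pos P.Kd_pos (sub_pos.mpr hle.2)
      positivity
    have h2 : P.rho * P.Seff * (1 - fpe) ≠ 0 :=
      (mul_pos (mul_pos P.rho_pos P.Seff_pos) (sub_pos.mpr hfpe.2)).ne'
    simp only [Extruder.F, Extruder.Fd]
    refine ContDiffAt.div (ContDiffAt.sub (ContDiffAt.div (by fun_prop) (by fun_prop) h1)
      (by fun_prop)) (by fun_prop) h2
  obtain ⟨K, t, ht, hK⟩ := hsm.exists_lipschitzOnWith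
  obtain ⟨δ, hδ, hδt⟩ := Metric.nhds_basis_closedBall.mem_iff.mp ht
  set Λ : ℝ := max K 1 with hΛ
  have hΛ1 : 1 ≤ Λ := le_max_right _ _
  -- In order: stay in the Lipschitz neighbourhood, have `2 Λ r ≤ ζ`, and keep `l` and `f` strictly
  -- inside the physical ranges.
  set r : ℝ := min (min δ (P.zeta / (2 * Λ))) (min (min (le / 2) ((P.L - le) / 2))
    (min (fpe / 2) ((1 - fpe) / 2))) with hr
  have hrp : 0 < r := by
    have := P.zeta_pos; have := hle.1; have := hle.2; have := hfpe.1; have := hfpe.2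
    simp only [hr, lt_min_iff]
    refine ⟨⟨hδ, by positivity⟩, ⟨by linarith, by linarith⟩, by linarith, by linarith⟩
  have r1 : r ≤ δ := (min_le_left _ _).trans (min_le_left _ _)
  have r2 : r ≤ P.zeta / (2 * Λ) := (min_le_left _ _).trans (min_le_right _ _)
  have r3 : r ≤ le / 2 := (min_le_right _ _).trans ((min_le_left _ _).trans (min_le_left _ _))
  have r4 : r ≤ (P.L - le) / 2 :=
    (min_le_right _ _).trans ((min_le_left _ _).trans (min_le_right _ _))
  have r5 : r ≤ fpe / 2 := (min_le_right _ _).trans ((min_le_right _ _).trans (min_le_left _ _))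
  have r6 : r ≤ (1 - fpe) / 2 :=
    (min_le_right _ _).trans ((min_le_right _ _).trans (min_le_right _ _))
  have hmem : ∀ l ∈ Icc (le - r) (le + r), ∀ f ∈ Icc (fpe - r) (fpe + r), (l, f) ∈ t := by
    intro l hl f hf
    refine hδt ?_
    rw [Metric.mem_closedBall, Prod.dist_eq, max_le_iff, Real.dist_eq, Real.dist_eq, abs_le, abs_le]
    exact ⟨⟨by simp only; linarith [hl.1], by simp only; linarith [hl.2]⟩,
      ⟨by simp only; linarith [hf.1], by simp only; linarith [hf.2]⟩⟩
  have hlip : ∀ l ∈ Icc (le - r) (le + r), ∀ l' ∈ Icc (le - r) (le + r),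
      ∀ f ∈ Icc (fpe - r) (fpe + r), ∀ f' ∈ Icc (fpe - r) (fpe + r),
      |P.F l 1 f - P.F l' 1 f'| ≤ Λ * (|l - l'| + |f - f'|) := by
    intro l hl l' hl' f hf f' hf'
    have h1 := hK.dist_le_mul (l, f) (hmem l hl f hf) (l', f') (hmem l' hl' f' hf')
    rw [Prod.dist_eq, Real.dist_eq, Real.dist_eq, Real.dist_eq] at h1
    refine h1.trans (mul_le_mul (le_max_left _ _) ?_ (by positivity) (by positivity))
    exact max_le (by simp) (by simp)
  refine ⟨r, Λ, hrp, hΛ1, by linarith [hle.1], by linarith [hle.2], by linarith [hfpe.1],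
    by linarith [hfpe.2], h0, hlip, fun l hl f hf => ?_⟩
  have h1 := hlip l hl le ⟨by linarith, by linarith⟩ f hf fpe ⟨by linarith, by linarith⟩
  rw [h0, sub_zero] at h1
  have h2 : |l - le| ≤ r := abs_le.mpr ⟨by linarith [hl.1], by linarith [hl.2]⟩
  have h3 : |f - fpe| ≤ r := abs_le.mpr ⟨by linarith [hf.1], by linarith [hf.2]⟩
  rw [le_div_iff₀ (by positivity)] at r2
  have : Λ * (|l - le| + |f - fpe|) ≤ Λ * (r + r) := by gcongr
  linarith

/-- Truncation to `[c - r, c + r]`. -/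
noncomputable def clip (c r x : ℝ) : ℝ := max (c - r) (min (c + r) x)

lemma clip_mem {c r : ℝ} (hr : 0 < r) (x : ℝ) : clip c r x ∈ Icc (c - r) (c + r) :=
  ⟨le_max_left _ _, max_le (by linarith) (min_le_left _ _)⟩

lemma clip_eq {c r x : ℝ} (hx : |x - c| ≤ r) : clip c r x = x := by
  rw [abs_le] at hx
  rw [clip, min_eq_right (by linarith), max_eq_right (by linarith)]

lemma abs_clip_sub_clip_le (c r x y : ℝ) : |clip c r x - clip c r y| ≤ |x - y| := by
  simp only [clip]
  refine (abs_max_sub_max_le_max _ _ _ _).trans ?_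
  rw [sub_self, abs_zero]
  refine max_le (abs_nonneg _) ((abs_min_sub_min_le_max _ _ _ _).trans ?_)
  rw [sub_self, abs_zero]
  exact max_le (abs_nonneg _) le_rfl

/-- Global solvability of a scalar differential equation with bounded Lipschitz right-hand side. -/
theorem exists_solution_of_bounded_lipschitz {T : ℝ} (hT : 0 < T) {V : ℝ → ℝ → ℝ} {K A : ℝ≥0}
    (hV : Continuous fun p : ℝ × ℝ => V p.1 p.2) (hK : ∀ t, LipschitzWith K (V t))
    (hA : ∀ t x, |V t x| ≤ A) (x0 : ℝ) :
    ∃ l a : ℝ → ℝ, Continuous a ∧ (∀ t, HasDerivAt l (a t) t) ∧ l 0 = x0 ∧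
      ∀ t ∈ Icc 0 T, a t = V t (l t) := by
  -- A ball of radius `A T` cannot be left in time `T` at speed at most `A`, so the local theorem
  -- covers all of `[0, T]`.
  have hPL : IsPicardLindelof V (tmin := 0) (tmax := T) ⟨0, le_rfl, hT.le⟩ x0
      (A * T.toNNReal) 0 A K := by
    refine ⟨fun t _ => (hK t).lipschitzOnWith, fun x _ => ?_, fun t _ x _ => hA t x, ?_⟩
    · exact (hV.comp (continuous_id.prodMk continuous_const)).continuousOn
    · simp [hT.le]
  obtain ⟨α, hα0, hα⟩ := hPL.exists_eq_forall_mem_Icc_hasDerivWithinAt₀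
  have hαc : ContinuousOn α (Icc 0 T) := fun t ht => (hα t ht).continuousWithinAt
  have hac : ContinuousOn (fun t => V t (α t)) (Icc 0 T) :=
    hV.comp_continuousOn (continuousOn_id.prodMk hαc)
  -- Constant extension of the velocity beyond `[0, T]`, so that its primitive is `C¹` on the whole
  -- line.
  set a : ℝ → ℝ := IccExtend hT.le ((Icc 0 T).domRestrict fun t => V t (α t)) with ha
  have hac' : Continuous a := (continuousOn_iff_continuous_domRestrict.mp hac).Icc_extend'
  have hae : ∀ t ∈ Icc 0 T, a t = V t (α t) := fun t ht => by
    rw [ha, IccExtend_of_mem _ _ ht]; rfl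
  have hl : ∀ t ∈ Icc 0 T, prim x0 a t = α t := by
    intro t ht
    have hsub : Icc 0 t ⊆ Icc 0 T := Icc_subset_Icc_right ht.2
    have h1 := intervalIntegral.integral_eq_sub_of_hasDerivAt_of_le ht.1 (hαc.mono hsub)
      (f' := a) (fun s hs => by
        have hs' : s ∈ Icc 0 T := ⟨hs.1.le, hs.2.le.trans ht.2⟩
        rw [hae s hs']
        exact (hα s hs').hasDerivAt (Icc_mem_nhds hs.1 (hs.2.trans_le ht.2)))
      (hac'.intervalIntegrable _ _)
    have h0 : α 0 = x0 := hα0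
    simp only [prim]
    rw [h1, h0]; ring
  exact ⟨prim x0 a, a, hac', hasDerivAt_prim hac', prim_zero _ _, fun t ht => by
    rw [hae t ht, hl t ht]⟩

set_option maxHeartbeats 1000000 in
/-- Existence and estimates for the interface position, given the transported profile `G`. -/
theorem Extruder.exists_interface (P : Extruder) {T le fpe r Λ n1 C1 : ℝ} (hT : 0 < T)
    (hbox : P.IsBox le fpe r Λ) (hn1 : 0 < n1) (hC1 : 0 < C1) :
    ∃ ε₀ > 0, ∃ C > 0, ∀ (ε l0 : ℝ) (N G g1 : ℝ → ℝ), 0 < ε → ε ≤ ε₀ → |l0 - le| ≤ ε →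
      Continuous N → (∀ t, 0 ≤ N t) → (∀ t, N t ≤ n1) →
      (∀ z, HasDerivAt G (g1 z) z) → (∀ z, |g1 z| ≤ C1 * ε) → |G 0 - fpe| ≤ C1 * ε →
      ∃ l a : ℝ → ℝ, Continuous a ∧ (∀ t, HasDerivAt l (a t) t) ∧ l 0 = l0 ∧
        ∀ t ∈ Icc 0 T, a t = P.F (l t) (N t) (G (l t - P.zeta * prim 0 N t)) ∧
          |l t - le| ≤ C * ε ∧ |l t - le| < r ∧ |a t| ≤ C * ε ∧ a t ≤ P.zeta * N t ∧
          ∀ x ∈ Icc (0 : ℝ) 1, |G (l t * x - P.zeta * prim 0 N t) - fpe| ≤ C * ε ∧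
            |G (l t * x - P.zeta * prim 0 N t) - fpe| < r := by
  have hr := hbox.r_pos
  have hΛ : 0 < Λ := one_pos.trans_le hbox.one_le
  have hζ := P.zeta_pos
  have hlep : 0 < le := by linarith [hbox.l_pos]
  -- Crude scale for `|l x - ζ ∫ N|`: the truncated velocity and `ζ N` are both at most `n1 ζ`.
  set R : ℝ := le + r + (2 * n1 * P.zeta) * T with hR
  have hRp : 0 < R := by positivity
  -- `|G - fpe|` is at most its value at `0` plus `C1 ε` times the range `2 R`.
  set E : ℝ := C1 * (1 + 2 * R) with hE
  have hEp : 0 < E := by positivity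
  set K : ℝ := n1 * Λ with hK
  have hKp : 0 < K := by positivity
  -- The Gronwall constant for `|l - le|`, with initial error `ε` and forcing `K E ε`.
  set C2 : ℝ := (1 + E) * Real.exp (K * T) with hC2
  have hC2p : 0 < C2 := by positivity
  set C : ℝ := C2 + E + K * (C2 + E) with hC
  have hCp : 0 < C := by positivity
  refine ⟨min r (r / (2 * C)), lt_min hr (by positivity), C, hCp, ?_⟩
  intro ε l0 N G g1 hε hε0 hl0 hN hNn hN1 hG hg1 hG0
  have hεr : ε ≤ r := hε0.trans (min_le_left _ _)
  have hεC : C * ε ≤ r / 2 := by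
    have := hε0.trans (min_le_right _ _)
    rw [le_div_iff₀ (by positivity)] at this
    linarith
  have hGc : Continuous G := continuous_iff_continuousAt.mpr fun z => (hG z).continuousAt
  have hGL : ∀ x y, |G x - G y| ≤ C1 * ε * |x - y| := fun x y =>
    convex_univ.norm_image_sub_le_of_norm_hasDerivWithin_le (f := G) (f' := g1) (C := C1 * ε)
      (fun z _ => (hG z).hasDerivWithinAt) (fun z _ => hg1 z) (mem_univ y) (mem_univ x)
  set M : ℝ → ℝ := prim 0 N with hM
  have hMc : Continuous M := continuous_prim fun a b => hN.intervalIntegrable a b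
  -- Truncating both arguments to the box makes the right-hand side bounded and globally Lipschitz;
  -- it agrees with `F` while the solution stays in the box.
  set ψ : ℝ → ℝ → ℝ := fun x f => P.F (clip le r x) 1 (clip fpe r f) with hψ
  have hψL : ∀ x y f g, |ψ x f - ψ y g| ≤ Λ * (|x - y| + |f - g|) := fun x y f g =>
    (hbox.lip _ (clip_mem hr x) _ (clip_mem hr y) _ (clip_mem hr f) _ (clip_mem hr g)).trans
      (mul_le_mul_of_nonneg_left (add_le_add (abs_clip_sub_clip_le _ _ _ _)
        (abs_clip_sub_clip_le _ _ _ _)) hΛ.le)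
  have hψζ : ∀ x f, |ψ x f| ≤ P.zeta := fun x f =>
    hbox.le_zeta _ (clip_mem hr x) _ (clip_mem hr f)
  have hψe : ∀ x f, |ψ x f| ≤ Λ * (|x - le| + |f - fpe|) := fun x f => by
    have := hψL x le f fpe
    have e : ψ le fpe = 0 := by
      simp only [hψ]
      rw [clip_eq (by simpa using hr.le), clip_eq (by simpa using hr.le), hbox.eq_zero]
    rwa [e, sub_zero] at this
  have hψc : Continuous fun p : ℝ × ℝ => ψ p.1 p.2 := by
    refine (LipschitzWith.of_dist_le_mul (K := (2 * Λ).toNNReal) fun p q => ?_).continuous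
    rw [Real.coe_toNNReal _ (by positivity), Real.dist_eq, Prod.dist_eq, Real.dist_eq, Real.dist_eq]
    refine (hψL _ _ _ _).trans ?_
    have h1 := le_max_left |p.1 - q.1| |p.2 - q.2|
    have h2 := le_max_right |p.1 - q.1| |p.2 - q.2|
    nlinarith
  set V : ℝ → ℝ → ℝ := fun t x => N t * ψ x (G (x - P.zeta * M t)) with hV
  have hVc : Continuous fun p : ℝ × ℝ => V p.1 p.2 :=
    (hN.comp continuous_fst).mul (hψc.comp (continuous_snd.prodMk
      (hGc.comp (continuous_snd.sub ((hMc.comp continuous_fst).const_mul _)))))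
  have hVL : ∀ t, LipschitzWith (n1 * (Λ * (1 + C1 * ε))).toNNReal (V t) := by
    intro t
    refine LipschitzWith.of_dist_le_mul fun x y => ?_
    rw [Real.coe_toNNReal _ (by positivity), Real.dist_eq, Real.dist_eq]
    simp only [hV]
    rw [← mul_sub, abs_mul, abs_of_nonneg (hNn t), mul_assoc]
    refine mul_le_mul (hN1 t) ?_ (abs_nonneg _) hn1.le
    refine (hψL _ _ _ _).trans ?_
    rw [mul_assoc]
    refine mul_le_mul_of_nonneg_left ?_ hΛ.le
    have := hGL (x - P.zeta * M t) (y - P.zeta * M t)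
    rw [sub_sub_sub_cancel_right] at this
    linarith
  have hVA : ∀ t x, |V t x| ≤ (n1 * P.zeta).toNNReal := by
    intro t x
    rw [Real.coe_toNNReal _ (by positivity)]
    simp only [hV]
    rw [abs_mul, abs_of_nonneg (hNn t)]
    exact mul_le_mul (hN1 t) (hψζ _ _) (abs_nonneg _) hn1.le
  obtain ⟨l, a, hac, hl, hl00, ha⟩ := exists_solution_of_bounded_lipschitz hT hVc hVL hVA l0
  have hlc : Continuous l := continuous_iff_continuousAt.mpr fun t => (hl t).continuousAt
  have hMd : ∀ t, HasDerivAt M (N t) t := hasDerivAt_prim hN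
  have hM0 : M 0 = 0 := prim_zero _ _
  have hl0b : |l0| ≤ le + r := by
    rw [abs_le] at hl0 ⊢
    constructor <;> linarith [hbox.l_pos]
  -- a priori range of the characteristic coordinate
  have hMb : ∀ t ∈ Icc 0 T, 0 ≤ M t ∧ M t ≤ n1 * T := by
    intro t ht
    have h1 := intervalIntegral.integral_mono_on ht.1 (hN.intervalIntegrable 0 t)
      (intervalIntegrable_const (μ := volume) (c := n1)) (fun x _ => hN1 x)
    have h2 := intervalIntegral.integral_nonneg (μ := volume) ht.1 (fun x _ => hNn x)
    rw [intervalIntegral.integral_const, smul_eq_mul, sub_zero] at h1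
    have h3 : t * n1 ≤ n1 * T := by nlinarith [ht.2]
    simp only [hM, prim, zero_add]
    exact ⟨h2, h1.trans h3⟩
  have hlb : ∀ t ∈ Icc 0 T, |l t| ≤ le + r + n1 * P.zeta * T := by
    intro t ht
    have h1 := (convex_Icc 0 T).norm_image_sub_le_of_norm_hasDerivWithin_le (f := l) (f' := a)
      (C := n1 * P.zeta) (fun z _ => (hl z).hasDerivWithinAt) (fun z hz => by
        rw [ha z hz, Real.norm_eq_abs]
        have := hVA z (l z)
        rwa [Real.coe_toNNReal _ (by positivity)] at this)
      (left_mem_Icc.mpr hT.le) ht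
    rw [hl00, Real.norm_eq_abs, Real.norm_eq_abs, sub_zero, abs_of_nonneg ht.1] at h1
    have h2 : n1 * P.zeta * t ≤ n1 * P.zeta * T := by gcongr; exact ht.2
    have h3 := abs_sub_abs_le_abs_sub (l t) l0
    linarith
  have hzb : ∀ t ∈ Icc 0 T, ∀ x ∈ Icc (0 : ℝ) 1, |l t * x - P.zeta * M t| ≤ 2 * R := by
    intro t ht x hx
    have h1 := hlb t ht
    obtain ⟨h2, h3⟩ := hMb t ht
    have h4 : |l t * x| ≤ |l t| := by
      rw [abs_mul, abs_of_nonneg hx.1]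
      exact mul_le_of_le_one_right (abs_nonneg _) hx.2
    have h5 : |P.zeta * M t| ≤ P.zeta * (n1 * T) := by
      rw [abs_of_nonneg (by positivity)]; gcongr
    have h6 := abs_sub (l t * x) (P.zeta * M t)
    have : 0 ≤ n1 * P.zeta * T := by positivity
    have h7 : 2 * R = 2 * (le + r) + 4 * (n1 * P.zeta * T) := by rw [hR]; ring
    have h8 : P.zeta * (n1 * T) = n1 * P.zeta * T := by ring
    rw [h7]
    linarith
  have hGE : ∀ t ∈ Icc 0 T, ∀ x ∈ Icc (0 : ℝ) 1,
      |G (l t * x - P.zeta * M t) - fpe| ≤ E * ε := by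
    intro t ht x hx
    have h1 := hGL (l t * x - P.zeta * M t) 0
    rw [sub_zero] at h1
    have h2 := abs_sub_le (G (l t * x - P.zeta * M t)) (G 0) fpe
    have h3 : C1 * ε * |l t * x - P.zeta * M t| ≤ C1 * ε * (2 * R) := by
      gcongr; exact hzb t ht x hx
    have h4 : E * ε = C1 * ε * (2 * R) + C1 * ε := by rw [hE]; ring
    rw [h4]
    linarith
  have hGE1 : ∀ t ∈ Icc 0 T, |G (l t - P.zeta * M t) - fpe| ≤ E * ε := fun t ht => by
    simpa using hGE t ht 1 (by simp)
  have hab : ∀ t ∈ Icc 0 T, |a t| ≤ K * |l t - le| + K * (E * ε) := by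
    intro t ht
    rw [ha t ht]
    simp only [hV]
    rw [abs_mul, abs_of_nonneg (hNn t), ← mul_add, hK, mul_assoc]
    refine mul_le_mul (hN1 t) ((hψe _ _).trans ?_) (abs_nonneg _) hn1.le
    refine mul_le_mul_of_nonneg_left ?_ hΛ.le
    linarith [hGE1 t ht]
  have hle : ∀ t ∈ Icc 0 T, |l t - le| ≤ C2 * ε := by
    intro t ht
    have h1 := norm_le_gronwallBound_of_norm_deriv_right_le (f := fun t => l t - le) (f' := a)
      (δ := ε) (K := K) (ε := K * (E * ε)) (a := 0) (b := T)
      (hlc.sub continuous_const).continuousOn (fun t _ => ((hl t).sub_const le).hasDerivWithinAt)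
      (by rw [hl00]; exact hl0) (fun t ht => hab t (Ico_subset_Icc_self ht)) t ht
    rw [gronwallBound_of_K_ne_0 hKp.ne', sub_zero, Real.norm_eq_abs] at h1
    refine h1.trans ?_
    have h2 : Real.exp (K * t) ≤ Real.exp (K * T) :=
      Real.exp_le_exp.mpr (mul_le_mul_of_nonneg_left ht.2 hKp.le)
    have h3 : K * (E * ε) / K = E * ε := by field_simp
    simp only
    rw [h3, hC2]
    have h4 : 0 < E * ε := by positivity
    have h5 : ε * Real.exp (K * t) ≤ ε * Real.exp (K * T) := by gcongr
    have h6 : E * ε * Real.exp (K * t) ≤ E * ε * Real.exp (K * T) := by gcongr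
    linarith
  have hC2C : C2 * ε ≤ C * ε := by
    have : 0 ≤ E + K * (C2 + E) := by positivity
    gcongr; linarith
  have hEC : E * ε ≤ C * ε := by
    have : 0 ≤ C2 + K * (C2 + E) := by positivity
    gcongr; linarith
  -- As `C ε ≤ r / 2`, the truncation is inactive.
  have hlr : ∀ t ∈ Icc 0 T, |l t - le| < r := fun t ht => by linarith [hle t ht]
  refine ⟨l, a, hac, hl, hl00, fun t ht => ⟨?_, (hle t ht).trans hC2C, hlr t ht, ?_, ?_,
    fun x hx => ⟨(hGE t ht x hx).trans hEC, by linarith [hGE t ht x hx]⟩⟩⟩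
  · rw [ha t ht, P.F_eq_mul]
    simp only [hV, hψ]
    rw [clip_eq (hlr t ht).le, clip_eq (by linarith [hGE1 t ht])]
  · refine (hab t ht).trans ?_
    have h1 : K * |l t - le| ≤ K * (C2 * ε) := by gcongr; exact hle t ht
    have h2 : 0 ≤ (C2 + E) * ε := by positivity
    simp only [hC]
    linarith
  · rw [ha t ht]
    simp only [hV]
    rw [mul_comm P.zeta (N t)]
    exact mul_le_mul_of_nonneg_left ((le_abs_self _).trans (hψζ _ _)) (hNn t)

end Interface

/-! ### Continuous weak solutions of the transport equation -/

section Transport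

lemma HasWeakDeriv.congr_left {E : Type*} [NormedAddCommGroup E] [NormedSpace ℝ E] [MeasureSpace E]
    [BorelSpace E] [FiniteDimensional ℝ E] {Ω : Set E} (hΩ : IsOpen Ω) {e : E} {u u' v : E → ℝ}
    (h : HasWeakDeriv Ω e u v) (hu : ∀ x ∈ Ω, u' x = u x) : HasWeakDeriv Ω e u' v := by
  have : ProperSpace E := FiniteDimensional.proper ℝ E
  refine ⟨?_, h.2.1, fun φ hφ hc hs => ?_⟩
  · rw [locallyIntegrableOn_iff hΩ.isLocallyClosed]
    intro k hk hkc
    exact (h.1.integrableOn_compact_subset hk hkc).congr_fun (fun x hx => (hu x (hk hx)).symm)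
      hkc.measurableSet
  · rw [← h.2.2 φ hφ hc hs]
    exact setIntegral_congr_fun hΩ.measurableSet fun x hx => by simp only [hu x hx]

/-- The data of a transport problem `∂ₜf + l⁻¹ (ζ N - x l') ∂ₓf = 0` on `(0,τ) × (0,1)` whose
velocity is positive at both ends. -/
structure TransportCoeff (τ ζ : ℝ) (l a N : ℝ → ℝ) : Prop where
  zeta_pos : 0 < ζ
  cont_a : Continuous a
  cont_N : Continuous N
  deriv_l : ∀ t, HasDerivAt l (a t) t
  N_pos : ∀ t, 0 < N t
  l_pos : ∀ t ∈ Icc 0 τ, 0 < l t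
  a_le : ∀ t ∈ Icc 0 τ, a t ≤ ζ * N t

variable {τ ζ : ℝ} {l a N : ℝ → ℝ}

lemma TransportCoeff.continuous_l (h : TransportCoeff τ ζ l a N) : Continuous l :=
  continuous_iff_continuousAt.mpr fun t => (h.deriv_l t).continuousAt

lemma TransportCoeff.deriv_prim (h : TransportCoeff τ ζ l a N) (t : ℝ) :
    HasDerivAt (fun t => ζ * prim 0 N t) (ζ * N t) t :=
  (hasDerivAt_prim h.cont_N t).const_mul ζ

lemma TransportCoeff.continuous_prim (h : TransportCoeff τ ζ l a N) :
    Continuous fun t => ζ * prim 0 N t :=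
  continuous_iff_continuousAt.mpr fun t => (h.deriv_prim t).continuousAt

lemma TransportCoeff.strictMono_prim (h : TransportCoeff τ ζ l a N) :
    StrictMono fun t => ζ * prim 0 N t :=
  strictMono_of_deriv_pos fun t => by
    rw [(h.deriv_prim t).deriv]; exact mul_pos h.zeta_pos (h.N_pos t)

/-- The coordinate `z` of the end `x = 1` does not increase because `a ≤ ζ N`; thus a characteristic
inside the domain at some time was never beyond that end earlier. -/
lemma TransportCoeff.antitoneOn_sub (h : TransportCoeff τ ζ l a N) :
    AntitoneOn (fun t => l t - ζ * prim 0 N t) (Icc 0 τ) := by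
  refine antitoneOn_of_deriv_nonpos (convex_Icc 0 τ)
    (h.continuous_l.sub h.continuous_prim).continuousOn
    (fun t _ => ((h.deriv_l t).sub (h.deriv_prim t)).differentiableAt.differentiableWithinAt)
    fun t ht => ?_
  have e : deriv (fun t => l t - ζ * prim 0 N t) t = a t - ζ * N t :=
    ((h.deriv_l t).sub (h.deriv_prim t)).deriv
  rw [e]
  linarith [h.a_le t (interior_subset ht)]

/-- The weak form of the transport equation in the characteristic coordinate
`z = l x - ζ ∫₀ᵗ N`. -/
lemma TransportCoeff.integral_eq_zero (h : TransportCoeff τ ζ l a N) {f : ℝ → ℝ → ℝ}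
    {ft fx : ℝ × ℝ → ℝ} (hf : Continuous fun p : ℝ × ℝ => f p.1 p.2)
    (hft : HasWeakDeriv (rectQ τ) (1, 0) (fun p => f p.1 p.2) ft)
    (hfx : HasWeakDeriv (rectQ τ) (0, 1) (fun p => f p.1 p.2) fx)
    (hpde : ∀ᵐ p ∂(volume.restrict (rectQ τ)),
      ft p + (1 / l p.1) * (ζ * N p.1 - p.2 * a p.1) * fx p = 0)
    {t1 t2 z1 z2 : ℝ} (ht1 : 0 < t1) (ht12 : t1 ≤ t2) (ht2 : t2 < τ)
    (hz1 : 0 < z1 + ζ * prim 0 N t1) (hz2 : z2 < l t2 - ζ * prim 0 N t2)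
    {A b : ℝ → ℝ} (hA : ContDiff ℝ ∞ A) (hAs : tsupport A ⊆ Icc t1 t2)
    (hb : ContDiff ℝ ∞ b) (hbs : tsupport b ⊆ Icc z1 z2) :
    ∫ p in rectQ τ, f p.1 p.2 * (l p.1 * deriv A p.1 * b (l p.1 * p.2 - ζ * prim 0 N p.1)) = 0 := by
  have hopen : IsOpen (rectQ τ) := isOpen_Ioo.prod isOpen_Ioo
  have hlc := h.continuous_l
  have hMc := h.continuous_prim
  have hac := h.cont_a
  have hNc := h.cont_N
  have hbc := hb.continuous
  have hAc := hA.continuous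
  have hbd : Continuous (deriv b) := hb.continuous_deriv (by simp)
  have hAd : Continuous (deriv A) := hA.continuous_deriv (by simp)
  set m : ℝ → ℝ := fun t => ζ * prim 0 N t with hm
  have hmd : ∀ t, HasDerivAt m (ζ * N t) t := h.deriv_prim
  set Z : ℝ × ℝ → ℝ := fun p => l p.1 * p.2 - m p.1 with hZ
  have hZc : Continuous Z :=
    ((hlc.comp continuous_fst).mul continuous_snd).sub (hMc.comp continuous_fst)
  -- Carries all the test functions. The condition on `z1` at time `t1` persists later and that on
  -- `z2` at `t2` holds earlier, by monotonicity of the end coordinates, so `S` stays inside the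
  -- rectangle.
  set S : Set (ℝ × ℝ) := {p | p.1 ∈ Icc t1 t2 ∧ Z p ∈ Icc z1 z2} with hS
  have hSclosed : IsClosed S :=
    (isClosed_Icc.preimage continuous_fst).inter (isClosed_Icc.preimage hZc)
  have hSsub : S ⊆ Icc t1 t2 ×ˢ Ioo 0 1 := by
    rintro ⟨t, x⟩ ⟨ht, hz⟩
    simp only [hZ] at ht hz
    have htτ : t ∈ Icc 0 τ := ⟨by linarith [ht.1], by linarith [ht.2]⟩
    have hl := h.l_pos t htτ
    have e1 : m t1 ≤ m t := h.strictMono_prim.monotone ht.1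
    have e2 : l t2 - m t2 ≤ l t - m t :=
      h.antitoneOn_sub htτ ⟨by linarith, ht2.le⟩ ht.2
    refine ⟨ht, ?_, ?_⟩
    · by_contra h'
      have : l t * x ≤ 0 := mul_nonpos_of_nonneg_of_nonpos hl.le (not_lt.mp h')
      linarith [hz.1]
    · by_contra h'
      have : l t * 1 ≤ l t * x := mul_le_mul_of_nonneg_left (not_lt.mp h') hl.le
      linarith [hz.2]
  have hScomp : IsCompact S :=
    (isCompact_Icc.prod isCompact_Icc).of_isClosed_subset hSclosed
      (hSsub.trans (prod_mono_right Ioo_subset_Icc_self))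
  have hSQ : S ⊆ rectQ τ := hSsub.trans (prod_mono_left fun t ht =>
    ⟨by linarith [ht.1], by linarith [ht.2]⟩)
  have hzero : ∀ (c : ℝ × ℝ → ℝ) (p : ℝ × ℝ), p ∉ S → c p * (A p.1 * b (Z p)) = 0 := by
    intro c p hp
    by_cases h1 : p.1 ∈ Icc t1 t2
    · have h2 : b (Z p) = 0 := image_eq_zero_of_notMem_tsupport fun h' => hp ⟨h1, hbs h'⟩
      rw [h2]; ring
    · have h2 : A p.1 = 0 := image_eq_zero_of_notMem_tsupport fun h' => h1 (hAs h')
      rw [h2]; ring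
  have hts : ∀ c : ℝ × ℝ → ℝ, tsupport (fun p => c p * (A p.1 * b (Z p))) ⊆ S := fun c =>
    closure_minimal (fun p hp => by by_contra h'; exact hp (hzero c p h')) hSclosed
  have hcs : ∀ c : ℝ × ℝ → ℝ, HasCompactSupport fun p => c p * (A p.1 * b (Z p)) := fun c =>
    HasCompactSupport.of_support_subset_isCompact hScomp (subset_closure.trans (hts c))
  have hAbc : Continuous fun p : ℝ × ℝ => A p.1 * b (Z p) :=
    (hAc.comp continuous_fst).mul (hbc.comp hZc)
  -- the two test functions
  set c1 : ℝ × ℝ → ℝ := fun p => l p.1 with hc1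
  set c2 : ℝ × ℝ → ℝ := fun p => ζ * N p.1 - p.2 * a p.1 with hc2
  have hc1c : Continuous c1 := hlc.comp continuous_fst
  have hc2c : Continuous c2 := ((hNc.comp continuous_fst).const_mul ζ).sub
    (continuous_snd.mul (hac.comp continuous_fst))
  set χ' : ℝ × ℝ → ℝ := fun p => a p.1 * (A p.1 * b (Z p))
    + l p.1 * (deriv A p.1 * b (Z p) + A p.1 * (deriv b (Z p) * (a p.1 * p.2 - ζ * N p.1))) with hχ'
  set κ' : ℝ × ℝ → ℝ := fun p => (-a p.1) * (A p.1 * b (Z p))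
    + c2 p * (A p.1 * (deriv b (Z p) * l p.1)) with hκ'
  have hχ'c : Continuous χ' := by
    simp only [hχ']
    refine ((hac.comp continuous_fst).mul hAbc).add (hc1c.mul
      (((hAd.comp continuous_fst).mul (hbc.comp hZc)).add ((hAc.comp continuous_fst).mul
        ((hbd.comp hZc).mul (((hac.comp continuous_fst).mul continuous_snd).sub
          ((hNc.comp continuous_fst).const_mul ζ))))))
  have hκ'c : Continuous κ' := by
    simp only [hκ']
    exact ((hac.comp continuous_fst).neg.mul hAbc).add (hc2c.mul ((hAc.comp continuous_fst).mul
      ((hbd.comp hZc).mul hc1c)))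
  have hχd : ∀ p, HasLineDerivAt ℝ (fun p => c1 p * (A p.1 * b (Z p))) (χ' p) p ((1, 0) : ℝ × ℝ) := by
    rintro ⟨t, x⟩
    have hZd : HasDerivAt (fun s => l s * x - m s) (a t * x - ζ * N t) t :=
      ((h.deriv_l t).mul_const x).sub (hmd t)
    have hbd' : HasDerivAt (fun s => b (l s * x - m s))
        (deriv b (l t * x - m t) * (a t * x - ζ * N t)) t :=
      ((hb.differentiable (by simp)) _).hasDerivAt.comp t hZd
    have hAd' : HasDerivAt A (deriv A t) t := ((hA.differentiable (by simp)) t).hasDerivAt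
    have h1 := (h.deriv_l t).mul (hAd'.mul hbd')
    have h2 := HasDerivAt.comp_const_add t 0 (by simpa using h1)
    unfold HasLineDerivAt
    convert! h2 using 1
    funext s
    simp [hc1, hZ]
  have hκd : ∀ p, HasLineDerivAt ℝ (fun p => c2 p * (A p.1 * b (Z p))) (κ' p) p ((0, 1) : ℝ × ℝ) := by
    rintro ⟨t, x⟩
    have hZd : HasDerivAt (fun y => l t * y - m t) (l t) x := by
      simpa using ((hasDerivAt_id x).const_mul (l t)).sub_const (m t)
    have hbd' : HasDerivAt (fun y => b (l t * y - m t)) (deriv b (l t * x - m t) * l t) x :=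
      ((hb.differentiable (by simp)) _).hasDerivAt.comp x hZd
    have hcd : HasDerivAt (fun y => ζ * N t - y * a t) (-a t) x := by
      simpa using ((hasDerivAt_id x).mul_const (a t)).const_sub (ζ * N t)
    have h1 := hcd.mul (hbd'.const_mul (A t))
    have h2 := HasDerivAt.comp_const_add x 0 (by simpa using h1)
    unfold HasLineDerivAt
    convert! h2 using 1
    · funext s
      simp [hc2, hZ]
    · simp only [hκ', hc2, hZ]; ring
  have e1 : ∫ p in rectQ τ, f p.1 p.2 * χ' p
      = -∫ p in rectQ τ, ft p * (c1 p * (A p.1 * b (Z p))) :=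
        hft.integral_mul_of_hasLineDerivAt hopen (hc1c.mul hAbc) hχ'c (hcs c1)
    ((hts c1).trans hSQ) hχd
  have e2 : ∫ p in rectQ τ, f p.1 p.2 * κ' p
      = -∫ p in rectQ τ, fx p * (c2 p * (A p.1 * b (Z p))) :=
        hfx.integral_mul_of_hasLineDerivAt hopen (hc2c.mul hAbc) hκ'c (hcs c2)
    ((hts c2).trans hSQ) hκd
  have i1 : IntegrableOn (fun p => ft p * (c1 p * (A p.1 * b (Z p)))) (rectQ τ) volume :=
    hft.2.1.integrableOn_mul_of_hasCompactSupport (hc1c.mul hAbc) (hcs c1)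
    ((hts c1).trans hSQ)
  have i2 : IntegrableOn (fun p => fx p * (c2 p * (A p.1 * b (Z p)))) (rectQ τ) volume :=
    hfx.2.1.integrableOn_mul_of_hasCompactSupport (hc2c.mul hAbc) (hcs c2)
    ((hts c2).trans hSQ)
  have hbounded : ∀ g : ℝ × ℝ → ℝ, Continuous g → IntegrableOn g (rectQ τ) volume := fun g hg =>
    (hg.continuousOn.integrableOn_compact (isCompact_Icc.prod isCompact_Icc)).mono_set
      (prod_mono Ioo_subset_Icc_self Ioo_subset_Icc_self)
  have e3 : ∫ p in rectQ τ, (ft p * (c1 p * (A p.1 * b (Z p))) + fx p * (c2 p * (A p.1 * b (Z p))))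
      = 0 := by
    refine integral_eq_zero_of_ae ?_
    filter_upwards [hpde, ae_restrict_mem hopen.measurableSet] with p hp hpQ
    have hl : l p.1 ≠ 0 := (h.l_pos p.1 (Ioo_subset_Icc_self hpQ.1)).ne'
    have : ft p = -((1 / l p.1) * (ζ * N p.1 - p.2 * a p.1) * fx p) := by linarith
    simp only [hc1, hc2, Pi.zero_apply, this]
    field_simp
    ring
  rw [integral_add i1 i2] at e3
  have e4 : ∫ p in rectQ τ, (f p.1 p.2 * χ' p + f p.1 p.2 * κ' p) = 0 := by
    have i3 : IntegrableOn (fun p => f p.1 p.2 * χ' p) (rectQ τ) volume :=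
      hbounded _ (hf.mul hχ'c)
    have i4 : IntegrableOn (fun p => f p.1 p.2 * κ' p) (rectQ τ) volume :=
      hbounded _ (hf.mul hκ'c)
    rw [integral_add i3 i4, e1, e2]
    linarith
  refine Eq.trans (integral_congr_ae (Eventually.of_forall fun p => ?_)) e4
  simp only [hχ', hκ', hc2, hZ, hm]
  ring

/-- Weak solutions of the transport equation are constant along characteristics. -/
lemma TransportCoeff.eq_along_characteristic (h : TransportCoeff τ ζ l a N) {f : ℝ → ℝ → ℝ}
    {ft fx : ℝ × ℝ → ℝ} (hf : Continuous fun p : ℝ × ℝ => f p.1 p.2)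
    (hft : HasWeakDeriv (rectQ τ) (1, 0) (fun p => f p.1 p.2) ft)
    (hfx : HasWeakDeriv (rectQ τ) (0, 1) (fun p => f p.1 p.2) fx)
    (hpde : ∀ᵐ p ∂(volume.restrict (rectQ τ)),
      ft p + (1 / l p.1) * (ζ * N p.1 - p.2 * a p.1) * fx p = 0)
    {s t z : ℝ} (hs : 0 < s) (hst : s < t) (ht : t < τ)
    (hz1 : 0 < z + ζ * prim 0 N s) (hz2 : z < l t - ζ * prim 0 N t) :
    f s ((z + ζ * prim 0 N s) / l s) = f t ((z + ζ * prim 0 N t) / l t) := by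
  have hτ : 0 < τ := hs.trans (hst.trans ht)
  have hlc := h.continuous_l
  have hMc := h.continuous_prim
  set m : ℝ → ℝ := fun t => ζ * prim 0 N t with hm
  -- room around the given characteristic
  obtain ⟨z1, hz1m, hz1z⟩ := exists_between (show -(m s) < z by linarith)
  obtain ⟨z2, hzz2, hz2m⟩ := exists_between hz2
  obtain ⟨t1, ht1, ht1s, ht1z⟩ : ∃ t1, 0 < t1 ∧ t1 < s ∧ 0 < z1 + m t1 := by
    have h1 : ∀ᶠ r in 𝓝[<] s, 0 < z1 + m r :=
      ((continuous_const.add hMc).continuousAt.eventually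
        (lt_mem_nhds (show 0 < z1 + m s by linarith))).filter_mono nhdsWithin_le_nhds
    have h2 : ∀ᶠ r in 𝓝[<] s, r ∈ Ioo 0 s := Ioo_mem_nhdsLT hs
    obtain ⟨r, hr1, hr2⟩ := (h1.and h2).exists
    exact ⟨r, hr2.1, hr2.2, hr1⟩
  obtain ⟨t2, ht2, ht2t, ht2z⟩ : ∃ t2, t2 < τ ∧ t < t2 ∧ z2 < l t2 - m t2 := by
    have h1 : ∀ᶠ r in 𝓝[>] t, z2 < l r - m r :=
      ((hlc.sub hMc).continuousAt.eventually (lt_mem_nhds hz2m)).filter_mono nhdsWithin_le_nhds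
    have h2 : ∀ᶠ r in 𝓝[>] t, r ∈ Ioo t τ := Ioo_mem_nhdsGT ht
    obtain ⟨r, hr1, hr2⟩ := (h1.and h2).exists
    exact ⟨r, hr2.2, hr2.1, hr1⟩
  -- the solution in characteristic coordinates
  set l' : ℝ → ℝ := fun r => l (projIcc 0 τ hτ.le r) with hl'
  have hl'c : Continuous l' := hlc.comp (continuous_subtype_val.comp continuous_projIcc)
  have hl'p : ∀ r, 0 < l' r := fun r => h.l_pos _ (projIcc 0 τ hτ.le r).2
  have hl'e : ∀ r ∈ Icc 0 τ, l' r = l r := fun r hr => by simp only [hl', projIcc_of_mem _ hr]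
  set q : ℝ → ℝ → ℝ := fun r y => f r ((y + m r) / l' r) with hq
  have hqc : Continuous fun p : ℝ × ℝ => q p.1 p.2 :=
    hf.comp (continuous_fst.prodMk ((continuous_snd.add (hMc.comp continuous_fst)).div
      (hl'c.comp continuous_fst) fun p => (hl'p p.1).ne'))
  have hQ : ∀ b : ℝ → ℝ, ContDiff ℝ ∞ b → tsupport b ⊆ Icc z1 z2 →
      ∫ y in Icc z1 z2, q s y * b y = ∫ y in Icc z1 z2, q t y * b y := by
    intro b hb hbs
    -- A moment of the solution in the coordinate `z`. By Fubini and the substitution `y = l x - m`,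
    -- the weak equation says that its time derivative vanishes.
    set Qb : ℝ → ℝ := fun r => ∫ y in Icc z1 z2, q r y * b y with hQb
    have hQbc : Continuous Qb :=
      continuous_parametric_integral_of_continuous (f := fun r y => q r y * b y)
        (hqc.mul (hb.continuous.comp continuous_snd)) isCompact_Icc
    have hb0 : ∀ y, y ∉ Icc z1 z2 → b y = 0 := fun y hy =>
      image_eq_zero_of_notMem_tsupport fun h' => hy (hbs h')
    have hw : HasWeakDeriv (Ioo t1 t2) 1 Qb fun _ => 0 := by
      refine ⟨hQbc.locallyIntegrable.locallyIntegrableOn _,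
        continuous_const.locallyIntegrable.locallyIntegrableOn _, fun A hA hAc hAs => ?_⟩
      have hA0 : ∀ r, r ∉ Ioo t1 t2 → deriv A r = 0 := fun r hr => by
        have : r ∉ tsupport (deriv A) := fun h' => hr (hAs (tsupport_deriv_subset h'))
        exact image_eq_zero_of_notMem_tsupport this
      have key := h.integral_eq_zero hf hft hfx hpde ht1 (ht1s.trans (hst.trans ht2t)).le ht2
        ht1z ht2z hA (hAs.trans Ioo_subset_Icc_self) hb hbs
      have hint : IntegrableOn (fun p : ℝ × ℝ => f p.1 p.2 * (l p.1 * deriv A p.1 *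
          b (l p.1 * p.2 - ζ * prim 0 N p.1))) (Ioo 0 τ ×ˢ Ioo 0 1) (volume.prod volume) := by
        have hAd : Continuous (deriv A) := hA.continuous_deriv (by simp)
        have hc : Continuous fun p : ℝ × ℝ => f p.1 p.2 * (l p.1 * deriv A p.1 *
            b (l p.1 * p.2 - ζ * prim 0 N p.1)) :=
          hf.mul (((hlc.comp continuous_fst).mul (hAd.comp continuous_fst)).mul
            (hb.continuous.comp (((hlc.comp continuous_fst).mul continuous_snd).sub
              (hMc.comp continuous_fst))))
        exact (hc.continuousOn.integrableOn_compact (isCompact_Icc.prod isCompact_Icc)).mono_set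
          (prod_mono Ioo_subset_Icc_self Ioo_subset_Icc_self)
      rw [rectQ, Measure.volume_eq_prod, setIntegral_prod _ hint] at key
      simp only [fderiv_apply_one_eq_deriv, zero_mul, integral_zero, neg_zero]
      have hsub : Ioo t1 t2 ⊆ Ioo 0 τ := Ioo_subset_Ioo ht1.le ht2.le
      have e1 : ∫ r in Ioo t1 t2, Qb r * deriv A r = ∫ r in Ioo 0 τ, Qb r * deriv A r := by
        refine (setIntegral_eq_of_subset_of_forall_sdiff_eq_zero measurableSet_Ioo hsub
          fun r hr => ?_).symm
        rw [hA0 r hr.2, mul_zero]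
      rw [e1]
      refine Eq.trans (setIntegral_congr_fun measurableSet_Ioo fun r hr => ?_) key
      simp only
      by_cases hrt : r ∈ Ioo t1 t2
      · have hrτ : r ∈ Icc 0 τ := Ioo_subset_Icc_self hr
        have hlr := h.l_pos r hrτ
        have g1 : m t1 ≤ m r := h.strictMono_prim.monotone hrt.1.le
        have g2 : l t2 - m t2 ≤ l r - m r :=
          h.antitoneOn_sub hrτ ⟨by linarith [hr.1, hrt.2], ht2.le⟩ hrt.2.le
        have e2 : ∫ x in Ioo 0 1, f r x * (l r * deriv A r * b (l r * x - m r))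
            = ∫ x, f r x * (l r * deriv A r * b (l r * x - m r)) := by
          refine setIntegral_eq_integral_of_forall_compl_eq_zero fun x hx => ?_
          rw [hb0 (l r * x - m r), mul_zero, mul_zero]
          rintro ⟨k1, k2⟩
          refine hx ⟨?_, ?_⟩
          · by_contra h'
            have : l r * x ≤ 0 := mul_nonpos_of_nonneg_of_nonpos hlr.le (not_lt.mp h')
            linarith
          · by_contra h'
            have : l r * 1 ≤ l r * x := mul_le_mul_of_nonneg_left (not_lt.mp h') hlr.le
            linarith
        have e3 : ∀ x, f r x * (l r * deriv A r * b (l r * x - m r))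
            = (fun y => (fun z => l r * deriv A r * (q r (z - m r) * b (z - m r))) y) (l r * x) := by
          intro x
          have : (l r * x - m r + m r) / l' r = x := by
            rw [hl'e r hrτ]; field_simp; ring
          simp only [hq, this]; ring
        have e4 : Qb r = ∫ y, q r y * b y :=
          setIntegral_eq_integral_of_forall_compl_eq_zero fun y hy => by rw [hb0 y hy, mul_zero]
        change Qb r * deriv A r = ∫ x in Ioo 0 1, f r x * (l r * deriv A r * b (l r * x - m r))
        rw [e2]
        simp_rw [e3]
        rw [Measure.integral_comp_mul_left
          (fun z => l r * deriv A r * (q r (z - m r) * b (z - m r))) (l r), integral_const_mul,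
          integral_sub_right_eq_self (fun y => q r y * b y) (m r), e4,
          abs_of_pos (inv_pos.mpr hlr), smul_eq_mul]
        field_simp
      · rw [hA0 r hrt]; simp
    have hmem1 : s ∈ Ioo t1 t2 := ⟨ht1s, hst.trans ht2t⟩
    have hmem2 : t ∈ Ioo t1 t2 := ⟨ht1s.trans hst, ht2t⟩
    have := hw.sub_eq_integral hQbc.continuousOn hmem1 hmem2
    rw [intervalIntegral.integral_zero] at this
    exact (sub_eq_zero.mp this).symm
  -- equality almost everywhere, hence everywhere
  have hz12 : z1 < z2 := hz1z.trans hzz2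
  have hqs : Continuous (q s) := hqc.comp (continuous_const.prodMk continuous_id)
  have hqt : Continuous (q t) := hqc.comp (continuous_const.prodMk continuous_id)
  have hae := isOpen_Ioo.ae_eq_zero_of_integral_contDiff_smul_eq_zero (μ := (volume : Measure ℝ))
    (U := Ioo z1 z2) (f := fun y => q s y - q t y)
    ((hqs.sub hqt).locallyIntegrable.locallyIntegrableOn _) (fun b hb hbc hbs => by
      have h1 := hQ b hb (hbs.trans Ioo_subset_Icc_self)
      have hint : ∀ g : ℝ → ℝ, Continuous g → IntegrableOn (fun y => g y * b y) (Icc z1 z2) volume :=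
        fun g hg => (hg.mul hb.continuous).continuousOn.integrableOn_compact isCompact_Icc
      have h2 : ∫ y in Icc z1 z2, (q s y * b y - q t y * b y) = 0 := by
        rw [integral_sub (hint _ hqs) (hint _ hqt), h1, sub_self]
      rw [← h2, setIntegral_eq_integral_of_forall_compl_eq_zero]
      · refine integral_congr_ae (Eventually.of_forall fun y => ?_)
        simp only [smul_eq_mul]; ring
      · intro y hy
        have : b y = 0 := image_eq_zero_of_notMem_tsupport fun h' =>
          hy (Ioo_subset_Icc_self (hbs h'))
        rw [this]; ring)
  have hE : EqOn (q s) (q t) (Icc z1 z2) := by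
    refine Measure.eqOn_Icc_of_ae_eq volume hz12.ne ?_ hqs.continuousOn hqt.continuousOn
    rw [Filter.EventuallyEq, ← restrict_Ioo_eq_restrict_Icc, ae_restrict_iff' measurableSet_Ioo]
    filter_upwards [hae] with y hy hyI
    exact sub_eq_zero.mp (hy hyI)
  have := hE (x := z) ⟨hz1z.le, hzz2.le⟩
  simp only [hq] at this
  rwa [hl'e s ⟨hs.le, (hst.trans ht).le⟩, hl'e t ⟨(hs.trans hst).le, ht.le⟩] at this

/-- A continuous weak solution of the transport equation is the transported profile of its
initial and boundary data. -/
theorem TransportCoeff.eq_profile (h : TransportCoeff τ ζ l a N) (hτ : 0 < τ) {f : ℝ → ℝ → ℝ}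
    {G : ℝ → ℝ} (hG : Continuous G)
    {ft fx : ℝ × ℝ → ℝ} (hf : ContinuousOn (fun p : ℝ × ℝ => f p.1 p.2) (Icc 0 τ ×ˢ Icc 0 1))
    (hft : HasWeakDeriv (rectQ τ) (1, 0) (fun p => f p.1 p.2) ft)
    (hfx : HasWeakDeriv (rectQ τ) (0, 1) (fun p => f p.1 p.2) fx)
    (hpde : ∀ᵐ p ∂(volume.restrict (rectQ τ)),
      ft p + (1 / l p.1) * (ζ * N p.1 - p.2 * a p.1) * fx p = 0)
    (hG0 : ∀ x ∈ Icc (0 : ℝ) 1, f 0 x = G (l 0 * x))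
    (hGb : ∀ t ∈ Icc 0 τ, f t 0 = G (-(ζ * prim 0 N t))) :
    ∀ t ∈ Icc 0 τ, ∀ x ∈ Icc (0 : ℝ) 1, f t x = G (l t * x - ζ * prim 0 N t) := by
  have hlc := h.continuous_l
  have hMc := h.continuous_prim
  have hmono := h.strictMono_prim
  have hanti := h.antitoneOn_sub
  set m : ℝ → ℝ := fun t => ζ * prim 0 N t with hm
  have hm0 : m 0 = 0 := by simp [hm, prim_zero]
  -- continuous extension of `f`
  set f' : ℝ → ℝ → ℝ := fun t x => f (projIcc 0 τ hτ.le t) (projIcc 0 1 zero_le_one x) with hf'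
  have hf'c : Continuous fun p : ℝ × ℝ => f' p.1 p.2 := by
    refine hf.comp_continuous (f := fun p : ℝ × ℝ =>
      ((projIcc 0 τ hτ.le p.1 : ℝ), (projIcc 0 1 zero_le_one p.2 : ℝ))) ?_ ?_
    · exact (continuous_subtype_val.comp (continuous_projIcc.comp continuous_fst)).prodMk
        (continuous_subtype_val.comp (continuous_projIcc.comp continuous_snd))
    · exact fun p => ⟨(projIcc 0 τ hτ.le p.1).2, (projIcc 0 1 zero_le_one p.2).2⟩
  have hf'e : ∀ t ∈ Icc 0 τ, ∀ x ∈ Icc (0 : ℝ) 1, f' t x = f t x := fun t ht x hx => by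
    simp only [hf', projIcc_of_mem _ ht, projIcc_of_mem _ hx]
  have hopen : IsOpen (rectQ τ) := isOpen_Ioo.prod isOpen_Ioo
  have hQe : ∀ p ∈ rectQ τ, f' p.1 p.2 = f p.1 p.2 := fun p hp =>
    hf'e _ (Ioo_subset_Icc_self hp.1) _ (Ioo_subset_Icc_self hp.2)
  have hft' := hft.congr_left hopen hQe
  have hfx' := hfx.congr_left hopen hQe
  have hint : ∀ t ∈ Ioo 0 τ, ∀ x ∈ Ioo (0 : ℝ) 1, f' t x = G (l t * x - m t) := by
    intro t ht x hx
    have htI := Ioo_subset_Icc_self ht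
    have hlt := h.l_pos t htI
    set z := l t * x - m t with hz
    have hzlt : z < l t - m t := by
      have : l t * x < l t * 1 := mul_lt_mul_of_pos_left hx.2 hlt
      linarith
    have hztop : 0 < z + m t := by
      have : 0 < l t * x := mul_pos hlt hx.1
      linarith
    -- the foot of the characteristic
    obtain ⟨t1, ht1, ht1t, hfoot, hval⟩ : ∃ t1, 0 ≤ t1 ∧ t1 < t ∧ 0 ≤ z + m t1 ∧
        f' t1 ((z + m t1) / l t1) = G z := by
      rcases lt_or_ge z 0 with hzn | hzp
      · obtain ⟨t1, ht1, hmt1⟩ := intermediate_value_Ioo ht.1.le hMc.continuousOn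
          (show -z ∈ Ioo (m 0) (m t) from ⟨by linarith, by linarith⟩)
        have hmt1' : m t1 = -z := hmt1
        have ht1I : t1 ∈ Icc 0 τ := ⟨ht1.1.le, (ht1.2.trans ht.2).le⟩
        refine ⟨t1, ht1.1.le, ht1.2, by linarith, ?_⟩
        rw [hmt1', add_neg_cancel, zero_div, hf'e t1 ht1I 0 (by simp), hGb t1 ht1I]
        change G (-(m t1)) = _
        rw [hmt1', neg_neg]
      · have h0I : (0 : ℝ) ∈ Icc 0 τ := ⟨le_rfl, hτ.le⟩
        have hl0 := h.l_pos 0 h0I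
        have h1 : l t - m t ≤ l 0 - m 0 := hanti h0I htI ht.1.le
        have hmem : z / l 0 ∈ Icc (0 : ℝ) 1 :=
          ⟨div_nonneg hzp hl0.le, (div_le_one hl0).mpr (by linarith)⟩
        refine ⟨0, le_rfl, ht.1, by linarith, ?_⟩
        rw [hm0, add_zero, hf'e 0 h0I _ hmem, hG0 _ hmem]
        congr 1; field_simp
    have ht1τ : t1 < τ := ht1t.trans ht.2
    have hcX : ContinuousOn (fun r => f' r ((z + m r) / l r)) (Icc t1 t) := by
      refine hf'c.comp_continuousOn (f := fun r => (r, (z + m r) / l r))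
        (continuousOn_id.prodMk (((continuous_const.add hMc).continuousOn).div hlc.continuousOn
        fun r hr => (h.l_pos r ⟨ht1.trans hr.1, hr.2.trans ht.2.le⟩).ne'))
    -- Constancy is known only at interior times and points; continuity carries it down to the foot,
    -- which may lie on the boundary.
    have hconst : EqOn (fun r => f' r ((z + m r) / l r)) (fun _ => f' t x) (Icc t1 t) := by
      refine EqOn.of_subset_closure (s := Ioo t1 t) (fun r hr => ?_) hcX continuousOn_const
        Ioo_subset_Icc_self (by rw [closure_Ioo ht1t.ne])
      have h1 : m t1 < m r := hmono hr.1
      have := h.eq_along_characteristic hf'c hft' hfx' hpde (s := r) (t := t) (z := z)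
        (ht1.trans_lt hr.1) hr.2 ht.2 (by change 0 < z + m r; linarith) hzlt
      change f' r ((z + m r) / l r) = f' t ((z + m t) / l t) at this
      rw [this]
      congr 1
      rw [hz]; field_simp; ring
    have h2 := hconst (left_mem_Icc.mpr ht1t.le)
    simp only at h2
    rw [← h2, hval]
  have hE : EqOn (fun p : ℝ × ℝ => f' p.1 p.2) (fun p => G (l p.1 * p.2 - m p.1))
      (Icc 0 τ ×ˢ Icc 0 1) := by
    refine EqOn.of_subset_closure (s := Ioo 0 τ ×ˢ Ioo 0 1)
      (fun p hp => hint p.1 hp.1 p.2 hp.2) hf'c.continuousOn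
      (hG.comp (((hlc.comp continuous_fst).mul continuous_snd).sub
        (hMc.comp continuous_fst))).continuousOn
      (prod_mono Ioo_subset_Icc_self Ioo_subset_Icc_self) ?_
    rw [closure_prod_eq, closure_Ioo hτ.ne, closure_Ioo zero_ne_one]
  intro t ht x hx
  rw [← hf'e t ht x hx]
  exact hE (x := (t, x)) ⟨ht, hx⟩

end Transport

/-! ### Uniqueness of solutions -/

section Uniqueness

lemma HasWeakDeriv.mono {E : Type*} [NormedAddCommGroup E] [NormedSpace ℝ E] [MeasureSpace E]
    [BorelSpace E] {Ω Ω' : Set E} (hΩ : IsOpen Ω) {e : E} {u v : E → ℝ}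
    (h : HasWeakDeriv Ω e u v) (hsub : Ω' ⊆ Ω) : HasWeakDeriv Ω' e u v := by
  refine ⟨h.1.mono_set hsub, h.2.1.mono_set hsub, fun φ hφ hc hs => ?_⟩
  have key := h.2.2 φ hφ hc (hs.trans hsub)
  have h0 : ∀ x ∈ Ω \ Ω', φ x = 0 := fun x hx =>
    image_eq_zero_of_notMem_tsupport fun h' => hx.2 (hs h')
  have h0' : ∀ x ∈ Ω \ Ω', fderiv ℝ φ x e = 0 := fun x hx => by
    have : x ∉ tsupport (fderiv ℝ φ) := fun h' => hx.2 (hs (tsupport_fderiv_subset ℝ h'))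
    rw [image_eq_zero_of_notMem_tsupport this]; rfl
  rw [setIntegral_eq_of_subset_of_forall_sdiff_eq_zero hΩ.measurableSet hsub
    (fun x hx => by rw [h0' x hx, mul_zero]),
    setIntegral_eq_of_subset_of_forall_sdiff_eq_zero hΩ.measurableSet hsub
    (fun x hx => by rw [h0 x hx, mul_zero])] at key
  exact key

lemma Extruder.IsBox.continuousOn {P : Extruder} {le fpe r Λ : ℝ} (h : P.IsBox le fpe r Λ) :
    ContinuousOn (fun p : ℝ × ℝ => P.F p.1 1 p.2)
      (Icc (le - r) (le + r) ×ˢ Icc (fpe - r) (fpe + r)) := by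
  have hΛ : 0 < Λ := one_pos.trans_le h.one_le
  refine (LipschitzOnWith.of_dist_le_mul (K := (2 * Λ).toNNReal) fun p hp q hq => ?_).continuousOn
  rw [Real.coe_toNNReal _ (by positivity), Real.dist_eq, Prod.dist_eq, Real.dist_eq, Real.dist_eq]
  refine (h.lip _ hp.1 _ hq.1 _ hp.2 _ hq.2).trans ?_
  have h1 := le_max_left |p.1 - q.1| |p.2 - q.2|
  have h2 := le_max_right |p.1 - q.1| |p.2 - q.2|
  nlinarith

lemma mem_Icc_of_abs_sub_le {c r x : ℝ} (h : |x - c| ≤ r) : x ∈ Icc (c - r) (c + r) := by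
  rw [abs_le] at h; exact ⟨by linarith, by linarith⟩

/-- A solution of the extruder model in travelling profile form, staying inside the box. -/
structure Extruder.IsProfileSolution (P : Extruder) (T le fpe r : ℝ) (N l a G : ℝ → ℝ) : Prop where
  cont_a : Continuous a
  deriv_l : ∀ t, HasDerivAt l (a t) t
  eq_F : ∀ t ∈ Icc 0 T, a t = P.F (l t) (N t) (G (l t - P.zeta * prim 0 N t))
  l_lt : ∀ t ∈ Icc 0 T, |l t - le| < r
  G_lt : ∀ t ∈ Icc 0 T, |G (l t - P.zeta * prim 0 N t) - fpe| < r

variable {P : Extruder} {T le fpe r Λ n1 D l0 : ℝ} {f0 Fi N N' l a G l' : ℝ → ℝ}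
  {f' : ℝ → ℝ → ℝ}

/-- Inside the box the interface velocity is continuous and at most `ζ N`, so the transport theory
applies along the competitor's own interface and yields the same profile `G`. Both interfaces then
solve one Lipschitz equation with the same initial value. -/
theorem Extruder.IsProfileSolution.eq_of_isSolution_of_mem_box
    (hs : P.IsProfileSolution T le fpe r N l a G) (hbox : P.IsBox le fpe r Λ)
    (hN : Continuous N) (hNp : ∀ t, 0 < N t) (hN1 : ∀ t, N t ≤ n1)
    (hNN' : ∀ t ∈ Icc 0 T, N' t = N t) (hGL : ∀ x y, |G x - G y| ≤ D * |x - y|) (hD : 0 ≤ D)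
    (hl0 : l 0 = l0) (hG0 : ∀ x ∈ Icc (0 : ℝ) 1, f0 x = G (l0 * x))
    (hGb : ∀ t ∈ Icc 0 T, P.inflow Fi N' t = G (-(P.zeta * prim 0 N t)))
    (hsol : P.IsSolution T l0 f0 Fi N' l' f') {τ : ℝ} (hτ : 0 < τ) (hτT : τ ≤ T)
    (hl' : ∀ t ∈ Icc 0 τ, |l' t - le| ≤ r) (hf' : ∀ t ∈ Icc 0 τ, |f' t 1 - fpe| ≤ r) :
    ∀ t ∈ Icc 0 τ, l' t = l t ∧
      ∀ x ∈ Icc (0 : ℝ) 1, f' t x = G (l t * x - P.zeta * prim 0 N t) := by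
  have hsub : Icc 0 τ ⊆ Icc 0 T := Icc_subset_Icc_right hτT
  have hl'c : ContinuousOn l' (Icc 0 τ) := hsol.l_mem.1.mono hsub
  have hf'c : ContinuousOn (fun p : ℝ × ℝ => f' p.1 p.2) (Icc 0 τ ×ˢ Icc 0 1) :=
    hsol.f_cont.mono (prod_mono_left hsub)
  have hf'1 : ContinuousOn (fun t => f' t 1) (Icc 0 τ) :=
    hf'c.comp (f := fun t => (t, (1 : ℝ))) (continuousOn_id.prodMk continuousOn_const)
      fun t ht => ⟨ht, by simp⟩
  have hAc : ContinuousOn (fun t => P.F (l' t) (N' t) (f' t 1)) (Icc 0 τ) := by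
    have h1 : ContinuousOn (fun t => N t * P.F (l' t) 1 (f' t 1)) (Icc 0 τ) :=
      hN.continuousOn.mul (hbox.continuousOn.comp (f := fun t => (l' t, f' t 1))
        (hl'c.prodMk hf'1) fun t ht =>
          ⟨mem_Icc_of_abs_sub_le (hl' t ht), mem_Icc_of_abs_sub_le (hf' t ht)⟩)
    refine h1.congr fun t ht => ?_
    simp only
    rw [P.F_eq_mul, hNN' t (hsub ht)]
  -- The competitor's velocity, continuously extended; its primitive `L` is a `C¹` version of `l'`
  -- to which `TransportCoeff` applies.
  set a' : ℝ → ℝ := IccExtend hτ.le ((Icc 0 τ).domRestrict fun t => P.F (l' t) (N' t) (f' t 1))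
    with ha'
  have ha'c : Continuous a' := (continuousOn_iff_continuous_domRestrict.mp hAc).Icc_extend'
  have ha'e : ∀ t ∈ Icc 0 τ, a' t = P.F (l' t) (N' t) (f' t 1) := fun t ht => by
    rw [ha', IccExtend_of_mem _ _ ht]; rfl
  set L : ℝ → ℝ := prim l0 a' with hL
  have hLd : ∀ t, HasDerivAt L (a' t) t := hasDerivAt_prim ha'c
  have hLe : ∀ t ∈ Icc 0 τ, l' t = L t := by
    intro t ht
    have hw := hsol.ode.mono isOpen_Ioo (Ioo_subset_Ioo_right hτT)
    rw [hw.eq_add_integral hτ hl'c (by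
      rw [← uIcc_of_le hτ.le] at hAc; exact hAc.intervalIntegrable) t ht, hsol.l_init]
    simp only [hL, prim]
    congr 1
    refine intervalIntegral.integral_congr fun s hs => ?_
    rw [uIcc_of_le ht.1] at hs
    exact (ha'e s ⟨hs.1, hs.2.trans ht.2⟩).symm
  have hcoef : TransportCoeff τ P.zeta L a' N := by
    refine ⟨P.zeta_pos, ha'c, hN, hLd, hNp, fun t ht => ?_, fun t ht => ?_⟩
    · rw [← hLe t ht]
      linarith [(mem_Icc_of_abs_sub_le (hl' t ht)).1, hbox.l_pos]
    · rw [ha'e t ht, P.F_eq_mul, hNN' t (hsub ht), mul_comm P.zeta (N t)]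
      exact mul_le_mul_of_nonneg_left ((le_abs_self _).trans (hbox.le_zeta _
        (mem_Icc_of_abs_sub_le (hl' t ht)) _ (mem_Icc_of_abs_sub_le (hf' t ht)))) (hNp t).le
  have hGc : Continuous G := by
    refine (LipschitzWith.of_dist_le_mul (K := D.toNNReal) fun x y => ?_).continuous
    rw [Real.coe_toNNReal _ hD, Real.dist_eq, Real.dist_eq]
    exact hGL x y
  have hopen : IsOpen (rectQ T) := isOpen_Ioo.prod isOpen_Ioo
  have hQsub : rectQ τ ⊆ rectQ T := prod_mono_left (Ioo_subset_Ioo_right hτT)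
  obtain ⟨ft, fx, hft, hfx, hpde⟩ := hsol.pde
  have hpde' : ∀ᵐ p ∂(volume.restrict (rectQ τ)),
      ft p + (1 / L p.1) * (P.zeta * N p.1 - p.2 * a' p.1) * fx p = 0 := by
    have h1 := ae_mono (Measure.restrict_mono hQsub le_rfl) hpde
    filter_upwards [h1, ae_restrict_mem (isOpen_Ioo.prod isOpen_Ioo).measurableSet] with p hp hpQ
    have ht : p.1 ∈ Icc 0 τ := Ioo_subset_Icc_self hpQ.1
    rw [Extruder.alpha, hNN' _ (hsub ht), hLe _ ht] at hp
    rw [ha'e _ ht, hNN' _ (hsub ht), hLe _ ht]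
    exact hp
  have hL0 : L 0 = l0 := prim_zero _ _
  have hprof := hcoef.eq_profile hτ hGc hf'c (hft.mono hopen hQsub) (hfx.mono hopen hQsub) hpde'
    (fun x hx => by rw [hsol.f_init x hx, hG0 x hx, hL0])
    (fun t ht => by rw [hsol.f_bdry t (hsub ht), hGb t (hsub ht)])
  have hf'1e : ∀ t ∈ Icc 0 τ, f' t 1 = G (L t - P.zeta * prim 0 N t) := fun t ht => by
    simpa using hprof t ht 1 (by simp)
  have hΛ : 0 < Λ := one_pos.trans_le hbox.one_le
  -- Gronwall with zero initial difference; the trace at `x = 1` depends on the interface through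
  -- the Lipschitz profile.
  have hLl : ∀ t ∈ Icc 0 τ, L t - l t = 0 := by
    refine eq_zero_of_abs_deriv_le_mul_abs_self_of_eq_zero_right (K := n1 * (Λ * (1 + D)))
      (f' := fun t => a' t - a t)
      (fun t _ => ((hLd t).sub (hs.deriv_l t)).continuousAt.continuousWithinAt)
      (fun t _ => ((hLd t).sub (hs.deriv_l t)).hasDerivWithinAt) (by rw [hL0, hl0, sub_self]) ?_
    intro t ht
    have htI : t ∈ Icc 0 τ := Ico_subset_Icc_self ht
    rw [ha'e t htI, hNN' t (hsub htI), hs.eq_F t (hsub htI), P.F_eq_mul, P.F_eq_mul (l t), ← mul_sub,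
      Real.norm_eq_abs, Real.norm_eq_abs, abs_mul, abs_of_pos (hNp t), mul_assoc]
    refine mul_le_mul (hN1 t) ?_ (abs_nonneg _) ((hNp t).le.trans (hN1 t))
    refine (hbox.lip _ (mem_Icc_of_abs_sub_le (hl' t htI)) _
      (mem_Icc_of_abs_sub_le (hs.l_lt t (hsub htI)).le) _ (mem_Icc_of_abs_sub_le (hf' t htI)) _
      (mem_Icc_of_abs_sub_le (hs.G_lt t (hsub htI)).le)).trans ?_
    rw [mul_assoc]
    refine mul_le_mul_of_nonneg_left ?_ hΛ.le
    have h1 := hGL (L t - P.zeta * prim 0 N t) (l t - P.zeta * prim 0 N t)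
    rw [sub_sub_sub_cancel_right, ← hf'1e t htI] at h1
    rw [hLe t htI]
    linarith
  intro t ht
  have h1 : L t = l t := sub_eq_zero.mp (hLl t ht)
  exact ⟨by rw [hLe t ht, h1], fun x hx => by rw [hprof t ht x hx, h1]⟩

/-- Uniqueness of solutions: a solution cannot leave the box, since it agrees with the profile
solution as long as it stays there. -/
theorem Extruder.IsProfileSolution.eq_of_isSolution
    (hs : P.IsProfileSolution T le fpe r N l a G) (hT : 0 < T) (hbox : P.IsBox le fpe r Λ)
    (hN : Continuous N) (hNp : ∀ t, 0 < N t) (hN1 : ∀ t, N t ≤ n1)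
    (hNN' : ∀ t ∈ Icc 0 T, N' t = N t) (hGL : ∀ x y, |G x - G y| ≤ D * |x - y|) (hD : 0 ≤ D)
    (hl0 : l 0 = l0) (hG0 : ∀ x ∈ Icc (0 : ℝ) 1, f0 x = G (l0 * x))
    (hGb : ∀ t ∈ Icc 0 T, P.inflow Fi N' t = G (-(P.zeta * prim 0 N t)))
    (hsol : P.IsSolution T l0 f0 Fi N' l' f') :
    ∀ t ∈ Icc 0 T, l' t = l t ∧
      ∀ x ∈ Icc (0 : ℝ) 1, f' t x = G (l t * x - P.zeta * prim 0 N t) := by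
  have hlc : Continuous l := continuous_iff_continuousAt.mpr fun t => (hs.deriv_l t).continuousAt
  have hMc : Continuous fun t => P.zeta * prim 0 N t :=
    (continuous_prim fun a b => hN.intervalIntegrable a b).const_mul _
  have hGc : Continuous G := by
    refine (LipschitzWith.of_dist_le_mul (K := D.toNNReal) fun x y => ?_).continuous
    rw [Real.coe_toNNReal _ hD, Real.dist_eq, Real.dist_eq]
    exact hGL x y
  have hl'c := hsol.l_mem.1
  have hf'1 : ContinuousOn (fun t => f' t 1) (Icc 0 T) :=
    hsol.f_cont.comp (f := fun t => (t, (1 : ℝ))) (continuousOn_id.prodMk continuousOn_const)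
      fun t ht => ⟨ht, by simp⟩
  have key : ∀ {τ : ℝ}, 0 < τ → τ ≤ T → (∀ t ∈ Icc 0 τ, |l' t - le| ≤ r) →
      (∀ t ∈ Icc 0 τ, |f' t 1 - fpe| ≤ r) → ∀ t ∈ Icc 0 τ, l' t = l t ∧
        ∀ x ∈ Icc (0 : ℝ) 1, f' t x = G (l t * x - P.zeta * prim 0 N t) :=
    hs.eq_of_isSolution_of_mem_box hbox hN hNp hN1 hNN' hGL hD hl0 hG0 hGb hsol
  -- Times at which the competitor is not strictly inside the box. At the least such time it still
  -- agrees with the profile solution, by continuity or, at time zero, by the data; but that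
  -- solution is strictly inside.
  set S : Set ℝ := {t ∈ Icc 0 T | max |l' t - le| |f' t 1 - fpe| ∈ Ici r} with hS
  have hSc : IsClosed S :=
    ((hl'c.sub continuousOn_const).abs.sup (hf'1.sub continuousOn_const).abs).preimage_isClosed_of_isClosed
      isClosed_Icc isClosed_Ici
  have hSe : S = ∅ := by
    by_contra hne
    obtain ⟨σ, hσS, hσ⟩ := (isCompact_Icc.of_isClosed_subset hSc fun t ht => ht.1).exists_isLeast
      (nonempty_iff_ne_empty.mpr hne)
    have hgood : ∀ t ∈ Icc 0 T, t < σ → |l' t - le| < r ∧ |f' t 1 - fpe| < r := by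
      intro t ht htσ
      have : t ∉ S := fun h' => absurd (hσ h') (not_le.mpr htσ)
      by_contra h'
      refine this ⟨ht, ?_⟩
      rw [mem_Ici, le_max_iff]
      by_contra h''
      rw [not_or, not_le, not_le] at h''
      exact h' h''
    have h0I : (0 : ℝ) ∈ Icc 0 T := ⟨le_rfl, hT.le⟩
    have heq : l' σ = l σ ∧ f' σ 1 = G (l σ - P.zeta * prim 0 N σ) := by
      rcases hσS.1.1.eq_or_lt with h0 | h0
      · rw [← h0, hsol.l_init, hsol.f_init 1 (by simp), hG0 1 (by simp), prim_zero, hl0]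
        simp
      · have hlt : ∀ t ∈ Ico 0 σ, l' t = l t ∧ f' t 1 = G (l t - P.zeta * prim 0 N t) := by
          intro t ht
          obtain ⟨τ, hτ1, hτ2⟩ := exists_between ht.2
          have hτT : τ ≤ T := hτ2.le.trans hσS.1.2
          have hgood' : ∀ s ∈ Icc 0 τ, |l' s - le| < r ∧ |f' s 1 - fpe| < r := fun s hs' =>
            hgood s ⟨hs'.1, hs'.2.trans hτT⟩ (hs'.2.trans_lt hτ2)
          have := key (ht.1.trans_lt hτ1) hτT (fun s hs' => (hgood' s hs').1.le)
            (fun s hs' => (hgood' s hs').2.le) t ⟨ht.1, hτ1.le⟩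
          exact ⟨this.1, by simpa using this.2 1 (by simp)⟩
        have hsub : Icc 0 σ ⊆ Icc 0 T := Icc_subset_Icc_right hσS.1.2
        have hcl : Icc 0 σ ⊆ closure (Ico 0 σ) := by rw [closure_Ico h0.ne]
        have e1 : EqOn l' l (Icc 0 σ) := EqOn.of_subset_closure (fun t ht => (hlt t ht).1)
          (hl'c.mono hsub) hlc.continuousOn Ico_subset_Icc_self hcl
        have e2 : EqOn (fun t => f' t 1) (fun t => G (l t - P.zeta * prim 0 N t)) (Icc 0 σ) :=
          EqOn.of_subset_closure (fun t ht => (hlt t ht).2)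
            (hf'1.mono hsub) (hGc.comp (hlc.sub hMc)).continuousOn Ico_subset_Icc_self hcl
        exact ⟨e1 ⟨h0.le, le_rfl⟩, e2 ⟨h0.le, le_rfl⟩⟩
    have h1 := hs.l_lt σ hσS.1
    have h2 := hs.G_lt σ hσS.1
    rw [← heq.2] at h2
    rw [← heq.1] at h1
    exact absurd hσS.2 (not_le.mpr (max_lt h1 h2))
  have hall : ∀ t ∈ Icc 0 T, |l' t - le| ≤ r ∧ |f' t 1 - fpe| ≤ r := by
    intro t ht
    have : t ∉ S := by rw [hSe]; simp
    have h1 : ¬ r ≤ max |l' t - le| |f' t 1 - fpe| := fun h' => this ⟨ht, h'⟩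
    rw [not_le, max_lt_iff] at h1
    exact ⟨h1.1.le, h1.2.le⟩
  exact key hT le_rfl (fun t ht => (hall t ht).1) (fun t ht => (hall t ht).2)

end Uniqueness

/-! ### The profile solution solves the problem; preparation of the data -/

section Existence

lemma HasWeakDeriv.congr_right {E : Type*} [NormedAddCommGroup E] [NormedSpace ℝ E] [MeasureSpace E]
    [BorelSpace E] [FiniteDimensional ℝ E] {Ω : Set E} (hΩ : IsOpen Ω) {e : E} {u v v' : E → ℝ}
    (h : HasWeakDeriv Ω e u v) (hv : ∀ x ∈ Ω, v' x = v x) : HasWeakDeriv Ω e u v' := by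
  have : ProperSpace E := FiniteDimensional.proper ℝ E
  refine ⟨h.1, ?_, fun φ hφ hc hs => ?_⟩
  · rw [locallyIntegrableOn_iff hΩ.isLocallyClosed]
    intro k hk hkc
    exact (h.2.1.integrableOn_compact_subset hk hkc).congr_fun (fun x hx => (hv x (hk hx)).symm)
      hkc.measurableSet
  · rw [h.2.2 φ hφ hc hs]
    exact congrArg _ (setIntegral_congr_fun hΩ.measurableSet fun x hx => by simp only [hv x hx])

lemma w1infNorm_le {a b A B : ℝ} (hA : 0 ≤ A) (hB : 0 ≤ B) {u v : ℝ → ℝ}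
    (h : HasWeakDeriv (Ioo a b) 1 u v) (hu : ∀ t ∈ Ioo a b, |u t| ≤ A)
    (hv : ∀ t ∈ Ioo a b, |v t| ≤ B) : w1infNorm a b u ≤ ENNReal.ofReal (A + B) := by
  rw [ENNReal.ofReal_add hA hB]
  exact (iInf₂_le v h).trans (add_le_add (normLp_top_le_of_bound measurableSet_Ioo hu)
    (normLp_top_le_of_bound measurableSet_Ioo hv))

lemma w1infNormQ_le {T A B C : ℝ} (hA : 0 ≤ A) (hB : 0 ≤ B) (hC : 0 ≤ C) {f : ℝ → ℝ → ℝ}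
    {ft fx : ℝ × ℝ → ℝ} (ht : HasWeakDeriv (rectQ T) (1, 0) (fun p => f p.1 p.2) ft)
    (hx : HasWeakDeriv (rectQ T) (0, 1) (fun p => f p.1 p.2) fx)
    (hf : ∀ p ∈ rectQ T, |f p.1 p.2| ≤ A) (hft : ∀ p ∈ rectQ T, |ft p| ≤ B)
    (hfx : ∀ p ∈ rectQ T, |fx p| ≤ C) : w1infNormQ T f ≤ ENNReal.ofReal (A + B + C) := by
  have hm : MeasurableSet (rectQ T) := measurableSet_Ioo.prod measurableSet_Ioo
  rw [ENNReal.ofReal_add (add_nonneg hA hB) hC, ENNReal.ofReal_add hA hB]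
  refine (iInf₂_le ft fx).trans ((iInf₂_le ht hx).trans ?_)
  exact add_le_add (add_le_add (normLp_top_le_of_bound hm hf) (normLp_top_le_of_bound hm hft))
    (normLp_top_le_of_bound hm hfx)

/-- Doubling `ε` gives the strict inequality needed to extract representatives from an infimum. -/
lemma exists_isH2Rep_of_h2Norm_sub_le {a b c ε : ℝ} (hab : a < b) (hε : 0 < ε) {u : ℝ → ℝ}
    (hu : ContinuousOn u (Icc a b)) (h : h2Norm a b (fun x => u x - c) ≤ ENNReal.ofReal ε) :
    ∃ v w, IsH2Rep a b u v w ∧ normLp (Ioo a b) 2 (fun x => u x - c) ≤ ENNReal.ofReal (2 * ε) ∧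
      normLp (Ioo a b) 2 v ≤ ENNReal.ofReal (2 * ε) ∧
      normLp (Ioo a b) 2 w ≤ ENNReal.ofReal (2 * ε) := by
  have hlt : ENNReal.ofReal ε < ENNReal.ofReal (2 * ε) :=
    (ENNReal.ofReal_lt_ofReal_iff (by positivity)).mpr (by linarith)
  obtain ⟨v, w, hr, h0, h1, h2⟩ :=
    exists_isH2Rep_of_h2Norm_lt hab (hu.sub continuousOn_const) (h.trans_lt hlt)
  refine ⟨v, w, ?_, h0, h1, h2⟩
  simpa using hr.sub_const (-c)

lemma IsH2Rep.abs_le_of_normLp_le {c δ : ℝ} (hδ : 0 ≤ δ) {u v w : ℝ → ℝ} (h : IsH2Rep 0 1 u v w)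
    (h0 : normLp (Ioo 0 1) 2 (fun x => u x - c) ≤ ENNReal.ofReal δ)
    (h1 : normLp (Ioo 0 1) 2 v ≤ ENNReal.ofReal δ)
    (h2 : normLp (Ioo 0 1) 2 w ≤ ENNReal.ofReal δ) : |u 0 - c| ≤ 2 * δ ∧ |v 0| ≤ 2 * δ := by
  have hv := h.continuousOn_snd zero_le_one
  have hs := h.sub_const c
  have hvL : MemLp v 2 (volume.restrict (Ioo 0 1)) :=
    ⟨(hv.mono Ioo_subset_Icc_self).aestronglyMeasurable measurableSet_Ioo,
      h1.trans_lt ENNReal.ofReal_lt_top⟩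
  have e1 := abs_le_of_normLp_two_le zero_lt_one hδ (hs.continuousOn zero_le_one) hvL hs.fst h0 h1
    0 (by simp)
  have e2 := abs_le_of_normLp_two_le zero_lt_one hδ hv h.memLp h.snd h1 h2 0 (by simp)
  norm_num at e1 e2
  exact ⟨e1, e2⟩

/-- Constant extension beyond `[0, T]` keeps the sup bound on the whole line, and the bound `2 ε ≤
1` on the weak derivative gives Lipschitz constant one on `[0, T]`. -/
lemma exists_continuous_extension {T c ε : ℝ} (hT : 0 < T) (hε : 0 < ε) (hε1 : 2 * ε ≤ 1)
    {N : ℝ → ℝ} (hN : ContinuousOn N (Icc 0 T))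
    (h : w1infNorm 0 T (fun t => N t - c) ≤ ENNReal.ofReal ε) :
    ∃ N' : ℝ → ℝ, Continuous N' ∧ (∀ t ∈ Icc 0 T, N t = N' t) ∧ (∀ t, |N' t - c| ≤ 2 * ε) ∧
      LipschitzOnWith 1 N' (Icc 0 T) := by
  have hlt : ENNReal.ofReal ε < ENNReal.ofReal (2 * ε) :=
    (ENNReal.ofReal_lt_ofReal_iff (by positivity)).mpr (by linarith)
  obtain ⟨v, hv, huv, hb, hvb⟩ :=
    exists_of_w1infNorm_lt hT (hN.sub continuousOn_const) (h.trans_lt hlt)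
  have hEq : ∀ t ∈ Icc 0 T, N t = IccExtend hT.le ((Icc 0 T).domRestrict N) t := fun t ht => by
    rw [IccExtend_of_mem _ _ ht]; rfl
  refine ⟨IccExtend hT.le ((Icc 0 T).domRestrict N), ?_, hEq, fun t => ?_, ?_⟩
  · exact (continuousOn_iff_continuous_domRestrict.mp hN).Icc_extend'
  · exact hb _ (projIcc 0 T hT.le t).2
  · refine LipschitzOnWith.of_dist_le_mul fun x hx y hy => ?_
    rw [← hEq x hx, ← hEq y hy, Real.dist_eq, Real.dist_eq]
    have hi : ∀ z ∈ Icc 0 T, IntervalIntegrable v volume 0 z := fun z hz => hv.mono_set (by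
      rw [uIcc_of_le hz.1, uIcc_of_le hT.le]; exact Icc_subset_Icc_right hz.2)
    have e : N x - N y = ∫ z in y..x, v z := by
      rw [← intervalIntegral.integral_interval_sub_left (hi x hx) (hi y hy)]
      have hx' := huv x hx
      have hy' := huv y hy
      simp only [Pi.sub_apply] at hx' hy'
      linarith
    rw [e, ← Real.norm_eq_abs]
    refine (intervalIntegral.norm_integral_le_of_norm_le_const_ae (C := 1) ?_).trans (by simp)
    have hne : ∀ᵐ z : ℝ, z ≠ T := by simp [ae_iff]
    filter_upwards [hvb, hne] with z hz hzT hzm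
    rw [Real.norm_eq_abs]
    refine (hz ⟨?_, lt_of_le_of_ne ?_ hzT⟩).trans hε1
    · exact (le_min hy.1 hx.1).trans_lt hzm.1
    · exact hzm.2.trans (max_le hy.2 hx.2)

variable {G g1 l a m n : ℝ → ℝ}

/-- Chain rule for the `C¹` profile. The shift `c` serves both the solution (`c = 0`) and its
deviation from the equilibrium (`c = fpe`). -/
lemma hasWeakDeriv_profile_time (hG : ∀ z, HasDerivAt G (g1 z) z) (hg1 : Continuous g1)
    (hl : ∀ t, HasDerivAt l (a t) t) (ha : Continuous a) (hm : ∀ t, HasDerivAt m (n t) t)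
    (hn : Continuous n) (c : ℝ) (Ω : Set (ℝ × ℝ)) :
    HasWeakDeriv Ω (1, 0) (fun p => G (l p.1 * p.2 - m p.1) - c)
      (fun p => g1 (l p.1 * p.2 - m p.1) * (a p.1 * p.2 - n p.1)) := by
  have hGc : Continuous G := continuous_iff_continuousAt.mpr fun t => (hG t).continuousAt
  have hlc : Continuous l := continuous_iff_continuousAt.mpr fun t => (hl t).continuousAt
  have hmc : Continuous m := continuous_iff_continuousAt.mpr fun t => (hm t).continuousAt
  refine .of_hasLineDerivAt (by fun_prop) (by fun_prop) fun p => ?_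
  have h0 : HasDerivAt (fun s : ℝ => p.1 + s) 1 0 := (hasDerivAt_id 0).const_add p.1
  have h1 : HasDerivAt (fun s : ℝ => l (p.1 + s)) (a p.1) 0 := by
    simpa [Function.comp_def] using (HasDerivAt.comp (0 : ℝ) (by simpa using hl p.1) h0)
  have h2 : HasDerivAt (fun s : ℝ => m (p.1 + s)) (n p.1) 0 := by
    simpa [Function.comp_def] using (HasDerivAt.comp (0 : ℝ) (by simpa using hm p.1) h0)
  have h3 := HasDerivAt.comp (0 : ℝ) (h₂ := G) (h₂' := g1 (l p.1 * p.2 - m p.1))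
    (by simpa using hG (l p.1 * p.2 - m p.1)) ((h1.mul_const p.2).sub h2)
  simpa [HasLineDerivAt, Function.comp_def] using h3.sub_const c

lemma hasWeakDeriv_profile_space (hG : ∀ z, HasDerivAt G (g1 z) z) (hg1 : Continuous g1)
    (hl : Continuous l) (hm : Continuous m) (c : ℝ) (Ω : Set (ℝ × ℝ)) :
    HasWeakDeriv Ω (0, 1) (fun p => G (l p.1 * p.2 - m p.1) - c)
      (fun p => g1 (l p.1 * p.2 - m p.1) * l p.1) := by
  have hGc : Continuous G := continuous_iff_continuousAt.mpr fun t => (hG t).continuousAt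
  refine .of_hasLineDerivAt (by fun_prop) (by fun_prop) fun p => ?_
  have h0 : HasDerivAt (fun s : ℝ => p.2 + s) 1 0 := (hasDerivAt_id 0).const_add p.2
  have h3 := HasDerivAt.comp (0 : ℝ) (h₂ := G) (h₂' := g1 (l p.1 * p.2 - m p.1))
    (by simpa using hG (l p.1 * p.2 - m p.1)) ((h0.const_mul (l p.1)).sub_const (m p.1))
  simpa [HasLineDerivAt, Function.comp_def] using h3.sub_const c

/-- The coordinate `z = l x - ζ ∫ N` satisfies `∂ₜ z + α ∂ₓ z = 0`, because `∂ₜ z = x l' - ζ N` and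
`∂ₓ z = l`. -/
theorem Extruder.IsProfileSolution.isSolution {P : Extruder} {T le fpe r l0 A : ℝ}
    {f0 Fi N N' : ℝ → ℝ} (hs : P.IsProfileSolution T le fpe r N l a G)
    (hG : ∀ z, HasDerivAt G (g1 z) z) (hg1 : Continuous g1) (hN : Continuous N)
    (hr : 0 < r) (hle : 0 < le - r) (hNN' : ∀ t ∈ Icc 0 T, N' t = N t) (hA : 0 ≤ A)
    (hl0 : l 0 = l0) (haA : ∀ t ∈ Icc 0 T, |a t| ≤ A)
    (hG0 : ∀ x ∈ Icc (0 : ℝ) 1, f0 x = G (l0 * x))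
    (hGb : ∀ t ∈ Icc 0 T, P.inflow Fi N' t = G (-(P.zeta * prim 0 N t))) :
    P.IsSolution T l0 f0 Fi N' l (fun t x => G (l t * x - P.zeta * prim 0 N t)) := by
  have hGc : Continuous G := continuous_iff_continuousAt.mpr fun t => (hG t).continuousAt
  have hlc : Continuous l := continuous_iff_continuousAt.mpr fun t => (hs.deriv_l t).continuousAt
  have hm : ∀ t, HasDerivAt (fun t => P.zeta * prim 0 N t) (P.zeta * N t) t :=
    fun t => (hasDerivAt_prim hN t).const_mul _
  have hmc : Continuous fun t => P.zeta * prim 0 N t :=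
    continuous_iff_continuousAt.mpr fun t => (hm t).continuousAt
  have hla : HasWeakDeriv (Ioo 0 T) 1 l a :=
    .of_hasLineDerivAt hlc hs.cont_a fun t => by
      have := (hs.deriv_l t).hasFDerivAt.hasLineDerivAt 1
      simpa using this
  refine ⟨⟨hlc.continuousOn, ?_⟩, ?_, ?_, hl0, ?_, ?_, ?_⟩
  · refine (w1infNorm_le (A := le + r) (B := A) ?_ hA hla (fun t ht => ?_) fun t ht =>
      haA t (Ioo_subset_Icc_self ht)).trans_lt ENNReal.ofReal_lt_top
    · linarith
    · have := abs_lt.mp (hs.l_lt t (Ioo_subset_Icc_self ht))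
      rw [abs_of_pos] <;> linarith
  · exact (hGc.comp (((hlc.comp continuous_fst).mul continuous_snd).sub
      (hmc.comp continuous_fst))).continuousOn
  · refine hla.congr_right isOpen_Ioo fun t ht => ?_
    have ht' := Ioo_subset_Icc_self ht
    rw [hs.eq_F t ht', hNN' t ht', mul_one]
  · have ht := hasWeakDeriv_profile_time hG hg1 hs.deriv_l hs.cont_a hm (hN.const_mul _) 0 (rectQ T)
    have hx := hasWeakDeriv_profile_space hG hg1 hlc hmc 0 (rectQ T)
    simp only [sub_zero] at ht hx
    refine ⟨_, _, ht, hx, ?_⟩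
    · refine (ae_restrict_iff' (measurableSet_Ioo.prod measurableSet_Ioo)).mpr (.of_forall ?_)
      intro p hp
      have ht' := Ioo_subset_Icc_self hp.1
      have hlp : l p.1 ≠ 0 := by
        have := (abs_lt.mp (hs.l_lt p.1 ht')).1
        exact (by linarith : 0 < l p.1).ne'
      simp only [Extruder.alpha, mul_one]
      rw [hNN' p.1 ht', ← hs.eq_F p.1 ht']
      field_simp
      ring
  · intro x hx
    simp only [prim_zero, hl0, mul_zero, sub_zero]
    exact (hG0 x hx).symm
  · intro t ht
    simp only [mul_zero, zero_sub]
    exact (hGb t ht).symm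

end Existence

/-! ### Assembly and choice of constants -/

theorem theorem2 (P : Extruder) (T : ℝ) (hT : 0 < T)
    -- a constant equilibrium
    (le Ne fpe : ℝ) (hle : le ∈ Ioo 0 P.L) (hNe : 0 < Ne) (hfpe : fpe ∈ Ioo (0 : ℝ) 1)
    (heq : P.F le Ne fpe = 0) :
    ∃ ε₀ > 0, ∃ C > 0, ∀ ε : ℝ, 0 < ε → ε ≤ ε₀ →
      ∀ (l0 : ℝ) (f0 Fi N : ℝ → ℝ),
        l0 ∈ Ioo 0 P.L → MemW1inf 0 T Fi → MemW1inf 0 T N →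
        MemH2 0 1 f0 → MemH2 0 T (P.inflow Fi N) →
        -- compatibility conditions of order zero and one at the corner
        P.inflow Fi N 0 = f0 0 →
        derivWithin f0 (Icc 0 1) 0
          + l0 / (P.zeta * N 0) * derivWithin (P.inflow Fi N) (Icc 0 T) 0 = 0 →
        -- smallness
        h2Norm 0 1 (fun x => f0 x - fpe) + h2Norm 0 T (fun t => P.inflow Fi N t - fpe)
          + w1infNorm 0 T (fun t => N t - Ne) + ENNReal.ofReal |l0 - le| ≤ ENNReal.ofReal ε →
        ∃ (l : ℝ → ℝ) (f : ℝ → ℝ → ℝ),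
          P.IsSolution T l0 f0 Fi N l f ∧
          (∀ t ∈ Icc 0 T, l t ∈ Ioo 0 P.L) ∧
          (∀ t ∈ Icc 0 T, ∀ x ∈ Icc (0 : ℝ) 1, f t x ∈ Ioo (0 : ℝ) 1) ∧
          MemW1infQ T f ∧ MemC0H2 T f ∧
          -- estimates
          (∀ t ∈ Icc 0 T, h2Norm 0 1 (fun x => f t x - fpe) ≤ ENNReal.ofReal (C * ε)) ∧
          w1infNormQ T (fun t x => f t x - fpe) ≤ ENNReal.ofReal (C * ε) ∧
          w1infNorm 0 T (fun t => l t - le) ≤ ENNReal.ofReal (C * ε) ∧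
          -- uniqueness, in either regularity class
          ∀ (l' : ℝ → ℝ) (f' : ℝ → ℝ → ℝ), P.IsSolution T l0 f0 Fi N l' f' →
            (MemC0H2 T f' ∨ MemW1infQ T f') →
            (∀ t ∈ Icc 0 T, l' t = l t) ∧
            (∀ t ∈ Icc 0 T, ∀ x ∈ Icc (0 : ℝ) 1, f' t x = f t x) := by
  obtain ⟨r, Λ, hbox⟩ := P.exists_isBox hle hNe hfpe heq
  have hr := hbox.r_pos
  have hlr := hbox.l_pos
  have hLp := P.L_pos
  have hζ := P.zeta_pos
  obtain ⟨Cp, hCp, hprof⟩ := exists_profile (T := T) (ζ := P.zeta) (la := le / 2) (lb := P.L)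
    (n0 := Ne / 2) (n1 := 2 * Ne) hT P.zeta_pos (half_pos hle.1) P.L_pos (half_pos hNe)
    (by positivity)
  -- The profile is used with `κ = 4 ε`, giving `4 Cp`; the added `4` covers `|f0 0 - fpe| ≤ 4 ε`.
  obtain ⟨C1, hC1⟩ : ∃ C1, C1 = 4 * Cp + 4 := ⟨_, rfl⟩
  have hC1p : 0 < C1 := by rw [hC1]; positivity
  obtain ⟨ε₁, hε₁, Ci, hCi, hint⟩ :=
    P.exists_interface hT hbox (n1 := 2 * Ne) (by positivity) hC1p
  -- The summands control a slice minus `fpe`, its first derivative `l G'`, and the `L²` norm of its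
  -- second derivative `l² G''`.
  obtain ⟨K, hK⟩ : ∃ K, K = Ci + P.L * C1 + P.L ^ 2 * √(1 / (le - r)) * C1 := ⟨_, rfl⟩
  have hKp : 0 < K := by rw [hK]; positivity
  obtain ⟨C, hC⟩ : ∃ C, C = 2 * K + (Ci + C1 * (Ci + P.zeta * (2 * Ne)) + C1 * P.L) + 2 * Ci :=
    ⟨_, rfl⟩
  have hCK : 2 * K ≤ C := by
    have : 0 < Ci + C1 * (Ci + P.zeta * (2 * Ne)) + C1 * P.L := by positivity
    linarith
  have hCQ : Ci + C1 * (Ci + P.zeta * (2 * Ne)) + C1 * P.L ≤ C := by linarith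
  have hCl : 2 * Ci ≤ C := by
    have : 0 < Ci + C1 * (Ci + P.zeta * (2 * Ne)) + C1 * P.L := by positivity
    linarith
  have hCp' : 0 < C := by linarith
  -- `1 / 2` makes `N` Lipschitz with constant one, `Ne / 4` keeps `N` between `Ne / 2` and `2 Ne`,
  -- and `le / 2` keeps `l0` above `le / 2`.
  refine ⟨min (min ε₁ (1 / 2)) (min (Ne / 4) (le / 2)), ?_, C, hCp', ?_⟩
  · have := hle.1
    positivity
  intro ε hε hεle l0 f0 Fi N hl0 hFi hN hf0 hh hcomp0 hcomp1 hsmall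
  have hε1 : ε ≤ ε₁ := hεle.trans ((min_le_left _ _).trans (min_le_left _ _))
  have hε2 : ε ≤ 1 / 2 := hεle.trans ((min_le_left _ _).trans (min_le_right _ _))
  have hε3 : ε ≤ Ne / 4 := hεle.trans ((min_le_right _ _).trans (min_le_left _ _))
  have hε4 : ε ≤ le / 2 := hεle.trans ((min_le_right _ _).trans (min_le_right _ _))
  have hs4 := le_add_self.trans hsmall
  have hs3 := (le_self_add (a := _ + _) (b := _)).trans hsmall
  have hs2 := (le_self_add (a := _ + _) (b := _)).trans hs3
  rw [ENNReal.ofReal_le_ofReal_iff hε.le] at hs4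
  obtain ⟨v0, w0, hr0, hu0', hv0', hw0'⟩ := exists_isH2Rep_of_h2Norm_sub_le zero_lt_one hε hf0.1
    (le_self_add.trans hs2)
  obtain ⟨vh, wh, hrh, -, hvh', hwh'⟩ := exists_isH2Rep_of_h2Norm_sub_le hT hε hh.1
    (le_add_self.trans hs2)
  obtain ⟨N', hN'c, hNN', hN'b, hN'L⟩ := exists_continuous_extension hT hε (by linarith) hN.1
    (le_add_self.trans hs3)
  obtain ⟨hu00, hv00⟩ := hr0.abs_le_of_normLp_le (by positivity) hu0' hv0' hw0'
  have hN'0 : ∀ t, Ne / 2 ≤ N' t := fun t => by linarith [(abs_le.mp (hN'b t)).1]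
  have hN'1 : ∀ t, N' t ≤ 2 * Ne := fun t => by linarith [(abs_le.mp (hN'b t)).2]
  have hN'p : ∀ t, 0 < N' t := fun t => (half_pos hNe).trans_le (hN'0 t)
  have hmono : ENNReal.ofReal (2 * ε) ≤ ENNReal.ofReal (4 * ε) :=
    ENNReal.ofReal_le_ofReal (by linarith)
  rw [hr0.derivWithin_eq zero_lt_one (by simp), hrh.derivWithin_eq hT (by simp [hT.le]),
    hNN' 0 (by simp [hT.le])] at hcomp1
  -- `κ = 4 ε`: extracting representatives costs a factor `2`, and the pointwise embedding on `(0,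
  -- 1)` another.
  obtain ⟨c1, g2, hg2, hg2n, hg1b, hG0, hGb⟩ := hprof (4 * ε) l0 N' f0 v0 w0 _ vh wh (by positivity)
    (by linarith [(abs_le.mp hs4).1]) hl0.2.le hN'c hN'0 hN'1 hN'L hr0 hrh hcomp0 hcomp1
    (by linarith) (hw0'.trans hmono) (hvh'.trans hmono) (hwh'.trans hmono)
  have hCε : Cp * (4 * ε) ≤ C1 * ε := by
    rw [hC1, add_mul]; linarith [mul_pos hCp hε]
  replace hg1b := fun z => (hg1b z).trans hCε
  replace hg2n := hg2n.trans (ENNReal.ofReal_le_ofReal hCε)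
  have hg1c : Continuous (prim c1 g2) := continuous_prim hg2.intervalIntegrable
  set G := prim (f0 0) (prim c1 g2) with hGdef
  have hGd : ∀ z, HasDerivAt G (prim c1 g2 z) z := hasDerivAt_prim hg1c
  have hG00 : G 0 = f0 0 := prim_zero _ _
  have hGfpe : |G 0 - fpe| ≤ C1 * ε := by
    rw [hG00, hC1, add_mul]; linarith [mul_pos hCp hε]
  have hGL : ∀ x y, |G x - G y| ≤ C1 * ε * |x - y| := fun x y =>
    convex_univ.norm_image_sub_le_of_norm_hasDerivWithin_le
      (fun z _ => (hGd z).hasDerivWithinAt) (fun z _ => hg1b z) (mem_univ y) (mem_univ x)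
  have hG0' : ∀ x ∈ Icc (0 : ℝ) 1, f0 x = G (l0 * x) := fun x hx => by
    rw [hG0 (l0 * x) ⟨mul_nonneg hl0.1.le hx.1, mul_le_of_le_one_right hl0.1.le hx.2⟩,
      mul_div_cancel_left₀ _ hl0.1.ne']
  have hGb' : ∀ t ∈ Icc 0 T, P.inflow Fi N t = G (-(P.zeta * prim 0 N' t)) :=
    fun t ht => (hGb t ht).symm
  obtain ⟨l, a, hac, hla, hl00, hI⟩ := hint ε l0 N' G (prim c1 g2) hε hε1 hs4 hN'c
    (fun t => (hN'p t).le) hN'1 hGd hg1b hGfpe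
  have hlc : Continuous l := continuous_iff_continuousAt.mpr fun t => (hla t).continuousAt
  have hm : ∀ t, HasDerivAt (fun t => P.zeta * prim 0 N' t) (P.zeta * N' t) t :=
    fun t => (hasDerivAt_prim hN'c t).const_mul _
  have hmc : Continuous fun t => P.zeta * prim 0 N' t :=
    continuous_iff_continuousAt.mpr fun t => (hm t).continuousAt
  have hps : P.IsProfileSolution T le fpe r N' l a G :=
    ⟨hac, hla, fun t ht => (hI t ht).1, fun t ht => (hI t ht).2.2.1,
      fun t ht => by simpa using ((hI t ht).2.2.2.2.2 1 (by simp)).2⟩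
  have haC : ∀ t ∈ Icc 0 T, |a t| ≤ Ci * ε := fun t ht => (hI t ht).2.2.2.1
  have hlI : ∀ t ∈ Icc 0 T, le - r < l t ∧ l t < P.L := fun t ht => by
    have := abs_lt.mp (hps.l_lt t ht)
    have := hbox.l_lt
    constructor <;> linarith
  have hfI : ∀ t ∈ Icc 0 T, ∀ x ∈ Icc (0 : ℝ) 1,
      G (l t * x - P.zeta * prim 0 N' t) ∈ Ioo (0 : ℝ) 1 := fun t ht x hx => by
    have := abs_lt.mp ((hI t ht).2.2.2.2.2 x hx).2
    have := hbox.f_pos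
    have := hbox.f_lt
    constructor <;> linarith
  have hfE : ∀ t ∈ Icc 0 T, ∀ x ∈ Icc (0 : ℝ) 1,
      |G (l t * x - P.zeta * prim 0 N' t) - fpe| ≤ Ci * ε :=
    fun t ht x hx => ((hI t ht).2.2.2.2.2 x hx).1
  have hwt := hasWeakDeriv_profile_time hGd hg1c hla hac hm (hN'c.const_mul _)
  have hwx := hasWeakDeriv_profile_space hGd hg1c hlc hmc
  have hft : ∀ p ∈ rectQ T, |prim c1 g2 (l p.1 * p.2 - P.zeta * prim 0 N' p.1) *
      (a p.1 * p.2 - P.zeta * N' p.1)| ≤ C1 * ε * (Ci + P.zeta * (2 * Ne)) := by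
    intro p hp
    have ht := Ioo_subset_Icc_self hp.1
    rw [abs_mul]
    refine mul_le_mul (hg1b _) ((abs_sub _ _).trans (add_le_add ?_ ?_)) (abs_nonneg _)
      (by positivity)
    · rw [abs_mul, abs_of_pos hp.2.1]
      calc |a p.1| * p.2 ≤ |a p.1| * 1 := mul_le_mul_of_nonneg_left hp.2.2.le (abs_nonneg _)
        _ ≤ Ci * ε := by rw [mul_one]; exact haC _ ht
        _ ≤ Ci := mul_le_of_le_one_right hCi.le (by linarith)
    · rw [abs_of_pos (mul_pos hζ (hN'p _))]
      exact mul_le_mul_of_nonneg_left (hN'1 _) hζ.le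
  have hfx : ∀ p ∈ rectQ T, |prim c1 g2 (l p.1 * p.2 - P.zeta * prim 0 N' p.1) * l p.1|
      ≤ C1 * ε * P.L := by
    intro p hp
    have ht := hlI p.1 (Ioo_subset_Icc_self hp.1)
    rw [abs_mul, abs_of_pos (hlr.trans ht.1)]
    exact mul_le_mul (hg1b _) ht.2.le (hlr.trans ht.1).le (by positivity)
  have hsol := hps.isSolution hGd hg1c hN'c hr hlr hNN' (by positivity) hl00 haC hG0' hGb'
  refine ⟨l, fun t x => G (l t * x - P.zeta * prim 0 N' t), hsol,
    fun t ht => ⟨hlr.trans (hlI t ht).1, (hlI t ht).2⟩, hfI, ⟨hsol.f_cont, ?_⟩,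
    memC0H2_slice hg2 hlc.continuousOn hmc.continuousOn fun t ht => hlr.trans (hlI t ht).1,
    fun t ht => ?_, ?_, ?_, ?_⟩
  · refine (w1infNormQ_le (A := 1) zero_le_one ?_ ?_ (by simpa using hwt 0 _)
      (by simpa using hwx 0 _) (fun p hp => ?_) hft hfx).trans_lt ENNReal.ofReal_lt_top
    · positivity
    · positivity
    · have := hfI p.1 (Ioo_subset_Icc_self hp.1) p.2 (Ioo_subset_Icc_self hp.2)
      rw [abs_of_pos this.1]
      exact this.2.le
  · have hlt := hlI t ht
    have hl0' := hlr.trans hlt.1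
    refine (h2Norm_slice_le hg2 hl0' (P.zeta * prim 0 N' t) (K := K * ε)
      (fun x hx => (hfE t ht x (Ioo_subset_Icc_self hx)).trans ?_) hg1b ?_ hg2n ?_).trans
        (ENNReal.ofReal_le_ofReal ?_)
    · refine mul_le_mul_of_nonneg_right ?_ hε.le
      rw [hK, add_assoc]
      exact le_add_of_nonneg_right (by positivity)
    · calc l t * (C1 * ε) ≤ P.L * (C1 * ε) := mul_le_mul_of_nonneg_right hlt.2.le (by positivity)
        _ ≤ K * ε := by
          rw [← mul_assoc]
          refine mul_le_mul_of_nonneg_right ?_ hε.le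
          have : 0 < P.L ^ 2 * √(1 / (le - r)) * C1 := by positivity
          linarith
    · calc l t ^ 2 * √(1 / l t) * (C1 * ε) ≤ P.L ^ 2 * √(1 / (le - r)) * (C1 * ε) := by
            have h1 : √(1 / l t) ≤ √(1 / (le - r)) :=
              Real.sqrt_le_sqrt (one_div_le_one_div_of_le hlr hlt.1.le)
            have h2 := hlt.2.le
            gcongr
        _ ≤ K * ε := by
          rw [← mul_assoc]
          refine mul_le_mul_of_nonneg_right ?_ hε.le
          have : 0 < P.L * C1 := by positivity
          linarith
    · rw [← mul_assoc]
      exact mul_le_mul_of_nonneg_right hCK hε.le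
  · refine (w1infNormQ_le (A := Ci * ε) (by positivity) ?_ ?_ (hwt fpe _) (hwx fpe _)
      (fun p hp => hfE p.1 (Ioo_subset_Icc_self hp.1) p.2 (Ioo_subset_Icc_self hp.2)) hft
      hfx).trans (ENNReal.ofReal_le_ofReal ?_)
    · positivity
    · positivity
    · calc _ = (Ci + C1 * (Ci + P.zeta * (2 * Ne)) + C1 * P.L) * ε := by ring
        _ ≤ C * ε := mul_le_mul_of_nonneg_right hCQ hε.le
  · have hw : HasWeakDeriv (Ioo 0 T) 1 (fun t => l t - le) a :=
      .of_hasLineDerivAt (hlc.sub continuous_const) hac fun t => by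
        simpa using ((hla t).sub_const le).hasFDerivAt.hasLineDerivAt 1
    refine (w1infNorm_le (A := Ci * ε) (B := Ci * ε) (by positivity) (by positivity) hw
      (fun t ht => (hI t (Ioo_subset_Icc_self ht)).2.1)
      fun t ht => haC t (Ioo_subset_Icc_self ht)).trans (ENNReal.ofReal_le_ofReal ?_)
    calc _ = 2 * Ci * ε := by ring
      _ ≤ C * ε := mul_le_mul_of_nonneg_right hCl hε.le
  · intro l' f' hsol' _
    have hu := hps.eq_of_isSolution hT hbox hN'c hN'p hN'1 hNN' hGL (by positivity) hl00 hG0' hGb'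
      hsol'
    exact ⟨fun t ht => (hu t ht).1, fun t ht => (hu t ht).2⟩
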